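/- Let $(\Omega,\mathfrak F,\mathbb P)$ be a probability space and let $Z=\{Z(x,t):x\in\mathbb S^2,\,t\in\mathbb R\}$ be a real Gaussian random field, jointly measurable in $(\omega,x,t)$, centered, with $\mathbb E[Z(x,t)Z(y,s)]=\Gamma(\langle x,y\rangle,t-s)$ for all $x,y\in\mathbb S^2$, $t,s\in\mathbb R$, where $\Gamma$ is continuous on $[-1,1]\times\mathbb R$, and $\mathbb E[Z(x,t)^2]=1$. Let $P_\ell$ be the Legendre polynomials and let $C_\ell(\tau)=2\pi\int_{-1}^1\Gamma(\theta,\tau)P_\ell(\theta)\,d\theta$ be the coefficients in the expansion $\Gamma(\theta,\tau)=\sum_{\ell\ge0}\frac{2\ell+1}{4\pi}C_\ell(\tau)P_\ell(\theta)$. Put $\widetilde{\mathbb N}=\{\ell\ge0:C_\ell(0)\neq0\}$ and $\sigma_\ell=\sqrt{\tfrac{2\ell+1}{4\pi}C_\ell(0)}$. Let $(Y_{\ell,m})_{-\ell\le m\le\ell}$ be the standard real orthonormal spherical harmonics, and put $$a_{\ell,m}(t)=\int_{\mathbb S^2}Z(x,t)Y_{\ell,m}(x)\,dx,\qquad Z_\ell(x,t)=\sum_{m=-\ell}^{\ell}a_{\ell,m}(t)Y_{\ell,m}(x).$$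 Fix $\alpha\ge2$; for $\beta\in(0,1)$ let $g_\beta(\tau)=(1+|\tau|)^{-\beta}$, and let $g_1(\tau)=(1+|\tau|)^{-\alpha}$. Assume that there are $\beta_\ell\in(0,1]$, $\ell\in\widetilde{\mathbb N}$, and functions $G_\ell$ such that $C_\ell(\tau)=G_\ell(\tau)g_{\beta_\ell}(\tau)$ for all $\ell\in\widetilde{\mathbb N}$ and $\tau\in\mathbb R$, and $\sup_{\ell\in\widetilde{\mathbb N}}|G_\ell(\tau)/C_\ell(0)-1|\to0$ as $\tau\to+\infty$; that $0\in\widetilde{\mathbb N}$; and that $\int_{\mathbb R}C_0(\tau)\,d\tau>0$ if $\beta_0=1$. For $u\in\mathbb R$ and $T>0$ let $$\mathcal A_u(t)=\mathrm{area}\{x\in\mathbb S^2:Z(x,t)\ge u\},\qquad \mathcal M_T(u)=\int_0^T\big(\mathcal A_u(t)-\mathbb E[\mathcal A_u(t)]\big)\,dt,$$ and, with $\phi(v)=(2\pi)^{-1/2}e^{-v^2/2}$, $H_2(v)=v^2-1$ and $\ell\in\widetilde{\mathbb N}$, $$m_{T;\ell}(u)=\frac{u}{2\sigma_\ell}\,\phi\!\left(\frac{u}{\sigma_\ell}\right)\int_{\mathbb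 S^2}\int_0^T H_2\!\left(\frac{Z_\ell(x,t)}{\sigma_\ell}\right)dt\,dx .$$ **Proposition.** Suppose that $\beta_\ell$, over $\ell\in\widetilde{\mathbb N}$ with $\ell\ge1$, attains its minimum at a unique multipole $\ell^\star$. If $u\neq0$ and $2\beta_{\ell^\star}<\min(\beta_0,1)$, then $$\mathrm{Corr}\big(\mathcal M_T(u),\,m_{T;\ell^\star}(u)\big)\longrightarrow1\qquad\text{as }T\to+\infty .$$ -/

import Mathlib

open MeasureTheory ProbabilityTheory Filter Topology

noncomputable section

namespace SphereTime

/-- The unit sphere of `ℝ³`. -/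
abbrev S2 : Type := Metric.sphere (0 : EuclideanSpace ℝ (Fin 3)) 1

/-- The area measure of the unit sphere (total mass `4π`). -/
def area : Measure S2 := (volume : Measure (EuclideanSpace ℝ (Fin 3))).toSphere

/-- The Legendre polynomial `P_ℓ` (Rodrigues' formula). -/
def legendre (ℓ : ℕ) : Polynomial ℝ :=
  Polynomial.C (1 / ((2 : ℝ) ^ ℓ * (ℓ.factorial : ℝ))) *
    Polynomial.derivative^[ℓ] ((Polynomial.X ^ 2 - 1) ^ ℓ)

/-- The standard real spherical harmonic `Y_{ℓ,m}`, `-ℓ ≤ m ≤ ℓ`, in Cartesian coordinates. In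
spherical coordinates, with `x 0 + i x 1 = sin θ e^{iφ}` and `x 2 = cos θ`, it is
`N (sin θ)^|m| P_ℓ^{(|m|)}(cos θ)` times `√2 cos (m φ)` if `m > 0`, times `1` if `m = 0`, and times
`√2 sin (|m| φ)` if `m < 0`, where `N² = (2ℓ+1)/(4π) · (ℓ-|m|)!/(ℓ+|m|)!`. -/
def sphHarm (ℓ : ℕ) (m : ℤ) (x : S2) : ℝ :=
  √((2 * (ℓ : ℝ) + 1) / (4 * Real.pi) *
      (((ℓ - m.natAbs).factorial : ℝ) / ((ℓ + m.natAbs).factorial : ℝ))) *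
    (Polynomial.derivative^[m.natAbs] (legendre ℓ)).eval (x.1 2) *
    (if m = 0 then 1
      else if 0 < m then √2 * ((⟨x.1 0, x.1 1⟩ : ℂ) ^ m.natAbs).re
      else √2 * ((⟨x.1 0, x.1 1⟩ : ℂ) ^ m.natAbs).im)

/-- `Z` is a jointly measurable, centred, mean-square continuous Gaussian field on `S² × ℝ` which is
isotropic in space and stationary in time, with covariance function `Γ : [-1,1] × ℝ → ℝ` (the values
of `Γ` outside this set play no role). -/
structure IsIsotropicStationaryGaussian {Ω : Type*} [MeasurableSpace Ω] (P : Measure Ω)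
    (Z : S2 → ℝ → Ω → ℝ) (Γ : ℝ → ℝ → ℝ) : Prop where
  measurable : Measurable fun p : Ω × S2 × ℝ => Z p.2.1 p.2.2 p.1
  gaussian : IsGaussianProcess (fun p : S2 × ℝ => Z p.1 p.2) P
  centered : ∀ x t, ∫ ω, Z x t ω ∂P = 0
  covariance_eq : ∀ x y t s,
    ∫ ω, Z x t ω * Z y s ω ∂P = Γ (inner ℝ x.1 y.1) (t - s)
  continuousOn : ContinuousOn (fun p : ℝ × ℝ => Γ p.1 p.2) (Set.Icc (-1) 1 ×ˢ Set.univ)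

/-- The coefficients `C_ℓ` in the expansion
`Γ(θ, τ) = ∑_ℓ (2ℓ+1)/(4π) C_ℓ(τ) P_ℓ(θ)`, computed by the orthogonality of the Legendre
polynomials (`∫_{-1}^1 P_ℓ² = 2/(2ℓ+1)`). -/
def coeffC (Γ : ℝ → ℝ → ℝ) (ℓ : ℕ) (τ : ℝ) : ℝ :=
  2 * Real.pi * ∫ θ in (-1 : ℝ)..1, Γ θ τ * (legendre ℓ).eval θ

/-- The set `Ñ` of the multipoles that are present in the field. -/
def activeMultipoles (Γ : ℝ → ℝ → ℝ) : Set ℕ := {ℓ | coeffC Γ ℓ 0 ≠ 0}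

/-- The standard deviation `σ_ℓ` of the `ℓ`-th component, `σ_ℓ² = (2ℓ+1)/(4π) C_ℓ(0)`. -/
def sigma (Γ : ℝ → ℝ → ℝ) (ℓ : ℕ) : ℝ :=
  √((2 * (ℓ : ℝ) + 1) / (4 * Real.pi) * coeffC Γ ℓ 0)

/-- The function `g_β`, where `α` is the exponent used for `β = 1`. -/
def memoryKernel (α β τ : ℝ) : ℝ :=
  if β = 1 then (1 + |τ|) ^ (-α) else (1 + |τ|) ^ (-β)

/-- The memory condition on the coefficients `C_ℓ`: exponents `β_ℓ ∈ (0,1]` with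
`C_ℓ = G_ℓ · g_{β_ℓ}`, `sup_ℓ |G_ℓ(τ)/C_ℓ(0) - 1| → 0` as `τ → +∞`, `C_0(0) ≠ 0`, and
`∫ C_0 > 0` if `β_0 = 1`. -/
structure MemoryCondition (Γ : ℝ → ℝ → ℝ) (α : ℝ) (β : ℕ → ℝ) : Prop where
  two_le_alpha : 2 ≤ α
  beta_mem : ∀ ℓ ∈ activeMultipoles Γ, β ℓ ∈ Set.Ioc (0 : ℝ) 1
  exists_factor : ∃ G : ℕ → ℝ → ℝ,
    (∀ ℓ ∈ activeMultipoles Γ, ∀ τ, coeffC Γ ℓ τ = G ℓ τ * memoryKernel α (β ℓ) τ) ∧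
    TendstoUniformlyOn (fun (τ : ℝ) (ℓ : ℕ) => G ℓ τ / coeffC Γ ℓ 0) (fun _ => 1) atTop
      (activeMultipoles Γ)
  zero_mem : 0 ∈ activeMultipoles Γ
  integral_pos : β 0 = 1 → 0 < ∫ τ, coeffC Γ 0 τ

section Functionals

variable {Ω : Type*} [MeasurableSpace Ω]

/-- The random coefficient `a_{ℓ,m}(t)` of the field. -/
def harmCoeff (Z : S2 → ℝ → Ω → ℝ) (ℓ : ℕ) (m : ℤ) (t : ℝ) (ω : Ω) : ℝ :=
  ∫ x, Z x t ω * sphHarm ℓ m x ∂area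

/-- The monochromatic field `Z_ℓ`. -/
def monoField (Z : S2 → ℝ → Ω → ℝ) (ℓ : ℕ) (x : S2) (t : ℝ) (ω : Ω) : ℝ :=
  ∑ m ∈ Finset.Icc (-(ℓ : ℤ)) (ℓ : ℤ), harmCoeff Z ℓ m t ω * sphHarm ℓ m x

/-- The excursion area `𝒜_u(t)`. -/
def excursionArea (Z : S2 → ℝ → Ω → ℝ) (u t : ℝ) (ω : Ω) : ℝ :=
  area.real {x | u ≤ Z x t ω}

/-- The functional `ℳ_T(u)`. -/
def excursionFunctional (P : Measure Ω) (Z : S2 → ℝ → Ω → ℝ) (u T : ℝ) (ω : Ω) : ℝ :=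
  ∫ t in (0 : ℝ)..T, (excursionArea Z u t ω - ∫ ω', excursionArea Z u t ω' ∂P)

/-- The functional `m_{T;ℓ}(u)`; `Polynomial.hermite 2` is `H₂ = X² - 1` and `gaussianPDFReal 0 1`
is the standard Gaussian density. -/
def monoFunctional (Z : S2 → ℝ → Ω → ℝ) (Γ : ℝ → ℝ → ℝ) (ℓ : ℕ) (u T : ℝ) (ω : Ω) : ℝ :=
  u / (2 * sigma Γ ℓ) * gaussianPDFReal 0 1 (u / sigma Γ ℓ) *
    ∫ x, (∫ t in (0 : ℝ)..T,
      Polynomial.aeval (monoField Z ℓ x t ω / sigma Γ ℓ) (Polynomial.hermite 2)) ∂area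

/-- The correlation coefficient of two random variables. -/
def corr (P : Measure Ω) (X Y : Ω → ℝ) : ℝ :=
  covariance X Y P / √(variance X P * variance Y P)

end Functionals

end SphereTime

end

namespace SphereTime

/-! ### Moments of linear forms on the sphere -/

/-! Almost surely, `monoFunctional` is a deterministic multiple of the time integral of the centred
power `∑ₘ (a_{ℓ,m}(t)² - C_ℓ(0))`, a purely quadratic functional of the field. When `X` is standard
normal and jointly Gaussian with centred `Y`, `W`, the covariance of `1{X ≥ u}` with `Y W` is
exactly `u φ(u) E[XY] E[XW]`. Together with Wick's formula and the Funk–Hecke formula this gives,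
for `J_T = ∬ C_ℓ(t-s)²` over the square of the time window, the value `(2ℓ+1) u φ(u) J_T` for the
covariance of the excursion functional with the power, and `2 (2ℓ+1) J_T` for the variance of the
power. Hence the squared correlation equals `(u² φ(u)² / 2) (2ℓ+1) J_T / Var ℳ_T` for every `T`
(`corr_eq`), and what remains is to show that `Var ℳ_T` is asymptotic to that numerator.

No chaos expansion is needed for the variance. The covariance of two indicators `1{X ≥ u}`, `1{Y ≥
u}` is a function of the correlation `r` whose derivative is the bivariate normal density at `(u,
u)`, so it equals `φ(u)² r + (u² φ(u)² / 2) r²` up to `ε r² + C |r|³`. Put `r = Γ(⟨x,y⟩, τ)` and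
integrate over pairs of points: the linear term becomes a multiple of `C_0(τ)`, the quadratic one a
multiple of `∑ₖ (2k+1) C_k(τ)²` by Parseval, and the rest is controlled by the second and third
absolute moments of `Γ(·, τ)`. Relative to `(1+|τ|)^(-2β)` with `β = β_{ℓ⋆}`, the first is
negligible because `2β < β_0`; the series keeps only the term `k = ℓ⋆`, by dominated convergence and
the uniform bound `|C_k(τ)| ≤ 2 C_k(0) (1+|τ|)^(-β)`; and the third moment is negligible because a
finite Legendre head tends to `0` uniformly while the tail is small in `L²` on the scale of the
kernel. As `2β < 1`, the double integral of the kernel outgrows `T`, so bounded lags do not matter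
and the asymptotics in `τ` pass to the double integrals
(`tendsto_integral_div_powerKernelIntegral`).

The harmonic analysis rests on the generating function `(w + 2 s z - s² w̄)^ℓ`, `w = y₀ + i y₁`: it
is a power of the pairing of `y` with an isotropic vector of `ℂ³`, and its coefficients in `s` are
the associated Legendre functions. Orthonormality and the Funk–Hecke formula both come from moments
of complex linear forms on the sphere, which are obtained from Gaussian integrals on `ℝ³`. -/

instance : IsFiniteMeasure area := inferInstanceAs (IsFiniteMeasure (Measure.toSphere _))

/-- Polar coordinates. Dividing by the radial factor turns Gaussian integrals over `ℝ³` into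
integrals over the sphere. -/
lemma integral_mul_exp_neg_norm_sq_of_homogeneous (F : EuclideanSpace ℝ (Fin 3) → ℝ) (n : ℕ)
    (hF : ∀ (r : ℝ) (y : EuclideanSpace ℝ (Fin 3)), 0 < r → F (r • y) = r ^ n * F y) :
    ∫ x, F x * Real.exp (-‖x‖ ^ 2) =
      (∫ y : S2, F y ∂area) * ∫ r in Set.Ioi (0 : ℝ), r ^ (n + 2) * Real.exp (-r ^ 2) := by
  have hdim : Module.finrank ℝ (EuclideanSpace ℝ (Fin 3)) - 1 = 2 := by simp
  calc
    ∫ x, F x * Real.exp (-‖x‖ ^ 2)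
      = ∫ x : ({(0)}ᶜ : Set (EuclideanSpace ℝ (Fin 3))), F x.1 * Real.exp (-‖x.1‖ ^ 2)
          ∂(Measure.comap Subtype.val volume) := by
      rw [integral_subtype_comap (measurableSet_singleton _).compl
        fun x : EuclideanSpace ℝ (Fin 3) ↦ F x * Real.exp (-‖x‖ ^ 2), restrict_compl_singleton]
    _ = ∫ p : S2 × Set.Ioi (0 : ℝ), F p.1 * (p.2.1 ^ n * Real.exp (-p.2.1 ^ 2))
          ∂(area.prod (.volumeIoiPow 2)) := by
      have := (volume : Measure (EuclideanSpace ℝ (Fin 3))).measurePreserving_homeomorphUnitSphereProd.integral_comp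
        (Homeomorph.measurableEmbedding _)
        (fun p : S2 × Set.Ioi (0 : ℝ) => F p.1 * (p.2.1 ^ n * Real.exp (-p.2.1 ^ 2)))
      rw [hdim] at this
      rw [area, ← this]
      refine integral_congr_ae (.of_forall fun x => ?_)
      have hx : 0 < ‖x.1‖ := norm_pos_iff.2 x.2
      have h1 : x.1 = ‖x.1‖ • (‖x.1‖⁻¹ • x.1) := by
        rw [smul_smul, mul_inv_cancel₀ hx.ne', one_smul]
      simp only [homeomorphUnitSphereProd_apply_snd_coe, homeomorphUnitSphereProd_apply_fst_coe]
      conv_lhs => rw [h1]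
      rw [hF _ _ hx, norm_smul, norm_smul, norm_inv, norm_norm, inv_mul_cancel₀ hx.ne']
      ring_nf
    _ = _ := by
      rw [integral_prod_mul (fun y : S2 => F y)
        (fun r : Set.Ioi (0 : ℝ) => r.1 ^ n * Real.exp (-r.1 ^ 2))]
      congr 1
      simp only [Measure.volumeIoiPow, ENNReal.ofReal]
      rw [integral_withDensity_eq_integral_smul,
        integral_subtype_comap measurableSet_Ioi
          fun a : ℝ ↦ Real.toNNReal (a ^ 2) • (a ^ n * Real.exp (-a ^ 2))]
      · refine setIntegral_congr_fun measurableSet_Ioi fun x hx ↦ ?_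
        simp only [NNReal.smul_def, Real.coe_toNNReal _ (sq_nonneg x), smul_eq_mul]
        ring
      · exact (measurable_subtype_coe.pow_const _).real_toNNReal

/-- The radial Gaussian integral `∫₀^∞ r^n e^{-r²} dr`. -/
noncomputable def radialGauss (n : ℕ) : ℝ := ∫ r in Set.Ioi (0 : ℝ), r ^ n * Real.exp (-r ^ 2)

lemma radialGauss_eq (n : ℕ) : radialGauss n = (1 / 2) * Real.Gamma ((n + 1) / 2) := by
  have := integral_rpow_mul_exp_neg_rpow (p := 2) (q := n) (by norm_num)
    (by have : (0 : ℝ) ≤ n := n.cast_nonneg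
        linarith)
  rw [← this, radialGauss]
  refine setIntegral_congr_fun measurableSet_Ioi fun x hx ↦ ?_
  simp

lemma radialGauss_pos (n : ℕ) : 0 < radialGauss n := by
  rw [radialGauss_eq]
  have := Real.Gamma_pos_of_pos (s := ((n : ℝ) + 1) / 2) (by positivity)
  positivity

lemma radialGauss_add_two (n : ℕ) : radialGauss (n + 2) = (n + 1) / 2 * radialGauss n := by
  rw [radialGauss_eq, radialGauss_eq]
  have : ((n + 2 : ℕ) + 1 : ℝ) / 2 = ((n : ℝ) + 1) / 2 + 1 := by push_cast; ring
  rw [this, Real.Gamma_add_one (by positivity)]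
  ring

lemma radialGauss_zero_sq : radialGauss 0 ^ 2 = Real.pi / 4 := by
  rw [radialGauss_eq]
  simp only [Nat.cast_zero, zero_add, Real.Gamma_one_half_eq, mul_pow, Real.sq_sqrt Real.pi_pos.le]
  ring

lemma integral_pow_mul_exp_neg_sq_of_even {n : ℕ} (hn : Even n) :
    ∫ x : ℝ, x ^ n * Real.exp (-x ^ 2) = 2 * radialGauss n := by
  rw [radialGauss, ← integral_comp_abs (f := fun r => r ^ n * Real.exp (-r ^ 2))]
  simp [hn.pow_abs]

lemma integral_pow_mul_exp_neg_sq_of_odd {n : ℕ} (hn : Odd n) :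
    ∫ x : ℝ, x ^ n * Real.exp (-x ^ 2) = 0 := by
  have h := integral_neg_eq_self (fun x : ℝ => x ^ n * Real.exp (-x ^ 2)) volume
  simp only [hn.neg_pow, neg_mul, even_two.neg_pow, integral_neg] at h
  linarith

lemma integral_coord_pow_mul_exp_neg_norm_sq (n : ℕ) :
    ∫ x : EuclideanSpace ℝ (Fin 3), (x 0) ^ n * Real.exp (-‖x‖ ^ 2) =
      (∫ x : ℝ, x ^ n * Real.exp (-x ^ 2)) * Real.pi := by
  rw [← (PiLp.volume_preserving_toLp (Fin 3)).integral_comp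
    (MeasurableEquiv.toLp 2 (Fin 3 → ℝ)).measurableEmbedding]
  have : ∀ x : Fin 3 → ℝ, (WithLp.toLp 2 x : EuclideanSpace ℝ (Fin 3)) 0 ^ n *
      Real.exp (-‖(WithLp.toLp 2 x : EuclideanSpace ℝ (Fin 3))‖ ^ 2) =
      ∏ i, (if i = 0 then (x i) ^ n else 1) * Real.exp (-(x i) ^ 2) := by
    intro x
    rw [EuclideanSpace.norm_sq_eq, Fin.sum_univ_three, Fin.prod_univ_three, neg_add, neg_add,
      Real.exp_add, Real.exp_add]
    simp
    ring
  simp_rw [this]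
  rw [integral_fintype_prod_volume_eq_prod
    (f := fun (i : Fin 3) (v : ℝ) => (if i = 0 then v ^ n else 1) * Real.exp (-v ^ 2))]
  rw [Fin.prod_univ_three]
  have h2 := integral_pow_mul_exp_neg_sq_of_even (n := 0) (by simp)
  simp only [pow_zero] at h2
  have h3 := radialGauss_zero_sq
  simp only [if_true, Fin.isValue, one_ne_zero, if_false, show (2 : Fin 3) ≠ 0 by decide, h2]
  -- The two remaining coordinates contribute `√π` each, hence the factor `π`.
  rw [mul_assoc]
  congr 1
  linarith

/-- Rotation invariance: `u` is completed to an orthonormal basis in which `⟨u, x⟩` is the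
coordinate of index `0`. -/
lemma integral_unit_inner_pow_mul_exp_neg_norm_sq (u : EuclideanSpace ℝ (Fin 3)) (hu : ‖u‖ = 1)
    (n : ℕ) :
    ∫ x : EuclideanSpace ℝ (Fin 3), (inner ℝ u x) ^ n * Real.exp (-‖x‖ ^ 2) =
      (∫ x : ℝ, x ^ n * Real.exp (-x ^ 2)) * Real.pi := by
  obtain ⟨b, hb⟩ := Orthonormal.exists_orthonormalBasis_extension_of_card_eq
    (𝕜 := ℝ) (E := EuclideanSpace ℝ (Fin 3)) (ι := Fin 3) (by simp) (v := fun _ => u) (s := {0})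
    (by
      rw [orthonormal_iff_ite]
      rintro ⟨i, hi⟩ ⟨j, hj⟩
      obtain rfl := hi
      obtain rfl := hj
      simp [hu])
  have hb0 : b 0 = u := hb 0 rfl
  rw [← integral_coord_pow_mul_exp_neg_norm_sq,
    ← (b.repr.measurePreserving).integral_comp b.repr.toHomeomorph.measurableEmbedding
      (fun x => (x 0) ^ n * Real.exp (-‖x‖ ^ 2))]
  refine integral_congr_ae (.of_forall fun x => ?_)
  simp only [b.repr_apply_apply, hb0, LinearIsometryEquiv.norm_map]

/-- Moments of a real linear form on the sphere. -/
lemma integral_inner_pow (a : EuclideanSpace ℝ (Fin 3)) (n : ℕ) :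
    ∫ y : S2, (inner ℝ a y.1) ^ n ∂area =
      if Even n then 4 * Real.pi / (n + 1) * (inner ℝ a a) ^ (n / 2) else 0 := by
  have unit : ∀ u : EuclideanSpace ℝ (Fin 3), ‖u‖ = 1 →
      ∫ y : S2, (inner ℝ u y.1) ^ n ∂area = if Even n then 4 * Real.pi / (n + 1) else 0 := by
    intro u hu
    have h := integral_mul_exp_neg_norm_sq_of_homogeneous (fun x => (inner ℝ u x) ^ n) n
      (fun r y _ => by simp [inner_smul_right, mul_pow])
    rw [integral_unit_inner_pow_mul_exp_neg_norm_sq u hu] at h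
    change _ = _ * radialGauss (n + 2) at h
    have hp := radialGauss_pos n
    rw [radialGauss_add_two] at h
    split_ifs with hn
    · rw [integral_pow_mul_exp_neg_sq_of_even hn] at h
      have hn1 : (n : ℝ) + 1 ≠ 0 := by positivity
      rw [eq_div_iff hn1]
      have := mul_right_cancel₀ hp.ne' (show 4 * Real.pi * radialGauss n =
        ((∫ y : S2, (inner ℝ u y.1) ^ n ∂area) * (n + 1)) * radialGauss n by linarith)
      exact this.symm
    · rw [integral_pow_mul_exp_neg_sq_of_odd (Nat.not_even_iff_odd.1 hn), zero_mul] at h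
      have : (n + 1) / 2 * radialGauss n ≠ 0 := by positivity
      exact (mul_eq_zero.1 h.symm).resolve_right this
  have hex : ∃ u : EuclideanSpace ℝ (Fin 3), ‖u‖ = 1 ∧ a = ‖a‖ • u := by
    rcases eq_or_ne a 0 with rfl | ha
    · exact ⟨EuclideanSpace.single 0 1, by simp, by simp⟩
    · have ha' : ‖a‖ ≠ 0 := norm_ne_zero_iff.2 ha
      exact ⟨‖a‖⁻¹ • a, by simp [norm_smul, ha'], by simp [smul_smul, ha']⟩
  obtain ⟨u, hu, hau⟩ := hex
  have h1 : ∀ y : S2, (inner ℝ a y.1) ^ n = ‖a‖ ^ n * (inner ℝ u y.1) ^ n := by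
    intro y
    conv_lhs => rw [hau]
    rw [real_inner_smul_left, mul_pow]
  simp_rw [h1]
  rw [integral_const_mul, unit u hu]
  split_ifs with hn
  · obtain ⟨k, rfl⟩ := hn
    rw [real_inner_self_eq_norm_sq, ← pow_mul, show 2 * ((k + k) / 2) = k + k by omega]
    ring
  · simp

lemma area_real_univ : area.real Set.univ = 4 * Real.pi := by
  have h := integral_inner_pow 0 0
  simpa using h

/-- The bilinear (not sesquilinear) pairing on `ℂ³`. -/
noncomputable def cdot (a b : Fin 3 → ℂ) : ℂ := ∑ i, a i * b i

/-- A point of the sphere as a complex vector. -/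
noncomputable def cvec (y : S2) : Fin 3 → ℂ := fun i => (y.1 i : ℂ)

lemma continuous_coord (i : Fin 3) : Continuous fun y : S2 => y.1 i :=
  (EuclideanSpace.proj i).continuous.comp continuous_subtype_val

lemma continuous_cdot_cvec (a : Fin 3 → ℂ) : Continuous fun y : S2 => cdot a (cvec y) := by
  unfold cdot cvec
  exact continuous_finsetSum _ fun i _ =>
    continuous_const.mul (Complex.continuous_ofReal.comp (continuous_coord i))

lemma integrable_of_continuous {E : Type*} [NormedAddCommGroup E] {f : S2 → E}
    (hf : Continuous f) : Integrable f area := by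
  exact hf.integrable_of_hasCompactSupport (HasCompactSupport.of_compactSpace f)

/-- Both sides are polynomials in `a ∈ ℂ³` and agree on `ℝ³` by `integral_inner_pow`; a polynomial
that vanishes on a product of infinite sets is zero. The complex version is what allows isotropic
vectors. -/
lemma integral_cdot_pow (a : Fin 3 → ℂ) (n : ℕ) :
    ∫ y : S2, (cdot a (cvec y)) ^ n ∂area =
      if Even n then 4 * Real.pi / (n + 1) * (cdot a a) ^ (n / 2) else 0 := by
  classical
  let p : MvPolynomial (Fin 3) ℂ := ∑ k ∈ (Finset.univ : Finset (Fin 3)).piAntidiag n,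
    MvPolynomial.C ((Nat.multinomial (Finset.univ : Finset (Fin 3)) k : ℂ) * ∫ y : S2, ∏ i : Fin 3, cvec y i ^ k i ∂area) *
      ∏ i : Fin 3, MvPolynomial.X i ^ k i
  let q : MvPolynomial (Fin 3) ℂ := MvPolynomial.C (if Even n then 4 * (Real.pi : ℂ) / (n + 1) else 0) *
    (∑ i : Fin 3, (MvPolynomial.X i * MvPolynomial.X i : MvPolynomial (Fin 3) ℂ)) ^ (n / 2)
  have hcv : ∀ i, Continuous fun y : S2 => cvec y i := fun i =>
    Complex.continuous_ofReal.comp (continuous_coord i)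
  have hp : ∀ a, MvPolynomial.eval a p = ∫ y : S2, (cdot a (cvec y)) ^ n ∂area := by
    intro a
    simp only [p, map_sum, map_mul, MvPolynomial.eval_C, map_prod, map_pow, MvPolynomial.eval_X,
      cdot, Finset.sum_pow_eq_sum_piAntidiag]
    rw [integral_finsetSum]
    · refine Finset.sum_congr rfl fun k _ => ?_
      rw [integral_const_mul]
      simp_rw [mul_pow, Finset.prod_mul_distrib]
      rw [integral_const_mul]
      ring
    · intro k _
      refine integrable_of_continuous ?_
      fun_prop
  have hq : ∀ a, MvPolynomial.eval a q =
      if Even n then 4 * Real.pi / (n + 1) * (cdot a a) ^ (n / 2) else 0 := by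
    intro a
    simp only [q, map_sum, map_mul, MvPolynomial.eval_C, map_pow, MvPolynomial.eval_X, cdot]
    split_ifs <;> simp
  rw [← hp, ← hq]
  congr 1
  refine MvPolynomial.funext_set (fun _ => Set.range ((↑) : ℝ → ℂ))
    (fun _ => Set.infinite_range_of_injective Complex.ofReal_injective) fun x hx => ?_
  choose b hb using fun i => hx i (Set.mem_univ i)
  rw [hp, hq]
  have h := integral_inner_pow (WithLp.toLp 2 b) n
  have h1 : ∀ y : S2, cdot x (cvec y) ^ n = ((inner ℝ (WithLp.toLp 2 b) y.1 ^ n : ℝ) : ℂ) := by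
    intro y
    simp only [cdot, cvec, ← hb, PiLp.inner_apply, Complex.ofReal_pow, Complex.ofReal_sum]
    congr 1
    refine Finset.sum_congr rfl fun i _ => ?_
    simp [mul_comm]
  have h2 : cdot x x = ((inner ℝ (WithLp.toLp 2 b) (WithLp.toLp 2 b) : ℝ) : ℂ) := by
    simp only [cdot, ← hb, PiLp.inner_apply, Complex.ofReal_sum]
    refine Finset.sum_congr rfl fun i _ => ?_
    simp [sq]
  simp_rw [h1]
  rw [integral_complex_ofReal, h, h2]
  split_ifs <;> simp

/-! ### Isotropic forms and spherical harmonics -/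

open Polynomial in
lemma coeff_C_add_C_mul_X_pow (A B : ℂ) (M j : ℕ) :
    ((C A + C B * X) ^ M : ℂ[X]).coeff j = A ^ (M - j) * B ^ j * M.choose j := by
  rw [add_comm, add_pow, finsetSum_coeff]
  have : ∀ b, (((C B * X) ^ b * C A ^ (M - b) * ((M.choose b : ℕ) : ℂ[X])) : ℂ[X]).coeff j =
      if j = b then A ^ (M - j) * B ^ j * M.choose j else 0 := by
    intro b
    rw [show ((C B * X) ^ b * C A ^ (M - b) * ((M.choose b : ℕ) : ℂ[X]) : ℂ[X]) =
      C (A ^ (M - b) * B ^ b * M.choose b) * X ^ b by simp [mul_pow]; ring]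
    rw [coeff_C_mul_X_pow]
    split_ifs with h
    · rw [h]
    · rfl
  simp_rw [this]
  rw [Finset.sum_ite_eq]
  split_ifs with h
  · rfl
  · rw [Nat.choose_eq_zero_of_lt (by simpa [Nat.lt_succ_iff] using h)]
    simp

open Polynomial in
lemma continuous_coeff_pow {Y : Type*} [TopologicalSpace Y] {q : Y → ℂ[X]}
    (hq : ∀ j, Continuous fun y => (q y).coeff j) (n j : ℕ) :
    Continuous fun y => (q y ^ n).coeff j := by
  induction n generalizing j with
  | zero => simpa using continuous_const
  | succ n ih =>
    simp_rw [pow_succ, coeff_mul]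
    exact continuous_finsetSum _ fun i _ => (ih _).mul (hq _)

open Polynomial in
-- Extraction from a generating function: an identity of integrals that holds for every value of the
-- parameter `s` holds coefficient by coefficient, because only finitely many powers of `s` occur.
lemma integral_mul_coeff_eq {q : S2 → ℂ[X]} {g : S2 → ℂ} (hg : Continuous g) (D : ℕ)
    (hD : ∀ y, (q y).natDegree ≤ D) (hq : ∀ j, Continuous fun y => (q y).coeff j) {R : ℂ[X]}
    (h : ∀ s, ∫ y, g y * (q y).eval s ∂area = R.eval s) (j : ℕ) :
    ∫ y, g y * (q y).coeff j ∂area = R.coeff j := by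
  have hR : R = ∑ i ∈ Finset.range (D + 1), C (∫ y, g y * (q y).coeff i ∂area) * X ^ i := by
    refine Polynomial.funext fun s => ?_
    rw [← h, eval_finsetSum]
    simp only [eval_mul, eval_C, eval_pow, eval_X]
    simp_rw [← integral_mul_const]
    rw [← integral_finsetSum]
    · refine integral_congr_ae (.of_forall fun y => ?_)
      simp only
      rw [eval_eq_sum_range' (Nat.lt_succ_of_le (hD y)), Finset.mul_sum]
      exact Finset.sum_congr rfl fun i _ => by ring
    · exact fun i _ => integrable_of_continuous ((hg.mul (hq i)).mul continuous_const)
  rw [hR]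
  simp only [finsetSum_coeff, coeff_C_mul_X_pow]
  rw [Finset.sum_ite_eq]
  split_ifs with hj
  · rfl
  · have : ∀ y, (q y).coeff j = 0 := fun y =>
      coeff_eq_zero_of_natDegree_lt ((hD y).trans_lt (by simpa using hj))
    simp [this]

open Polynomial in
/-- Mixed moments of a linear form with an isotropic linear form. -/
lemma integral_cdot_pow_mul_isotropic (a η : Fin 3 → ℂ) (hη : cdot η η = 0) (N l : ℕ) :
    N.choose l * ∫ y : S2, (cdot a (cvec y)) ^ (N - l) * (cdot η (cvec y)) ^ l ∂area =
      if Even N then 4 * Real.pi / (N + 1) *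
        ((cdot a a) ^ (N / 2 - l) * (2 * cdot a η) ^ l * (N / 2).choose l) else 0 := by
  have key := integral_mul_coeff_eq (g := fun _ => 1)
    (q := fun y => (C (cdot a (cvec y)) + C (cdot η (cvec y)) * X) ^ N)
    continuous_const N
    (fun y => by compute_degree)
    (fun j => by
      simp only [coeff_C_add_C_mul_X_pow]
      have h1 := continuous_cdot_cvec a
      have h2 := continuous_cdot_cvec η
      fun_prop)
    -- Since `η` is isotropic, `(a + s η)·(a + s η) = a·a + 2 (a·η) s` has no quadratic term in `s`,
    -- so the moment of `a + s η` is a power of an affine polynomial, with explicit coefficients.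
    (R := if Even N then C (4 * (Real.pi : ℂ) / (N + 1)) *
      (C (cdot a a) + C (2 * cdot a η) * X) ^ (N / 2) else 0)
    (fun s => by
      have h := integral_cdot_pow (a + s • η) N
      have h1 : ∀ b, cdot (a + s • η) b = cdot a b + s * cdot η b := by
        intro b
        simp only [cdot, Pi.add_apply, Pi.smul_apply, smul_eq_mul, Finset.mul_sum,
          ← Finset.sum_add_distrib]
        exact Finset.sum_congr rfl fun i _ => by ring
      have h2 : cdot (a + s • η) (a + s • η) = cdot a a + 2 * cdot a η * s := by
        have : cdot (a + s • η) (a + s • η) = cdot a a + 2 * cdot a η * s + s ^ 2 * cdot η η := by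
          simp only [cdot, Fin.sum_univ_three, Pi.add_apply, Pi.smul_apply, smul_eq_mul]
          ring
        rw [this, hη]
        ring
      rw [h2] at h
      simp only [h1] at h
      simp only [one_mul, eval_pow, eval_add, eval_mul, eval_C, eval_X]
      simp only [mul_comm _ s]
      rw [h]
      split_ifs <;> simp)
    l
  simp only [one_mul, coeff_C_add_C_mul_X_pow] at key
  rw [integral_mul_const] at key
  rw [mul_comm, key]
  split_ifs
  · rw [coeff_C_mul, coeff_C_add_C_mul_X_pow]
  · simp

lemma cdot_cvec_cvec (x y : S2) : cdot (cvec x) (cvec y) = ((inner ℝ x.1 y.1 : ℝ) : ℂ) := by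
  simp only [cdot, cvec, PiLp.inner_apply, Complex.ofReal_sum]
  exact Finset.sum_congr rfl fun i _ => by simp [mul_comm]

lemma inner_self_S2 (x : S2) : inner ℝ x.1 x.1 = (1 : ℝ) := by
  have : ‖x.1‖ = 1 := by simp
  rw [real_inner_self_eq_norm_sq, this, one_pow]

/-- The mixed moment formula with `a = x`: as `x·x = 1`, all dependence on `x` and `ζ` is through
`(ζ·x)^l`, so a single constant serves for all of them. -/
lemma exists_funkHecke_monomial (n l : ℕ) : ∃ c : ℂ, ∀ (x : S2) (ζ : Fin 3 → ℂ), cdot ζ ζ = 0 →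
    ∫ y : S2, ((inner ℝ x.1 y.1 : ℝ) : ℂ) ^ n * (cdot ζ (cvec y)) ^ l ∂area =
      c * (cdot ζ (cvec x)) ^ l := by
  refine ⟨(if Even (n + l) then 4 * (Real.pi : ℂ) / ((n + l : ℕ) + 1) * 2 ^ l * ((n + l) / 2).choose l
    else 0) / (n + l).choose l, fun x ζ hζ => ?_⟩
  have h := integral_cdot_pow_mul_isotropic (cvec x) ζ hζ (n + l) l
  rw [Nat.add_sub_cancel] at h
  simp only [cdot_cvec_cvec x, inner_self_S2, Complex.ofReal_one, one_pow, one_mul] at h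
  have hc : ((n + l).choose l : ℂ) ≠ 0 :=
    Nat.cast_ne_zero.2 (Nat.choose_pos (Nat.le_add_left _ _)).ne'
  have hcomm : cdot (cvec x) ζ = cdot ζ (cvec x) := by
    simp [cdot, mul_comm]
  rw [hcomm] at h
  rw [div_mul_eq_mul_div, eq_div_iff hc, mul_comm, h]
  split_ifs
  · rw [mul_pow]; ring
  · simp

/-- The mixed moment formula with `a = ζ` isotropic: the factor `(ζ·ζ)^((k+l)/2 - l)` or the
binomial coefficient vanishes unless `k = l`. -/
lemma integral_isotropic_mul_isotropic (ζ η : Fin 3 → ℂ) (hζ : cdot ζ ζ = 0) (hη : cdot η η = 0)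
    (k l : ℕ) :
    ∫ y : S2, (cdot ζ (cvec y)) ^ k * (cdot η (cvec y)) ^ l ∂area =
      if k = l then 4 * Real.pi / (2 * l + 1) * (2 * cdot ζ η) ^ l / (2 * l).choose l else 0 := by
  have h := integral_cdot_pow_mul_isotropic ζ η hη (k + l) l
  rw [Nat.add_sub_cancel, hζ] at h
  have hc : ((k + l).choose l : ℂ) ≠ 0 :=
    Nat.cast_ne_zero.2 (Nat.choose_pos (Nat.le_add_left _ _)).ne'
  split_ifs with hkl
  · subst hkl
    rw [eq_div_iff (by rw [two_mul]; exact hc), mul_comm, two_mul k, h, if_pos (by simp)]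
    rw [show (k + k) / 2 = k by omega]
    rw [Nat.sub_self, pow_zero, Nat.choose_self]
    push_cast
    ring
  · refine (mul_eq_zero.1 (h.trans ?_)).resolve_left hc
    split_ifs with he
    · rcases lt_or_gt_of_ne hkl with h1 | h1
      · rw [Nat.choose_eq_zero_of_lt (by omega)]; simp
      · obtain ⟨j, hj⟩ := he
        rw [zero_pow (by omega)]; simp
    · rfl

/-! The isotropic vectors `(1 - s², ± i (1 + s²), 2 s)`. -/

/-- The isotropic vector whose pairing with `y` is `w + 2 s z - s² w̄`, `w = y₀ + i y₁`. -/
noncomputable def isoVec (s : ℂ) : Fin 3 → ℂ := ![1 - s ^ 2, Complex.I * (1 + s ^ 2), 2 * s]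

/-- The isotropic vector whose pairing with `y` is `w̄ + 2 s z - s² w`, `w = y₀ + i y₁`. -/
noncomputable def isoVecConj (s : ℂ) : Fin 3 → ℂ := ![1 - s ^ 2, -Complex.I * (1 + s ^ 2), 2 * s]

lemma cdot_isoVec_isoVec (s t : ℂ) : cdot (isoVec s) (isoVec t) = -2 * (s - t) ^ 2 := by
  simp only [cdot, Fin.sum_univ_three, isoVec, Matrix.cons_val]
  linear_combination (1 + s ^ 2) * (1 + t ^ 2) * Complex.I_sq

lemma cdot_isoVecConj_isoVecConj (s t : ℂ) :
    cdot (isoVecConj s) (isoVecConj t) = -2 * (s - t) ^ 2 := by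
  simp only [cdot, Fin.sum_univ_three, isoVecConj, Matrix.cons_val]
  linear_combination (1 + s ^ 2) * (1 + t ^ 2) * Complex.I_sq

lemma cdot_isoVec_isoVecConj (s t : ℂ) :
    cdot (isoVec s) (isoVecConj t) = 2 * (1 + s * t) ^ 2 := by
  simp only [cdot, Fin.sum_univ_three, isoVec, isoVecConj, Matrix.cons_val]
  linear_combination -(1 + s ^ 2) * (1 + t ^ 2) * Complex.I_sq

/-- The complex coordinate `x₀ + i x₁`. -/
noncomputable def wcoord (y : S2) : ℂ := ⟨y.1 0, y.1 1⟩

open Polynomial in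
/-- The polynomial `(a + 2 c X - b X²)^l`. -/
noncomputable def isoPoly (a b c : ℂ) (l : ℕ) : ℂ[X] := (C a + C (2 * c) * X - C b * X ^ 2) ^ l

lemma wcoord_eq (y : S2) : wcoord y = (y.1 0 : ℂ) + y.1 1 * Complex.I := by
  apply Complex.ext <;> simp [wcoord]

lemma conj_wcoord_eq (y : S2) :
    (starRingEnd ℂ) (wcoord y) = (y.1 0 : ℂ) - y.1 1 * Complex.I := by
  apply Complex.ext <;> simp [wcoord]

lemma eval_isoPoly (y : S2) (l : ℕ) (s : ℂ) :
    (isoPoly (wcoord y) ((starRingEnd ℂ) (wcoord y)) (y.1 2) l).eval s =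
      (cdot (isoVec s) (cvec y)) ^ l := by
  simp only [isoPoly, cdot, Fin.sum_univ_three, isoVec, Matrix.cons_val, cvec, conj_wcoord_eq,
    Polynomial.eval_pow, Polynomial.eval_add, Polynomial.eval_sub,
    Polynomial.eval_mul, Polynomial.eval_C, Polynomial.eval_X]
  rw [wcoord_eq]
  ring

lemma eval_isoPoly_conj (y : S2) (l : ℕ) (s : ℂ) :
    (isoPoly ((starRingEnd ℂ) (wcoord y)) (wcoord y) (y.1 2) l).eval s =
      (cdot (isoVecConj s) (cvec y)) ^ l := by
  simp only [isoPoly, cdot, Fin.sum_univ_three, isoVecConj, Matrix.cons_val, cvec, conj_wcoord_eq,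
    Polynomial.eval_pow, Polynomial.eval_add, Polynomial.eval_sub,
    Polynomial.eval_mul, Polynomial.eval_C, Polynomial.eval_X]
  rw [wcoord_eq]
  ring

lemma natDegree_isoPoly_le (a b c : ℂ) (l : ℕ) : (isoPoly a b c l).natDegree ≤ 2 * l := by
  unfold isoPoly
  compute_degree
  omega

lemma sq_wcoord (y : S2) :
    wcoord y * (starRingEnd ℂ) (wcoord y) = ((1 - y.1 2 ^ 2 : ℝ) : ℂ) := by
  have h := inner_self_S2 y
  simp only [PiLp.inner_apply, Fin.sum_univ_three] at h
  simp only [RCLike.inner_apply, conj_trivial] at h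
  rw [conj_wcoord_eq, wcoord_eq]
  have h2 : (1 - y.1 2 ^ 2 : ℝ) = y.1 0 ^ 2 + y.1 1 ^ 2 := by linarith
  rw [h2]
  push_cast
  linear_combination -(y.1 1 : ℂ) ^ 2 * Complex.I_sq

lemma continuous_wcoord : Continuous wcoord := by
  rw [funext wcoord_eq]
  have h0 := continuous_coord 0
  have h1 := continuous_coord 1
  fun_prop

open Polynomial in
lemma continuous_coeff_isoPoly {a b c : S2 → ℂ} (ha : Continuous a) (hb : Continuous b)
    (hc : Continuous c) (l j : ℕ) : Continuous fun y => (isoPoly (a y) (b y) (c y) l).coeff j := by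
  unfold isoPoly
  refine continuous_coeff_pow (fun j => ?_) l j
  simp only [coeff_sub, coeff_add, coeff_C, coeff_C_mul, coeff_X, coeff_X_pow]
  split_ifs <;> fun_prop

open Polynomial in
-- Substituting `a X` for `X` in `a + 2cX - bX²` produces `a (1 + 2cX - abX²)`, and the bracket is
-- `X² + 2cX - ab` reversed; reversal of degree `2l` sends the index `l - m` to `l + m`. Apart from
-- `a ^ m`, the coefficient therefore depends on `a` and `b` only through `ab`.
lemma coeff_isoPoly (a b c : ℂ) {l m : ℕ} (hm : m ≤ l) :
    (isoPoly a b c l).coeff (l - m) =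
      a ^ m * ((X ^ 2 + C (2 * c) * X - C (a * b)) ^ l : ℂ[X]).coeff (l + m) := by
  -- The rescaling argument cancels a power of `a`, so `a = 0` (the poles, in the application) is
  -- computed directly.
  rcases eq_or_ne a 0 with rfl | ha
  · have h1 : isoPoly 0 b c l = (C (2 * c) + C (-b) * X) ^ l * X ^ l := by
      rw [isoPoly, ← mul_pow]; congr 1; simp; ring
    have h2 : (X ^ 2 + C (2 * c) * X - C (0 * b)) ^ l = ((C (2 * c) + C 1 * X) ^ l * X ^ l : ℂ[X]) := by
      rw [← mul_pow]; congr 1; simp; ring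
    rw [h1, h2, coeff_mul_X_pow', coeff_mul_X_pow']
    rcases Nat.eq_zero_or_pos m with rfl | hm0
    · simp only [coeff_C_add_C_mul_X_pow]
      simp
    · rw [if_neg (by omega), zero_pow hm0.ne', zero_mul]
  · set p : ℂ[X] := X ^ 2 + C (2 * c) * X - C (a * b) with hp
    have hpd : p.natDegree ≤ 2 := by rw [hp]; compute_degree
    have hr : reflect 2 p = 1 + C (2 * c) * X - C (a * b) * X ^ 2 := by
      have : p = C 1 * X ^ 2 + C (2 * c) * X ^ 1 + C (-(a * b)) * X ^ 0 := by
        rw [hp]; simp; ring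
      rw [this, reflect_add, reflect_add, reflect_C_mul_X_pow, reflect_C_mul_X_pow,
        reflect_C_mul_X_pow, revAt_le (by norm_num), revAt_le (by norm_num), revAt_le (by norm_num)]
      simp
      ring
    have hpow : ∀ k, reflect (2 * k) (p ^ k) = (reflect 2 p) ^ k := by
      intro k
      induction k with
      | zero => simp
      | succ k ih =>
        rw [pow_succ, pow_succ, ← ih, mul_add, mul_one, reflect_mul _ _ _ hpd]
        exact natDegree_pow_le_of_le _ hpd |>.trans (by omega)
    have hcomp : (isoPoly a b c l).comp (C a * X) = C (a ^ l) * reflect (2 * l) (p ^ l) := by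
      rw [hpow, hr, isoPoly, C_pow, ← mul_pow, pow_comp]
      congr 1
      simp
      ring
    have h := congrArg (fun q => q.coeff (l - m)) hcomp
    simp only [coeff_C_mul, coeff_reflect] at h
    rw [revAt_le (by omega), comp_C_mul_X_coeff, show 2 * l - (l - m) = l + m by omega] at h
    have hal : a ^ l = a ^ (l - m) * a ^ m := by rw [← pow_add]; congr 1; omega
    have han : a ^ (l - m) ≠ 0 := pow_ne_zero _ ha
    apply mul_left_cancel₀ han
    rw [← mul_assoc, ← hal, ← h]
    ring

open Polynomial in
/-- The associated Legendre functions as coefficients of powers of isotropic forms. -/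
lemma pow_mul_legendre_eq_coeff {a b : ℂ} {z : ℝ} (hab : a * b = ((1 - z ^ 2 : ℝ) : ℂ)) {l m : ℕ}
    (hm : m ≤ l) :
    a ^ m * (((derivative^[m] (legendre l)).eval z : ℝ) : ℂ) =
      ((l + m).factorial : ℂ) / (2 ^ l * l.factorial) * (isoPoly a b z l).coeff (l - m) := by
  rw [coeff_isoPoly _ _ _ hm, hab]
  -- The trinomial is `(X + z)² - 1`, that is, the Rodrigues polynomial's base shifted to `z`. Its
  -- Taylor coefficient of index `l + m` is the derivative of that order divided by `(l + m)!`.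
  have h1 : (X ^ 2 + C (2 * (z : ℂ)) * X - C (((1 - z ^ 2 : ℝ) : ℂ))) ^ l =
      ((taylor z ((X ^ 2 - 1) ^ l : ℝ[X])).map Complex.ofRealHom) := by
    rw [taylor_apply, pow_comp, Polynomial.map_pow]
    congr 1
    simp [show (C (2 : ℂ) : ℂ[X]) = 2 from rfl]
    ring
  rw [h1, coeff_map, taylor_coeff]
  have h2 : derivative^[l + m] ((X ^ 2 - 1) ^ l : ℝ[X]) =
      (l + m).factorial • hasseDeriv (l + m) ((X ^ 2 - 1) ^ l : ℝ[X]) := by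
    rw [← factorial_smul_hasseDeriv]; rfl
  have h3 : derivative^[m] (legendre l) =
      C (1 / (2 ^ l * (l.factorial : ℝ))) * derivative^[l + m] ((X ^ 2 - 1) ^ l : ℝ[X]) := by
    rw [legendre, iterate_derivative_C_mul, add_comm l m, Function.iterate_add_apply]
  rw [h3, h2]
  simp
  ring

open Polynomial in
/-- The complex spherical harmonic `w^m P_l^{(m)}(z)`, without normalization. -/
noncomputable def assocHarm (l m : ℕ) (y : S2) : ℂ :=
  wcoord y ^ m * (((derivative^[m] (legendre l)).eval (y.1 2) : ℝ) : ℂ)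

/-- The powers of `w + 2 s z - s² w̄` as polynomials in `s`. -/
noncomputable def isoPolyS (l : ℕ) (y : S2) : Polynomial ℂ :=
  isoPoly (wcoord y) ((starRingEnd ℂ) (wcoord y)) (y.1 2) l

/-- The powers of `w̄ + 2 s z - s² w` as polynomials in `s`. -/
noncomputable def isoPolyConjS (l : ℕ) (y : S2) : Polynomial ℂ :=
  isoPoly ((starRingEnd ℂ) (wcoord y)) (wcoord y) (y.1 2) l

lemma continuous_conj_wcoord : Continuous fun y => (starRingEnd ℂ) (wcoord y) :=
  Complex.continuous_conj.comp continuous_wcoord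

lemma continuous_ofReal_coord (i : Fin 3) : Continuous fun y : S2 => (y.1 i : ℂ) :=
  Complex.continuous_ofReal.comp (continuous_coord i)

lemma continuous_coeff_isoPolyS (l j : ℕ) : Continuous fun y => (isoPolyS l y).coeff j :=
  continuous_coeff_isoPoly continuous_wcoord continuous_conj_wcoord (continuous_ofReal_coord 2) l j

lemma continuous_coeff_isoPolyConjS (l j : ℕ) : Continuous fun y => (isoPolyConjS l y).coeff j :=
  continuous_coeff_isoPoly continuous_conj_wcoord continuous_wcoord (continuous_ofReal_coord 2) l j

/-- The factor `(l+m)!/(2^l l!)`. -/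
noncomputable def assocConst (l m : ℕ) : ℂ := ((l + m).factorial : ℂ) / (2 ^ l * l.factorial)

lemma assocHarm_eq (y : S2) {l m : ℕ} (hm : m ≤ l) :
    assocHarm l m y = assocConst l m * (isoPolyS l y).coeff (l - m) :=
  pow_mul_legendre_eq_coeff (sq_wcoord y) hm

lemma conj_assocHarm_eq (y : S2) {l m : ℕ} (hm : m ≤ l) :
    (starRingEnd ℂ) (assocHarm l m y) = assocConst l m * (isoPolyConjS l y).coeff (l - m) := by
  rw [assocHarm, map_mul, map_pow, Complex.conj_ofReal]
  exact pow_mul_legendre_eq_coeff (by rw [mul_comm, sq_wcoord]) hm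

lemma continuous_eval_coord (p : Polynomial ℝ) (i : Fin 3) :
    Continuous fun y : S2 => p.eval (y.1 i) :=
  p.continuous.comp (continuous_coord i)

lemma continuous_assocHarm (l m : ℕ) : Continuous (assocHarm l m) :=
  (continuous_wcoord.pow m).mul (Complex.continuous_ofReal.comp (continuous_eval_coord _ 2))

/-- The integral operator acts on the whole generating function by one scalar, hence on each of its
coefficients by that scalar; this is why `c` does not depend on `m`. -/
lemma exists_funkHecke_assocHarm (n l : ℕ) : ∃ c : ℂ, ∀ m ≤ l, ∀ x : S2,
    ∫ y : S2, ((inner ℝ x.1 y.1 : ℝ) : ℂ) ^ n * assocHarm l m y ∂area = c * assocHarm l m x := by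
  obtain ⟨c, hc⟩ := exists_funkHecke_monomial n l
  refine ⟨c, fun m hm x => ?_⟩
  have hg : Continuous fun y : S2 => ((inner ℝ x.1 y.1 : ℝ) : ℂ) ^ n :=
    (Complex.continuous_ofReal.comp (continuous_const.inner continuous_subtype_val)).pow n
  have h := integral_mul_coeff_eq hg (2 * l) (q := isoPolyS l)
    (fun y => natDegree_isoPoly_le _ _ _ _) (continuous_coeff_isoPolyS l)
    (R := Polynomial.C c * isoPolyS l x) (fun s => by
      simp only [isoPolyS, Polynomial.eval_mul, Polynomial.eval_C, eval_isoPoly]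
      exact hc x _ (by rw [cdot_isoVec_isoVec]; simp)) (l - m)
  rw [Polynomial.coeff_C_mul] at h
  simp only [assocHarm_eq _ hm]
  rw [mul_left_comm, ← h, ← integral_const_mul]
  exact integral_congr_ae (.of_forall fun y => by ring)

lemma integral_coeff_mul_coeff {q q' : S2 → Polynomial ℂ} (D D' : ℕ)
    (hD : ∀ y, (q y).natDegree ≤ D) (hq : ∀ j, Continuous fun y => (q y).coeff j)
    (hD' : ∀ y, (q' y).natDegree ≤ D') (hq' : ∀ j, Continuous fun y => (q' y).coeff j)
    (heval' : ∀ t, Continuous fun y => (q' y).eval t)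
    {R : ℂ → Polynomial ℂ} (h : ∀ s t, ∫ y, (q' y).eval t * (q y).eval s ∂area = (R t).eval s)
    {R' : Polynomial ℂ} {j : ℕ} (hR' : ∀ t, (R t).coeff j = R'.eval t) (k : ℕ) :
    ∫ y, (q y).coeff j * (q' y).coeff k ∂area = R'.coeff k := by
  refine integral_mul_coeff_eq (hq j) D' hD' hq' (fun t => ?_) k
  rw [← hR', ← integral_mul_coeff_eq (heval' t) D hD hq (fun s => h s t) j]
  exact integral_congr_ae (.of_forall fun y => by ring)

lemma continuous_eval_isoPolyS (l : ℕ) (t : ℂ) : Continuous fun y => (isoPolyS l y).eval t := by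
  simp only [isoPolyS, eval_isoPoly]
  exact (continuous_cdot_cvec _).pow l

lemma continuous_eval_isoPolyConjS (l : ℕ) (t : ℂ) :
    Continuous fun y => (isoPolyConjS l y).eval t := by
  simp only [isoPolyConjS, eval_isoPoly_conj]
  exact (continuous_cdot_cvec _).pow l

open Polynomial in
-- The pairing of the two isotropic vectors is `2 (1 + s t)²`, and a power of `1 + s t` contains
-- only the diagonal monomials `s^j t^j`.
lemma integral_coeff_isoPolyS_mul_conj (l j k : ℕ) :
    ∫ y, (isoPolyS l y).coeff j * (isoPolyConjS l y).coeff k ∂area =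
      if k = j then 4 * (Real.pi : ℂ) / (2 * l + 1) * 4 ^ l / (2 * l).choose l * (2 * l).choose j
      else 0 := by
  set K : ℂ := 4 * Real.pi / (2 * l + 1) * 4 ^ l / (2 * l).choose l with hK
  rw [integral_coeff_mul_coeff (q := isoPolyS l) (q' := isoPolyConjS l) (2 * l) (2 * l) (fun y => natDegree_isoPoly_le _ _ _ _)
    (continuous_coeff_isoPolyS l) (fun y => natDegree_isoPoly_le _ _ _ _)
    (continuous_coeff_isoPolyConjS l) (continuous_eval_isoPolyConjS l)
    (R := fun t => C K * (C 1 + C t * X) ^ (2 * l))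
    (R' := C (K * (2 * l).choose j) * X ^ j)]
  · rw [coeff_C_mul_X_pow]
  · intro s t
    simp only [isoPolyS, isoPolyConjS, eval_isoPoly, eval_isoPoly_conj]
    simp_rw [mul_comm (cdot (isoVecConj t) _ ^ l)]
    rw [integral_isotropic_mul_isotropic _ _ (by rw [cdot_isoVec_isoVec]; simp)
      (by rw [cdot_isoVecConj_isoVecConj]; simp), if_pos rfl, cdot_isoVec_isoVecConj]
    simp only [eval_mul, eval_C, eval_pow, eval_add, eval_X]
    rw [hK, show (2 : ℂ) * (2 * (1 + s * t) ^ 2) = 4 * (1 + t * s) ^ 2 by ring, mul_pow,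
      ← pow_mul]
    ring
  · intro t
    rw [coeff_C_mul, coeff_C_add_C_mul_X_pow]
    simp
    ring

open Polynomial in
-- Without conjugation the pairing is `-2 (s - t)²`, so the double generating function is
-- homogeneous of degree `2l` in `(s, t)` and has no monomials of lower total degree.
lemma integral_coeff_isoPolyS_mul {l j k : ℕ} (hjk : j + k < 2 * l) :
    ∫ y, (isoPolyS l y).coeff j * (isoPolyS l y).coeff k ∂area = 0 := by
  set K : ℂ := 4 * Real.pi / (2 * l + 1) * (-4) ^ l / (2 * l).choose l with hK
  rw [integral_coeff_mul_coeff (q := isoPolyS l) (q' := isoPolyS l) (2 * l) (2 * l) (fun y => natDegree_isoPoly_le _ _ _ _)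
    (continuous_coeff_isoPolyS l) (fun y => natDegree_isoPoly_le _ _ _ _)
    (continuous_coeff_isoPolyS l) (continuous_eval_isoPolyS l)
    (R := fun t => C K * (C (-t) + C 1 * X) ^ (2 * l))
    (R' := C (K * (-1) ^ (2 * l - j) * (2 * l).choose j) * X ^ (2 * l - j))]
  · rw [coeff_C_mul_X_pow, if_neg (by omega)]
  · intro s t
    simp only [isoPolyS, eval_isoPoly]
    simp_rw [mul_comm (cdot (isoVec t) _ ^ l)]
    rw [integral_isotropic_mul_isotropic _ _ (by rw [cdot_isoVec_isoVec]; simp)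
      (by rw [cdot_isoVec_isoVec]; simp), if_pos rfl, cdot_isoVec_isoVec]
    simp only [eval_mul, eval_C, eval_pow, eval_add, eval_X]
    rw [hK, show (2 : ℂ) * (-2 * (s - t) ^ 2) = (-4) * (-t + 1 * s) ^ 2 by ring, mul_pow,
      ← pow_mul]
    ring
  · intro t
    rw [coeff_C_mul, coeff_C_add_C_mul_X_pow]
    simp only [one_pow, mul_one, eval_mul, eval_C, eval_pow, eval_X]
    rw [neg_pow]
    ring

open Polynomial in
lemma integral_coeff_isoPolyS_mul_of_ne {l l' : ℕ} (hl : l ≠ l') (j k : ℕ) :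
    ∫ y, (isoPolyS l y).coeff j * (isoPolyS l' y).coeff k ∂area = 0 := by
  rw [integral_coeff_mul_coeff (q := isoPolyS l) (q' := isoPolyS l') (2 * l) (2 * l') (fun y => natDegree_isoPoly_le _ _ _ _)
    (continuous_coeff_isoPolyS l) (fun y => natDegree_isoPoly_le _ _ _ _)
    (continuous_coeff_isoPolyS l') (continuous_eval_isoPolyS l')
    (R := fun t => 0) (R' := 0)]
  · simp
  · intro s t
    simp only [isoPolyS, eval_isoPoly]
    rw [integral_isotropic_mul_isotropic _ _ (by rw [cdot_isoVec_isoVec]; simp)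
      (by rw [cdot_isoVec_isoVec]; simp), if_neg hl.symm]
    simp
  · simp

lemma integral_assocHarm_mul_conj {l m m' : ℕ} (hm : m ≤ l) (hm' : m' ≤ l) :
    ∫ y, assocHarm l m y * (starRingEnd ℂ) (assocHarm l m' y) ∂area =
      if m = m' then 4 * (Real.pi : ℂ) / (2 * l + 1) * ((l + m).factorial / (l - m).factorial) else 0 := by
  simp only [assocHarm_eq _ hm, conj_assocHarm_eq _ hm']
  simp_rw [mul_mul_mul_comm]
  rw [integral_const_mul, integral_coeff_isoPolyS_mul_conj]
  rcases eq_or_ne m m' with rfl | h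
  · rw [if_pos rfl, if_pos rfl]
    have h1 : ((2 * l).choose l : ℂ) = (2 * l).factorial / (l.factorial * l.factorial) := by
      rw [Nat.cast_choose ℂ (by omega), show 2 * l - l = l by omega]
    have h2 : ((2 * l).choose (l - m) : ℂ) =
        (2 * l).factorial / ((l - m).factorial * (l + m).factorial) := by
      rw [Nat.cast_choose ℂ (by omega), show 2 * l - (l - m) = l + m by omega]
    have f1 : ((2 * l).factorial : ℂ) ≠ 0 := Nat.cast_ne_zero.2 (Nat.factorial_ne_zero _)
    have f2 : (l.factorial : ℂ) ≠ 0 := Nat.cast_ne_zero.2 (Nat.factorial_ne_zero _)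
    have f3 : ((l - m).factorial : ℂ) ≠ 0 := Nat.cast_ne_zero.2 (Nat.factorial_ne_zero _)
    have f4 : ((l + m).factorial : ℂ) ≠ 0 := Nat.cast_ne_zero.2 (Nat.factorial_ne_zero _)
    have f5 : (2 * l + 1 : ℂ) ≠ 0 := by exact_mod_cast Nat.succ_ne_zero (2 * l)
    rw [h1, h2, assocConst, show (4 : ℂ) ^ l = 2 ^ l * 2 ^ l by rw [← mul_pow]; norm_num]
    field_simp
  · rw [if_neg (by omega), if_neg h, mul_zero]

lemma integral_assocHarm_mul {l m m' : ℕ} (hm : m ≤ l) (hm' : m' ≤ l) (h : 0 < m + m') :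
    ∫ y, assocHarm l m y * assocHarm l m' y ∂area = 0 := by
  simp only [assocHarm_eq _ hm, assocHarm_eq _ hm']
  simp_rw [mul_mul_mul_comm]
  rw [integral_const_mul, integral_coeff_isoPolyS_mul (by omega), mul_zero]

/-- The value at `1` of the Legendre polynomials. -/
lemma legendre_eval_one (l : ℕ) : (legendre l).eval 1 = 1 := by
  have h := pow_mul_legendre_eq_coeff (a := 0) (b := 0) (z := 1) (by simp) (Nat.zero_le l)
  have h1 : isoPoly 0 0 ((1 : ℝ) : ℂ) l = (Polynomial.C (2 ^ l)) * Polynomial.X ^ l := by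
    rw [isoPoly, Polynomial.C_pow, ← mul_pow]; simp
  rw [h1, Polynomial.coeff_C_mul_X_pow] at h
  have f2 : (l.factorial : ℂ) ≠ 0 := Nat.cast_ne_zero.2 (Nat.factorial_ne_zero _)
  simp only [pow_zero, Function.iterate_zero, id_eq, one_mul, add_zero, Nat.sub_zero,
    if_true] at h
  rw [div_mul_eq_mul_div, mul_comm,
    div_self (mul_ne_zero (pow_ne_zero _ two_ne_zero) f2)] at h
  exact_mod_cast h

/-! ### Zonal integrals and the Funk–Hecke formula -/

lemma inner_mem_Icc (x y : S2) : inner ℝ x.1 y.1 ∈ Set.Icc (-1 : ℝ) 1 := by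
  have h := abs_real_inner_le_norm x.1 y.1
  have hx : ‖x.1‖ = 1 := by simp
  have hy : ‖y.1‖ = 1 := by simp
  rw [hx, hy, one_mul] at h
  exact abs_le.1 h

lemma continuous_comp_inner {f : ℝ → ℝ} (hf : ContinuousOn f (Set.Icc (-1) 1)) (x : S2) :
    Continuous fun y : S2 => f (inner ℝ x.1 y.1) :=
  hf.comp_continuous (continuous_const.inner continuous_subtype_val) (inner_mem_Icc x)

lemma integral_inner_pow_S2 (x : S2) (n : ℕ) :
    ∫ y : S2, (inner ℝ x.1 y.1) ^ n ∂area = ∫ θ in (-1 : ℝ)..1, θ ^ n * (2 * Real.pi) := by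
  rw [integral_inner_pow, inner_self_S2, intervalIntegral.integral_mul_const, integral_pow]
  split_ifs with h
  · rw [(Even.add_one h).neg_one_pow]
    simp
    ring
  · rw [(Odd.add_one (Nat.not_even_iff_odd.1 h)).neg_one_pow]
    simp

/-- Weierstrass approximation for integrals of zonal functions. -/
lemma integral_comp_inner_mul_eq {h : S2 → ℝ} {k : ℝ → ℝ} (hh : Continuous h) (hk : Continuous k)
    (x : S2) (hpow : ∀ n : ℕ, ∫ y, (inner ℝ x.1 y.1) ^ n * h y ∂area =
      ∫ θ in (-1 : ℝ)..1, θ ^ n * k θ)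
    {f : ℝ → ℝ} (hf : ContinuousOn f (Set.Icc (-1) 1)) :
    ∫ y, f (inner ℝ x.1 y.1) * h y ∂area = ∫ θ in (-1 : ℝ)..1, f θ * k θ := by
  have hpoly : ∀ p : Polynomial ℝ, ∫ y, p.eval (inner ℝ x.1 y.1) * h y ∂area =
      ∫ θ in (-1 : ℝ)..1, p.eval θ * k θ := by
    intro p
    simp_rw [Polynomial.eval_eq_sum_range, Finset.sum_mul]
    rw [integral_finsetSum, intervalIntegral.integral_finsetSum]
    · refine Finset.sum_congr rfl fun i _ => ?_
      simp_rw [mul_assoc]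
      rw [integral_const_mul, intervalIntegral.integral_const_mul, hpow]
    · intro i _
      exact Continuous.intervalIntegrable (by fun_prop) _ _
    · intro i _
      have := continuous_comp_inner (f := fun θ => p.coeff i * θ ^ i) (by fun_prop) x
      exact integrable_of_continuous (this.mul hh)
  set B : ℝ := (∫ y, |h y| ∂area) + ∫ θ in (-1 : ℝ)..1, |k θ| with hB
  have hB0 : 0 ≤ B := add_nonneg (integral_nonneg fun _ => abs_nonneg _)
    (intervalIntegral.integral_nonneg (by norm_num) fun _ _ => abs_nonneg _)
  have key : ∀ ε > 0, |(∫ y, f (inner ℝ x.1 y.1) * h y ∂area) -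
      ∫ θ in (-1 : ℝ)..1, f θ * k θ| ≤ ε * B := by
    intro ε hε
    obtain ⟨p, hp⟩ := exists_polynomial_near_of_continuousOn (-1) 1 f hf ε hε
    have hpc : ContinuousOn (fun θ => p.eval θ) (Set.Icc (-1) 1) := p.continuous.continuousOn
    have i1 : Integrable (fun y => f (inner ℝ x.1 y.1) * h y) area :=
      integrable_of_continuous ((continuous_comp_inner hf x).mul hh)
    have i2 : Integrable (fun y => p.eval (inner ℝ x.1 y.1) * h y) area :=
      integrable_of_continuous ((continuous_comp_inner hpc x).mul hh)
    have i3 : IntervalIntegrable (fun θ => f θ * k θ) volume (-1) 1 :=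
      ContinuousOn.intervalIntegrable_of_Icc (by norm_num) (hf.mul hk.continuousOn)
    have i4 : IntervalIntegrable (fun θ => p.eval θ * k θ) volume (-1) 1 :=
      ContinuousOn.intervalIntegrable_of_Icc (by norm_num) (hpc.mul hk.continuousOn)
    have e1 : |(∫ y, f (inner ℝ x.1 y.1) * h y ∂area) -
        ∫ y, p.eval (inner ℝ x.1 y.1) * h y ∂area| ≤ ε * ∫ y, |h y| ∂area := by
      rw [← integral_sub i1 i2, ← integral_const_mul]
      refine (abs_integral_le_integral_abs).trans (integral_mono (i1.sub i2).abs
        ((integrable_of_continuous hh).abs.const_mul _) fun y => ?_)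
      simp only
      rw [← sub_mul, abs_mul, abs_sub_comm]
      exact mul_le_mul_of_nonneg_right (hp _ (inner_mem_Icc x y)).le (abs_nonneg _)
    have e2 : |(∫ θ in (-1 : ℝ)..1, p.eval θ * k θ) - ∫ θ in (-1 : ℝ)..1, f θ * k θ| ≤
        ε * ∫ θ in (-1 : ℝ)..1, |k θ| := by
      rw [← intervalIntegral.integral_sub i4 i3, ← intervalIntegral.integral_const_mul]
      refine (intervalIntegral.abs_integral_le_integral_abs (by norm_num)).trans
        (intervalIntegral.integral_mono_on (by norm_num) (i4.sub i3).abs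
          ((hk.abs.intervalIntegrable _ _).const_mul _) fun θ hθ => ?_)
      rw [← sub_mul, abs_mul]
      exact mul_le_mul_of_nonneg_right (hp _ hθ).le (abs_nonneg _)
    rw [hpoly p] at e1
    calc _ ≤ _ := abs_sub_le _ (∫ θ in (-1 : ℝ)..1, p.eval θ * k θ) _
      _ ≤ _ := by rw [hB, mul_add]; exact add_le_add e1 e2
  have h0 : |(∫ y, f (inner ℝ x.1 y.1) * h y ∂area) - ∫ θ in (-1 : ℝ)..1, f θ * k θ| ≤ 0 := by
    refine le_of_forall_pos_le_add fun δ hδ => ?_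
    refine (key (δ / (B + 1)) (by positivity)).trans ?_
    rw [zero_add, div_mul_eq_mul_div, div_le_iff₀ (by positivity)]
    nlinarith
  exact sub_eq_zero.1 (abs_nonpos_iff.1 h0)

/-- Archimedes' theorem. -/
lemma integral_comp_inner {f : ℝ → ℝ} (hf : ContinuousOn f (Set.Icc (-1) 1)) (x : S2) :
    ∫ y, f (inner ℝ x.1 y.1) ∂area = 2 * Real.pi * ∫ θ in (-1 : ℝ)..1, f θ := by
  have := integral_comp_inner_mul_eq (h := fun _ => 1) (k := fun _ => 2 * Real.pi)
    continuous_const continuous_const x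
    (fun n => by simpa using integral_inner_pow_S2 x n) hf
  simpa [intervalIntegral.integral_mul_const, mul_comm] using this

/-- The north pole. -/
noncomputable def northPole : S2 := ⟨EuclideanSpace.single 2 1, by simp⟩

lemma inner_northPole (y : S2) : inner ℝ northPole.1 y.1 = y.1 2 := by
  simp [northPole, EuclideanSpace.inner_single_left]

lemma assocHarm_zero (l : ℕ) (y : S2) : assocHarm l 0 y = ((legendre l).eval (y.1 2) : ℝ) := by
  simp [assocHarm]

/-- The constant is the same for all `m ≤ l` and all `x`, so it is found from `m = 0` at the north
pole, where `P_l(1) = 1` and Archimedes' theorem reduces the integral to `[-1, 1]`. -/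
lemma integral_inner_pow_mul_assocHarm (n : ℕ) {l m : ℕ} (hm : m ≤ l) (x : S2) :
    ∫ y : S2, ((inner ℝ x.1 y.1 : ℝ) : ℂ) ^ n * assocHarm l m y ∂area =
      ((2 * Real.pi * ∫ θ in (-1 : ℝ)..1, θ ^ n * (legendre l).eval θ : ℝ) : ℂ) *
        assocHarm l m x := by
  obtain ⟨c, hc⟩ := exists_funkHecke_assocHarm n l
  rw [hc m hm]
  congr 1
  have h := hc 0 (Nat.zero_le l) northPole
  simp only [assocHarm_zero, inner_northPole] at h
  rw [show (northPole.1 2 : ℝ) = 1 by simp [northPole], legendre_eval_one] at h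
  have h2 := integral_comp_inner (f := fun θ => θ ^ n * (legendre l).eval θ)
    ((continuous_id.pow n).mul (legendre l).continuous).continuousOn northPole
  simp only [inner_northPole] at h2
  rw [← h2, ← integral_complex_ofReal]
  simpa using h.symm

/-- The real part of the unnormalized harmonic. -/
lemma continuous_re_assocHarm (l m : ℕ) : Continuous fun y => (assocHarm l m y).re :=
  Complex.continuous_re.comp (continuous_assocHarm l m)

lemma continuous_im_assocHarm (l m : ℕ) : Continuous fun y => (assocHarm l m y).im :=
  Complex.continuous_im.comp (continuous_assocHarm l m)

/-- The normalization constant of the spherical harmonics. -/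
noncomputable def normConst (l k : ℕ) : ℝ :=
  √((2 * (l : ℝ) + 1) / (4 * Real.pi) * (((l - k).factorial : ℝ) / ((l + k).factorial : ℝ)))

lemma sphHarm_zero (l : ℕ) (x : S2) : sphHarm l 0 x = normConst l 0 * (assocHarm l 0 x).re := by
  simp [sphHarm, normConst, assocHarm_zero]

lemma sphHarm_of_pos (l : ℕ) {m : ℤ} (hm : 0 < m) (x : S2) :
    sphHarm l m x = normConst l m.natAbs * √2 * (assocHarm l m.natAbs x).re := by
  rw [sphHarm, if_neg hm.ne', if_pos hm, assocHarm, Complex.re_mul_ofReal, normConst, wcoord]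
  ring

lemma sphHarm_of_neg (l : ℕ) {m : ℤ} (hm : m < 0) (x : S2) :
    sphHarm l m x = normConst l m.natAbs * √2 * (assocHarm l m.natAbs x).im := by
  rw [sphHarm, if_neg hm.ne, if_neg hm.not_gt, assocHarm, Complex.im_mul_ofReal, normConst, wcoord]
  ring

lemma continuous_sphHarm (l : ℕ) (m : ℤ) : Continuous (sphHarm l m) := by
  rcases lt_trichotomy m 0 with h | rfl | h
  · rw [funext (sphHarm_of_neg l h)]
    exact (continuous_im_assocHarm l _).const_mul _
  · rw [funext (sphHarm_zero l)]
    exact (continuous_re_assocHarm l _).const_mul _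
  · rw [funext (sphHarm_of_pos l h)]
    exact (continuous_re_assocHarm l _).const_mul _

lemma integral_re_eq {f : S2 → ℂ} (hf : Continuous f) :
    ∫ y, (f y).re ∂area = (∫ y, f y ∂area).re :=
  Complex.reCLM.integral_comp_comm (integrable_of_continuous hf)

lemma integral_im_eq {f : S2 → ℂ} (hf : Continuous f) :
    ∫ y, (f y).im ∂area = (∫ y, f y ∂area).im :=
  Complex.imCLM.integral_comp_comm (integrable_of_continuous hf)

lemma integral_inner_pow_mul_sphHarm (n : ℕ) {l : ℕ} {m : ℤ} (hm : m.natAbs ≤ l) (x : S2) :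
    ∫ y : S2, (inner ℝ x.1 y.1) ^ n * sphHarm l m y ∂area =
      (2 * Real.pi * ∫ θ in (-1 : ℝ)..1, θ ^ n * (legendre l).eval θ) * sphHarm l m x := by
  have hc : Continuous fun y : S2 => ((inner ℝ x.1 y.1 : ℝ) : ℂ) ^ n * assocHarm l m.natAbs y :=
    ((Complex.continuous_ofReal.comp (continuous_const.inner continuous_subtype_val)).pow n).mul
      (continuous_assocHarm l _)
  have h := integral_inner_pow_mul_assocHarm n hm x
  have hre := integral_re_eq hc
  have him := integral_im_eq hc
  rw [h] at hre him
  simp_rw [← Complex.ofReal_pow] at hre him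
  simp only [Complex.re_ofReal_mul, Complex.im_ofReal_mul] at hre him
  rcases lt_trichotomy m 0 with h | rfl | h
  · simp only [sphHarm_of_neg l h]
    simp_rw [mul_left_comm _ (normConst l m.natAbs * √2)]
    rw [integral_const_mul, him]
  · simp only [sphHarm_zero]
    simp_rw [mul_left_comm _ (normConst l 0)]
    rw [integral_const_mul]
    simp only [Int.natAbs_zero] at hre
    rw [hre]
  · simp only [sphHarm_of_pos l h]
    simp_rw [mul_left_comm _ (normConst l m.natAbs * √2)]
    rw [integral_const_mul, hre]

/-- The Funk–Hecke formula. -/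
lemma integral_comp_inner_mul_sphHarm {f : ℝ → ℝ} (hf : ContinuousOn f (Set.Icc (-1) 1)) {l : ℕ}
    {m : ℤ} (hm : m.natAbs ≤ l) (x : S2) :
    ∫ y, f (inner ℝ x.1 y.1) * sphHarm l m y ∂area =
      (2 * Real.pi * ∫ θ in (-1 : ℝ)..1, f θ * (legendre l).eval θ) * sphHarm l m x := by
  rw [integral_comp_inner_mul_eq (k := fun θ => (legendre l).eval θ * (2 * Real.pi * sphHarm l m x))
    (continuous_sphHarm l m) ((legendre l).continuous.mul continuous_const) x _ hf]
  · simp_rw [← mul_assoc _ _ (2 * Real.pi * sphHarm l m x)]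
    rw [intervalIntegral.integral_mul_const]
    ring
  · intro n
    rw [integral_inner_pow_mul_sphHarm n hm]
    simp_rw [← mul_assoc _ _ (2 * Real.pi * sphHarm l m x)]
    rw [intervalIntegral.integral_mul_const]
    ring

/-! ### Orthonormality -/

/-- The squared norm of the unnormalized harmonic. -/
noncomputable def assocNormSq (l k : ℕ) : ℝ :=
  4 * Real.pi / (2 * l + 1) * ((l + k).factorial / (l - k).factorial)

lemma normConst_sq_mul (l k : ℕ) : normConst l k ^ 2 * assocNormSq l k = 1 := by
  rw [normConst, Real.sq_sqrt (by positivity), assocNormSq]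
  have f3 : ((l - k).factorial : ℝ) ≠ 0 := Nat.cast_ne_zero.2 (Nat.factorial_ne_zero _)
  have f4 : ((l + k).factorial : ℝ) ≠ 0 := Nat.cast_ne_zero.2 (Nat.factorial_ne_zero _)
  have := Real.pi_pos.ne'
  field_simp

section
variable {l k k' : ℕ} (hk : k ≤ l) (hk' : k' ≤ l)
include hk hk'

lemma integral_re_im_assocHarm :
    (∫ y, ((assocHarm l k y).re * (assocHarm l k' y).re +
        (assocHarm l k y).im * (assocHarm l k' y).im) ∂area = if k = k' then assocNormSq l k else 0) ∧
    (∫ y, ((assocHarm l k y).im * (assocHarm l k' y).re -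
        (assocHarm l k y).re * (assocHarm l k' y).im) ∂area = 0) := by
  have h := integral_assocHarm_mul_conj hk hk'
  have hc : Continuous fun y => assocHarm l k y * (starRingEnd ℂ) (assocHarm l k' y) :=
    (continuous_assocHarm l k).mul (Complex.continuous_conj.comp (continuous_assocHarm l k'))
  have e : (if k = k' then 4 * (Real.pi : ℂ) / (2 * l + 1) * ((l + k).factorial / (l - k).factorial)
      else 0) = ((if k = k' then assocNormSq l k else 0 : ℝ) : ℂ) := by
    split_ifs
    · simp [assocNormSq]
    · simp
  rw [e] at h
  have hre := integral_re_eq hc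
  have him := integral_im_eq hc
  rw [h] at hre him
  simp only [Complex.mul_re, Complex.mul_im, Complex.conj_re, Complex.conj_im, mul_neg,
    sub_neg_eq_add, Complex.ofReal_re, Complex.ofReal_im] at hre him
  refine ⟨hre, ?_⟩
  rw [← him]
  exact integral_congr_ae (.of_forall fun y => by ring)

lemma integral_re_im_assocHarm' (h0 : 0 < k + k') :
    (∫ y, ((assocHarm l k y).re * (assocHarm l k' y).re -
        (assocHarm l k y).im * (assocHarm l k' y).im) ∂area = 0) ∧
    (∫ y, ((assocHarm l k y).im * (assocHarm l k' y).re +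
        (assocHarm l k y).re * (assocHarm l k' y).im) ∂area = 0) := by
  have h := integral_assocHarm_mul hk hk' h0
  have hc : Continuous fun y => assocHarm l k y * assocHarm l k' y :=
    (continuous_assocHarm l k).mul (continuous_assocHarm l k')
  have hre := integral_re_eq hc
  have him := integral_im_eq hc
  rw [h] at hre him
  simp only [Complex.mul_re, Complex.mul_im, Complex.zero_re, Complex.zero_im] at hre him
  refine ⟨hre, ?_⟩
  rw [← him]
  exact integral_congr_ae (.of_forall fun y => by ring)

/-- Half-sums and half-differences of the relations for `f · conj g` and for `f · g`. The case `k =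
k' = 0` is excluded because there `f · g` has nonzero integral. -/
lemma integral_assocHarm_parts (h0 : 0 < k + k') :
    (∫ y, (assocHarm l k y).re * (assocHarm l k' y).re ∂area =
      if k = k' then assocNormSq l k / 2 else 0) ∧
    (∫ y, (assocHarm l k y).im * (assocHarm l k' y).im ∂area =
      if k = k' then assocNormSq l k / 2 else 0) ∧
    (∫ y, (assocHarm l k y).re * (assocHarm l k' y).im ∂area = 0) ∧
    (∫ y, (assocHarm l k y).im * (assocHarm l k' y).re ∂area = 0) := by
  obtain ⟨h1, h2⟩ := integral_re_im_assocHarm hk hk'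
  obtain ⟨h3, h4⟩ := integral_re_im_assocHarm' hk hk' h0
  have cr := fun k => continuous_re_assocHarm l k
  have ci := fun k => continuous_im_assocHarm l k
  have irr : Integrable (fun y => (assocHarm l k y).re * (assocHarm l k' y).re) area :=
    integrable_of_continuous ((cr k).mul (cr k'))
  have iii : Integrable (fun y => (assocHarm l k y).im * (assocHarm l k' y).im) area :=
    integrable_of_continuous ((ci k).mul (ci k'))
  have iri : Integrable (fun y => (assocHarm l k y).re * (assocHarm l k' y).im) area :=
    integrable_of_continuous ((cr k).mul (ci k'))
  have iir : Integrable (fun y => (assocHarm l k y).im * (assocHarm l k' y).re) area :=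
    integrable_of_continuous ((ci k).mul (cr k'))
  rw [integral_add irr iii] at h1
  rw [integral_sub iir iri] at h2
  rw [integral_sub irr iii] at h3
  rw [integral_add iir iri] at h4
  refine ⟨?_, ?_, ?_, ?_⟩
  · split_ifs at h1 ⊢ <;> linarith
  · split_ifs at h1 ⊢ <;> linarith
  · linarith
  · linarith

end

lemma integral_cmul_cmul (a b : ℝ) (f g : S2 → ℝ) :
    ∫ y, (a * f y) * (b * g y) ∂area = a * b * ∫ y, f y * g y ∂area := by
  rw [← integral_const_mul]
  exact integral_congr_ae (.of_forall fun y => by ring)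

/-- Orthonormality of the real spherical harmonics. -/
lemma integral_sphHarm_mul_sphHarm {l : ℕ} {m m' : ℤ} (hm : m.natAbs ≤ l) (hm' : m'.natAbs ≤ l) :
    ∫ y, sphHarm l m y * sphHarm l m' y ∂area = if m = m' then 1 else 0 := by
  have hsq : (√2 : ℝ) * √2 = 2 := Real.mul_self_sqrt (by norm_num)
  have parts := integral_assocHarm_parts hm hm'
  have hN := normConst_sq_mul l m.natAbs
  rcases lt_trichotomy m 0 with h | rfl | h <;> rcases lt_trichotomy m' 0 with h' | rfl | h'
  · obtain ⟨h1, h2, h3, h4⟩ := parts (by omega)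
    simp only [sphHarm_of_neg l h, sphHarm_of_neg l h']
    rw [integral_cmul_cmul, h2]
    split_ifs with e1 e2 e2
    · rw [← e1]; linear_combination hN + (normConst l m.natAbs ^ 2 * assocNormSq l m.natAbs / 2) * hsq
    · omega
    · omega
    · simp
  · obtain ⟨h1, h2, h3, h4⟩ := parts (by omega)
    simp only [sphHarm_of_neg l h, sphHarm_zero]
    simp only [Int.natAbs_zero] at h4
    rw [integral_cmul_cmul, h4, if_neg (by omega), mul_zero]
  · obtain ⟨h1, h2, h3, h4⟩ := parts (by omega)
    simp only [sphHarm_of_neg l h, sphHarm_of_pos l h']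
    rw [integral_cmul_cmul, h4, if_neg (by omega), mul_zero]
  · obtain ⟨h1, h2, h3, h4⟩ := parts (by omega)
    simp only [sphHarm_of_neg l h', sphHarm_zero]
    simp only [Int.natAbs_zero] at h3
    rw [integral_cmul_cmul, h3, if_neg (by omega), mul_zero]
  · obtain ⟨h1, h2⟩ := integral_re_im_assocHarm (Nat.zero_le l) (Nat.zero_le l)
    have him : ∀ y, (assocHarm l 0 y).im = 0 := fun y => by rw [assocHarm_zero]; simp
    simp only [him, mul_zero, add_zero, if_true] at h1
    simp only [sphHarm_zero]
    simp only [Int.natAbs_zero] at hN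
    rw [integral_cmul_cmul, h1, if_pos trivial, ← hN]
    ring
  · obtain ⟨h1, h2, h3, h4⟩ := parts (by omega)
    simp only [sphHarm_of_pos l h', sphHarm_zero]
    simp only [Int.natAbs_zero] at h1
    rw [integral_cmul_cmul, h1, if_neg (by omega), if_neg (by omega), mul_zero]
  · obtain ⟨h1, h2, h3, h4⟩ := parts (by omega)
    simp only [sphHarm_of_pos l h, sphHarm_of_neg l h']
    rw [integral_cmul_cmul, h3, if_neg (by omega), mul_zero]
  · obtain ⟨h1, h2, h3, h4⟩ := parts (by omega)
    simp only [sphHarm_of_pos l h, sphHarm_zero]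
    simp only [Int.natAbs_zero] at h1
    rw [integral_cmul_cmul, h1, if_neg (by omega), if_neg (by omega), mul_zero]
  · obtain ⟨h1, h2, h3, h4⟩ := parts (by omega)
    simp only [sphHarm_of_pos l h, sphHarm_of_pos l h']
    rw [integral_cmul_cmul, h1]
    split_ifs with e1 e2 e2
    · rw [← e1]; linear_combination hN + (normConst l m.natAbs ^ 2 * assocNormSq l m.natAbs / 2) * hsq
    · omega
    · omega
    · simp

/-- By Archimedes' theorem this is the inner product on the sphere of the harmonics with `m = 0`. -/
lemma integral_legendre_mul_legendre (l l' : ℕ) :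
    ∫ θ in (-1 : ℝ)..1, (legendre l).eval θ * (legendre l').eval θ =
      if l = l' then 2 / (2 * (l : ℝ) + 1) else 0 := by
  have h2 := integral_comp_inner (f := fun θ => (legendre l).eval θ * (legendre l').eval θ)
    ((legendre l).continuous.mul (legendre l').continuous).continuousOn northPole
  simp only [inner_northPole] at h2
  have h3 : ∫ y : S2, (legendre l).eval (y.1 2) * (legendre l').eval (y.1 2) ∂area =
      if l = l' then 4 * Real.pi / (2 * (l : ℝ) + 1) else 0 := by
    split_ifs with h
    · subst h
      obtain ⟨h1, -⟩ := integral_re_im_assocHarm (Nat.zero_le l) (Nat.zero_le l)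
      simp only [assocHarm_zero] at h1
      simp only [Complex.ofReal_re, Complex.ofReal_im, mul_zero, add_zero, if_true,
        assocNormSq, Nat.sub_zero] at h1
      rw [h1, div_self (Nat.cast_ne_zero.2 (Nat.factorial_ne_zero _)), mul_one]
    · have h1 : ∫ y : S2, assocHarm l 0 y * assocHarm l' 0 y ∂area = 0 := by
        simp only [assocHarm_eq _ (Nat.zero_le _)]
        simp_rw [mul_mul_mul_comm]
        rw [integral_const_mul, integral_coeff_isoPolyS_mul_of_ne h, mul_zero]
      simp only [assocHarm_zero, ← Complex.ofReal_mul] at h1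
      rw [integral_complex_ofReal] at h1
      exact_mod_cast h1
  rw [h2] at h3
  have hpi := Real.pi_pos.ne'
  split_ifs at h3 ⊢ with h
  · field_simp at h3 ⊢
    linarith
  · exact (mul_eq_zero.1 h3).resolve_left (by positivity)

/-! ### Completeness of the Legendre polynomials -/

open Polynomial in
lemma degree_legendre (l : ℕ) : (legendre l).degree = l := by
  have hd : ((X ^ 2 - 1 : ℝ[X]) ^ l).natDegree ≤ 2 * l := by
    compute_degree
    omega
  have hle : (legendre l).natDegree ≤ l := by
    refine (natDegree_C_mul_le _ _).trans ((natDegree_iterate_derivative _ l).trans ?_)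
    omega
  have hmonic : (X ^ 2 - 1 : ℝ[X]).Monic := by monicity!
  have hlead : ((X ^ 2 - 1 : ℝ[X]) ^ l).coeff (2 * l) = 1 := by
    have h := hmonic.pow l
    have h2 : ((X ^ 2 - 1 : ℝ[X]) ^ l).natDegree = 2 * l := by
      rw [hmonic.natDegree_pow, show (X ^ 2 - 1 : ℝ[X]).natDegree = 2 by compute_degree!, mul_comm]
    rw [← h2]
    exact h
  have hc : (legendre l).coeff l ≠ 0 := by
    rw [legendre, coeff_C_mul, coeff_iterate_derivative, ← two_mul, hlead, nsmul_eq_mul, mul_one]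
    refine mul_ne_zero (by positivity) (Nat.cast_ne_zero.2 ?_)
    exact (Nat.descFactorial_pos.2 (by omega)).ne'
  have hn := natDegree_eq_of_le_of_coeff_ne_zero hle hc
  have h0 : legendre l ≠ 0 := fun h => by simp [h] at hc
  rw [degree_eq_natDegree h0, hn]

/-- The sequence of Legendre polynomials. -/
noncomputable def legendreSeq : Polynomial.Sequence ℝ where
  elems' := legendre
  degree_eq' := degree_legendre

/-- One polynomial in each degree, with invertible leading coefficients, spans all polynomials. -/
lemma exists_eq_sum_legendre (p : Polynomial ℝ) : ∃ (N : ℕ) (a : ℕ → ℝ),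
    p = ∑ l ∈ Finset.range N, a l • legendre l := by
  have h : p ∈ Submodule.span ℝ (Set.range legendreSeq) := by
    rw [legendreSeq.span (fun i => (Polynomial.leadingCoeff_ne_zero.2 (legendreSeq.ne_zero i)).isUnit)]
    trivial
  obtain ⟨c, hc⟩ := Finsupp.mem_span_range_iff_exists_finsupp.1 h
  obtain ⟨N, hN⟩ := c.support.exists_nat_subset_range
  refine ⟨N, c, hc.symm.trans ?_⟩
  exact Finsupp.sum_of_support_subset _ hN _ (by simp)

lemma integral_sub_sum_legendre_sq {f : ℝ → ℝ} (hf : Continuous f) (N : ℕ) (a : ℕ → ℝ) :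
    ∫ θ in (-1 : ℝ)..1, (f θ - ∑ l ∈ Finset.range N, a l * (legendre l).eval θ) ^ 2 =
      (∫ θ in (-1 : ℝ)..1, f θ ^ 2) +
      ∑ l ∈ Finset.range N, (2 / (2 * (l : ℝ) + 1) * a l ^ 2 -
        2 * a l * ∫ θ in (-1 : ℝ)..1, f θ * (legendre l).eval θ) := by
  have hP : ∀ l, Continuous fun θ => (legendre l).eval θ := fun l => (legendre l).continuous
  have e : ∀ θ, (f θ - ∑ l ∈ Finset.range N, a l * (legendre l).eval θ) ^ 2 =
      f θ ^ 2 + ∑ l ∈ Finset.range N, (∑ l' ∈ Finset.range N,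
        (a l * a l') * ((legendre l).eval θ * (legendre l').eval θ) -
        (2 * a l) * (f θ * (legendre l).eval θ)) := by
    intro θ
    rw [sub_sq, Finset.sum_sub_distrib, sq (∑ l ∈ Finset.range N, _), Finset.sum_mul_sum,
      Finset.mul_sum]
    have h1 : ∀ l l', (a l * a l') * ((legendre l).eval θ * (legendre l').eval θ) =
      a l * (legendre l).eval θ * (a l' * (legendre l').eval θ) := fun l l' => by ring
    simp_rw [h1]
    have h2 : ∀ l, 2 * f θ * (a l * (legendre l).eval θ) = 2 * a l * (f θ * (legendre l).eval θ) :=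
      fun l => by ring
    simp_rw [h2]
    ring
  simp_rw [e]
  rw [intervalIntegral.integral_add (Continuous.intervalIntegrable (by fun_prop) _ _)
    (Continuous.intervalIntegrable (by fun_prop) _ _)]
  congr 1
  rw [intervalIntegral.integral_finsetSum
    (fun l _ => Continuous.intervalIntegrable (by fun_prop) _ _)]
  refine Finset.sum_congr rfl fun l hl => ?_
  rw [intervalIntegral.integral_sub (Continuous.intervalIntegrable (by fun_prop) _ _)
    (Continuous.intervalIntegrable (by fun_prop) _ _), intervalIntegral.integral_const_mul,
    intervalIntegral.integral_finsetSum
      (fun l _ => Continuous.intervalIntegrable (by fun_prop) _ _)]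
  congr 1
  simp_rw [intervalIntegral.integral_const_mul, integral_legendre_mul_legendre]
  simp only [mul_ite, mul_zero, Finset.sum_ite_eq, hl, if_true]
  ring

/-- Parseval's identity for the Legendre polynomials. -/
lemma hasSum_legendre_sq_of_continuous {f : ℝ → ℝ} (hf : Continuous f) :
    HasSum (fun l : ℕ => (2 * (l : ℝ) + 1) / 2 * (∫ θ in (-1 : ℝ)..1, f θ * (legendre l).eval θ) ^ 2)
      (∫ θ in (-1 : ℝ)..1, f θ ^ 2) := by
  set c : ℕ → ℝ := fun l => ∫ θ in (-1 : ℝ)..1, f θ * (legendre l).eval θ with hc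
  have hnn : ∀ l : ℕ, 0 ≤ (2 * (l : ℝ) + 1) / 2 * c l ^ 2 := fun l => by positivity
  have hle : ∀ N, ∑ l ∈ Finset.range N, (2 * (l : ℝ) + 1) / 2 * c l ^ 2 ≤
      ∫ θ in (-1 : ℝ)..1, f θ ^ 2 := by
    intro N
    -- With the Fourier–Legendre coefficients the squared distance equals the squared norm minus the
    -- partial sum: this is Bessel's inequality.
    have h := integral_sub_sum_legendre_sq hf N (fun l => (2 * (l : ℝ) + 1) / 2 * c l)
    have h0 : 0 ≤ ∫ θ in (-1 : ℝ)..1,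
        (f θ - ∑ l ∈ Finset.range N, (2 * (l : ℝ) + 1) / 2 * c l * (legendre l).eval θ) ^ 2 :=
      intervalIntegral.integral_nonneg (by norm_num) fun _ _ => sq_nonneg _
    rw [h] at h0
    have e : ∀ l : ℕ, 2 / (2 * (l : ℝ) + 1) * ((2 * (l : ℝ) + 1) / 2 * c l) ^ 2 -
        2 * ((2 * (l : ℝ) + 1) / 2 * c l) * c l = -((2 * (l : ℝ) + 1) / 2 * c l ^ 2) := by
      intro l
      have : (2 * (l : ℝ) + 1) ≠ 0 := by positivity
      field_simp
      ring
    have h0' : 0 ≤ (∫ θ in (-1 : ℝ)..1, f θ ^ 2) +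
        ∑ l ∈ Finset.range N, -((2 * (l : ℝ) + 1) / 2 * c l ^ 2) := by
      rw [← Finset.sum_congr rfl (fun l _ => e l)]
      exact h0
    rw [Finset.sum_neg_distrib] at h0'
    linarith
  have hge : ∀ ε > 0, ∃ N, (∫ θ in (-1 : ℝ)..1, f θ ^ 2) - ε ≤
      ∑ l ∈ Finset.range N, (2 * (l : ℝ) + 1) / 2 * c l ^ 2 := by
    intro ε hε
    -- The interval has length `2`, so uniform error `√(ε/2)` gives squared `L²` error at most `ε`.
    obtain ⟨p, hp⟩ := exists_polynomial_near_of_continuousOn (-1) 1 f hf.continuousOn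
      (√(ε / 2)) (by positivity)
    obtain ⟨N, a, rfl⟩ := exists_eq_sum_legendre p
    refine ⟨N, ?_⟩
    have h := integral_sub_sum_legendre_sq hf N a
    have hP : ∀ l, Continuous fun θ => (legendre l).eval θ := fun l => (legendre l).continuous
    have h1 : ∫ θ in (-1 : ℝ)..1, (f θ - ∑ l ∈ Finset.range N, a l * (legendre l).eval θ) ^ 2 ≤
        ∫ θ in (-1 : ℝ)..1, ε / 2 := by
      refine intervalIntegral.integral_mono_on (by norm_num)
        (Continuous.intervalIntegrable (by fun_prop) _ _) (by simp) fun θ hθ => ?_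
      have h2 := (hp θ hθ).le
      simp only [Polynomial.eval_finsetSum, Polynomial.eval_smul, smul_eq_mul] at h2
      rw [abs_sub_comm] at h2
      rw [← sq_abs]
      exact (pow_le_pow_left₀ (abs_nonneg _) h2 2).trans_eq (Real.sq_sqrt (by positivity))
    rw [h] at h1
    simp only [intervalIntegral.integral_const, smul_eq_mul] at h1
    -- Completing the square: the Fourier–Legendre coefficients are at least as good as those of the
    -- approximating polynomial.
    have h3 : ∑ l ∈ Finset.range N, -((2 * (l : ℝ) + 1) / 2 * c l ^ 2) ≤
        ∑ l ∈ Finset.range N, (2 / (2 * (l : ℝ) + 1) * a l ^ 2 - 2 * a l * c l) := by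
      refine Finset.sum_le_sum fun l _ => ?_
      have hl : (0 : ℝ) < 2 * (l : ℝ) + 1 := by positivity
      have : 2 / (2 * (l : ℝ) + 1) * a l ^ 2 - 2 * a l * c l + (2 * (l : ℝ) + 1) / 2 * c l ^ 2 =
          2 / (2 * (l : ℝ) + 1) * (a l - (2 * (l : ℝ) + 1) / 2 * c l) ^ 2 := by
        field_simp
        ring
      have h0 : 0 ≤ 2 / (2 * (l : ℝ) + 1) * (a l - (2 * (l : ℝ) + 1) / 2 * c l) ^ 2 := by positivity
      linarith
    rw [Finset.sum_neg_distrib] at h3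
    linarith
  refine (hasSum_iff_tendsto_nat_of_nonneg hnn _).2 ?_
  rw [Metric.tendsto_atTop]
  intro ε hε
  obtain ⟨N, hN⟩ := hge (ε / 2) (by positivity)
  refine ⟨N, fun n hn => ?_⟩
  have hmono : ∑ l ∈ Finset.range N, (2 * (l : ℝ) + 1) / 2 * c l ^ 2 ≤
      ∑ l ∈ Finset.range n, (2 * (l : ℝ) + 1) / 2 * c l ^ 2 :=
    Finset.sum_le_sum_of_subset_of_nonneg (Finset.range_mono hn) fun l _ _ => hnn l
  rw [Real.dist_eq, abs_lt]
  constructor <;> linarith [hle n]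

/-- Parseval's identity for the Legendre polynomials. -/
lemma hasSum_legendre_sq {f : ℝ → ℝ} (hf : ContinuousOn f (Set.Icc (-1) 1)) :
    HasSum (fun l : ℕ => (2 * (l : ℝ) + 1) / 2 * (∫ θ in (-1 : ℝ)..1, f θ * (legendre l).eval θ) ^ 2)
      (∫ θ in (-1 : ℝ)..1, f θ ^ 2) := by
  have h11 : (-1 : ℝ) ≤ 1 := by norm_num
  have hg : Continuous (Set.IccExtend h11 (Set.domRestrict (Set.Icc (-1) 1) f)) :=
    (continuousOn_iff_continuous_domRestrict.1 hf).Icc_extend'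
  have heq : ∀ θ ∈ Set.uIcc (-1 : ℝ) 1, Set.IccExtend h11 (Set.domRestrict (Set.Icc (-1) 1) f) θ = f θ := by
    intro θ hθ
    rw [Set.uIcc_of_le h11] at hθ
    rw [Set.IccExtend_of_mem h11 _ hθ]
    rfl
  have h := hasSum_legendre_sq_of_continuous hg
  rw [intervalIntegral.integral_congr (g := fun θ => f θ ^ 2)
    (fun θ hθ => by simp only [heq θ hθ])] at h
  have h2 : ∀ l : ℕ, ∫ θ in (-1 : ℝ)..1,
      Set.IccExtend h11 (Set.domRestrict (Set.Icc (-1) 1) f) θ * (legendre l).eval θ =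
      ∫ θ in (-1 : ℝ)..1, f θ * (legendre l).eval θ := fun l =>
    intervalIntegral.integral_congr fun θ hθ => by simp only [heq θ hθ]
  simpa only [h2] using h

/-! ### Gaussian moments -/

/-- The indicator of `[u, ∞)`. -/
noncomputable def above (u v : ℝ) : ℝ := if u ≤ v then 1 else 0

lemma measurable_above (u : ℝ) : Measurable (above u) :=
  Measurable.ite measurableSet_Ici measurable_const measurable_const

lemma above_nonneg (u v : ℝ) : 0 ≤ above u v := by
  unfold above; split_ifs <;> norm_num

lemma above_le_one (u v : ℝ) : above u v ≤ 1 := by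
  unfold above; split_ifs <;> norm_num

lemma abs_above_le_one (u v : ℝ) : |above u v| ≤ 1 := by
  rw [abs_of_nonneg (above_nonneg u v)]; exact above_le_one u v

lemma above_eq_indicator (u : ℝ) : above u = (Set.Ici u).indicator 1 := by
  ext v; simp [above, Set.indicator]

/-- The tail of the standard normal distribution. -/
noncomputable def gaussTail (u : ℝ) : ℝ := (gaussianReal 0 1).real (Set.Ici u)

lemma gaussianPDFReal_std (x : ℝ) :
    gaussianPDFReal 0 1 x = (√(2 * Real.pi))⁻¹ * Real.exp (-(1 / 2) * x ^ 2) := by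
  rw [gaussianPDFReal_def]
  simp
  left
  ring

lemma hasDerivAt_gaussianPDFReal_std (x : ℝ) :
    HasDerivAt (gaussianPDFReal 0 1) (-x * gaussianPDFReal 0 1 x) x := by
  rw [funext gaussianPDFReal_std]
  have h := (((hasDerivAt_id x).pow 2).const_mul (-(1 / 2 : ℝ))).exp.const_mul (√(2 * Real.pi))⁻¹
  refine h.congr_deriv ?_
  simp
  ring

lemma integrable_pow_mul_gaussianPDFReal_std (n : ℕ) :
    Integrable fun x => x ^ n * gaussianPDFReal 0 1 x := by
  have h := (integrable_rpow_mul_exp_neg_mul_sq (b := 1 / 2) (by norm_num) (s := n)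
    (by have : (0 : ℝ) ≤ n := n.cast_nonneg
        linarith)).const_mul (√(2 * Real.pi))⁻¹
  refine h.congr (.of_forall fun x => ?_)
  simp only [gaussianPDFReal_std, Real.rpow_natCast]
  ring

lemma integral_above_gaussian (u : ℝ) : ∫ x, above u x ∂(gaussianReal 0 1) = gaussTail u := by
  rw [above_eq_indicator, integral_indicator_one measurableSet_Ici, gaussTail]

lemma gaussTail_eq_integral (u : ℝ) : gaussTail u = ∫ x in Set.Ioi u, gaussianPDFReal 0 1 x := by
  rw [gaussTail, Measure.real, gaussianReal_apply_eq_integral 0 one_ne_zero, integral_Ici_eq_integral_Ioi,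
    ENNReal.toReal_ofReal]
  exact setIntegral_nonneg measurableSet_Ioi fun x _ => gaussianPDFReal_nonneg _ _ _

lemma integral_above_mul_gaussian (u : ℝ) (f : ℝ → ℝ) :
    ∫ x, above u x * f x ∂(gaussianReal 0 1) =
      ∫ x in Set.Ioi u, f x * gaussianPDFReal 0 1 x := by
  rw [integral_gaussianReal_eq_integral_smul one_ne_zero, ← integral_Ici_eq_integral_Ioi,
    ← integral_indicator measurableSet_Ici]
  refine integral_congr_ae (.of_forall fun x => ?_)
  simp only [above, Set.indicator, Set.mem_Ici]
  split_ifs <;> simp [mul_comm]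

/-- The function `x² φ - φ` is the derivative of `-x φ`. -/
lemma integral_above_mul_sq_gaussian (u : ℝ) :
    ∫ x, above u x * x ^ 2 ∂(gaussianReal 0 1) = gaussTail u + u * gaussianPDFReal 0 1 u := by
  rw [integral_above_mul_gaussian, gaussTail_eq_integral]
  have hd : ∀ x, HasDerivAt (fun x => -(x * gaussianPDFReal 0 1 x))
      (x ^ 2 * gaussianPDFReal 0 1 x - gaussianPDFReal 0 1 x) x := by
    intro x
    refine (((hasDerivAt_id x).mul (hasDerivAt_gaussianPDFReal_std x)).neg).congr_deriv ?_
    simp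
    ring
  have i0 := integrable_pow_mul_gaussianPDFReal_std 0
  have i1 := integrable_pow_mul_gaussianPDFReal_std 1
  have i2 := integrable_pow_mul_gaussianPDFReal_std 2
  simp only [pow_zero, one_mul, pow_one] at i0 i1
  have h := integral_Ioi_of_hasDerivAt_of_tendsto' (a := u) (fun x _ => hd x)
    (i2.sub i0).integrableOn
    (tendsto_zero_of_hasDerivAt_of_integrableOn_Ioi (a := u) (fun x _ => hd x)
      (i2.sub i0).integrableOn i1.neg.integrableOn)
  rw [integral_sub i2.integrableOn i0.integrableOn] at h
  linarith

lemma integral_pow_four_gaussianReal (v : NNReal) :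
    ∫ x, x ^ 4 ∂(gaussianReal 0 v) = 3 * (v : ℝ) ^ 2 := by
  have h12 : ((1 / 2 : NNReal)) ≠ 0 := by norm_num
  -- Variance `1/2` is the one for which the density is `π^(-1/2) e^(-x²)`; the general variance
  -- follows by scaling, which also covers `v = 0`.
  have h : ∫ x, x ^ 4 ∂(gaussianReal 0 (1 / 2)) = 3 / 4 := by
    rw [integral_gaussianReal_eq_integral_smul h12]
    have e : ∀ x, gaussianPDFReal 0 (1 / 2) x • x ^ 4 =
        (√Real.pi)⁻¹ * (x ^ 4 * Real.exp (-x ^ 2)) := by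
      intro x
      rw [gaussianPDFReal_def]
      simp [mul_comm, mul_assoc]
    simp_rw [e]
    rw [integral_const_mul, integral_pow_mul_exp_neg_sq_of_even (by decide), radialGauss_add_two 2,
      radialGauss_add_two 0, radialGauss_eq]
    simp only [Nat.cast_zero, zero_add, Real.Gamma_one_half_eq]
    have : √Real.pi ≠ 0 := by positivity
    field_simp
    norm_num
  have hmap : gaussianReal 0 v = (gaussianReal 0 (1 / 2)).map (√(2 * (v : ℝ)) * ·) := by
    rw [gaussianReal_map_const_mul]
    congr 1
    · simp
    · ext
      simp only [NNReal.coe_mul, NNReal.coe_mk, Real.sq_sqrt (show (0 : ℝ) ≤ 2 * v by positivity)]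
      push_cast
      ring
  rw [hmap, integral_map (by fun_prop) (by fun_prop)]
  simp_rw [mul_pow]
  rw [integral_const_mul, h, show 4 = 2 * 2 by norm_num, pow_mul,
    Real.sq_sqrt (show (0 : ℝ) ≤ 2 * v by positivity)]
  ring

section Gaussian

variable {Ω : Type*} [MeasurableSpace Ω] {P : Measure Ω}

lemma map_eq_of_gaussian {X : Ω → ℝ} (hX : HasGaussianLaw X P) (h0 : ∫ ω, X ω ∂P = 0) :
    P.map X = gaussianReal 0 (∫ ω, X ω ^ 2 ∂P).toNNReal := by
  rw [hX.map_eq_gaussianReal, h0, variance_of_integral_eq_zero hX.aemeasurable h0]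

lemma integral_pow_four_of_gaussian {X : Ω → ℝ} (hX : HasGaussianLaw X P) (h0 : ∫ ω, X ω ∂P = 0) :
    ∫ ω, X ω ^ 4 ∂P = 3 * (∫ ω, X ω ^ 2 ∂P) ^ 2 := by
  have h := integral_map hX.aemeasurable (f := fun x : ℝ => x ^ 4) (by fun_prop)
  rw [← h, map_eq_of_gaussian hX h0, integral_pow_four_gaussianReal,
    Real.coe_toNNReal _ (integral_nonneg fun _ => sq_nonneg _)]

lemma memLp_mul_of_gaussian {X Y : Ω → ℝ} (hX : HasGaussianLaw X P) (hY : HasGaussianLaw Y P) :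
    MemLp (fun ω => X ω * Y ω) 2 P := by
  have : ENNReal.HolderTriple 4 4 2 := ⟨by
    rw [← ENNReal.toReal_eq_toReal_iff' (by simp) (by simp),
      ENNReal.toReal_add (by simp) (by simp)]
    norm_num⟩
  exact MemLp.mul (hY.memLp (p := 4) (by norm_num)) (hX.memLp (p := 4) (by norm_num))

lemma integrable_mul_mul_mul_of_gaussian {X Y Z W : Ω → ℝ} (hX : HasGaussianLaw X P)
    (hY : HasGaussianLaw Y P) (hZ : HasGaussianLaw Z P) (hW : HasGaussianLaw W P) :
    Integrable (fun ω => X ω * Y ω * (Z ω * W ω)) P :=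
  (memLp_mul_of_gaussian hX hY).integrable_mul (memLp_mul_of_gaussian hZ hW)

variable [IsProbabilityMeasure P]

lemma integrable_mul_of_gaussian {X Y : Ω → ℝ} (hX : HasGaussianLaw X P) (hY : HasGaussianLaw Y P) :
    Integrable (fun ω => X ω * Y ω) P :=
  (memLp_mul_of_gaussian hX hY).integrable (by norm_num)

/-- Polarization: adding the fourth moments of `X + Y` and `X - Y`, each known from its variance,
isolates `E[X² Y²]`. -/
lemma integral_sq_mul_sq_of_gaussian {X Y : Ω → ℝ}
    (hG : ∀ a b : ℝ, HasGaussianLaw (fun ω => a * X ω + b * Y ω) P)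
    (hX0 : ∫ ω, X ω ∂P = 0) (hY0 : ∫ ω, Y ω ∂P = 0) :
    ∫ ω, X ω ^ 2 * Y ω ^ 2 ∂P =
      (∫ ω, X ω ^ 2 ∂P) * (∫ ω, Y ω ^ 2 ∂P) + 2 * (∫ ω, X ω * Y ω ∂P) ^ 2 := by
  have hX : HasGaussianLaw X P := by simpa using hG 1 0
  have hY : HasGaussianLaw Y P := by simpa using hG 0 1
  have iXX := integrable_mul_of_gaussian hX hX
  have iXY := integrable_mul_of_gaussian hX hY
  have iYY := integrable_mul_of_gaussian hY hY
  have j0 := integrable_mul_mul_mul_of_gaussian hX hX hX hX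
  have j1 := integrable_mul_mul_mul_of_gaussian hX hX hX hY
  have j2 := integrable_mul_mul_mul_of_gaussian hX hX hY hY
  have j3 := integrable_mul_mul_mul_of_gaussian hX hY hY hY
  have j4 := integrable_mul_mul_mul_of_gaussian hY hY hY hY
  have hc : ∀ b : ℝ, ∫ ω, (1 * X ω + b * Y ω) ∂P = 0 := fun b => by
    rw [integral_add (hX.integrable.const_mul _) (hY.integrable.const_mul _), integral_const_mul,
      integral_const_mul, hX0, hY0]; ring
  have h2 : ∀ b : ℝ, ∫ ω, (1 * X ω + b * Y ω) ^ 2 ∂P =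
      (∫ ω, X ω * X ω ∂P) + 2 * b * (∫ ω, X ω * Y ω ∂P) + b ^ 2 * (∫ ω, Y ω * Y ω ∂P) := fun b => by
    rw [← integral_const_mul, ← integral_const_mul, ← integral_add iXX (iXY.const_mul _),
      ← integral_add (iXX.fun_add (iXY.const_mul _)) (iYY.const_mul _)]
    exact integral_congr_ae (.of_forall fun ω => by ring)
  have h4 : (∫ ω, (1 * X ω + 1 * Y ω) ^ 4 ∂P) + ∫ ω, (1 * X ω + (-1) * Y ω) ^ 4 ∂P =
      2 * (∫ ω, X ω ^ 4 ∂P) + 12 * (∫ ω, X ω ^ 2 * Y ω ^ 2 ∂P) + 2 * ∫ ω, Y ω ^ 4 ∂P := by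
    have k0 : Integrable (fun ω => X ω ^ 4) P := j0.congr (.of_forall fun ω => by ring)
    have k2 : Integrable (fun ω => X ω ^ 2 * Y ω ^ 2) P := j2.congr (.of_forall fun ω => by ring)
    have k4 : Integrable (fun ω => Y ω ^ 4) P := j4.congr (.of_forall fun ω => by ring)
    have e : ∀ b : ℝ, Integrable (fun ω => (1 * X ω + b * Y ω) ^ 4) P := fun b => by
      have h := integrable_mul_mul_mul_of_gaussian (hG 1 b) (hG 1 b) (hG 1 b) (hG 1 b)
      exact h.congr (.of_forall fun ω => by ring)
    rw [← integral_const_mul, ← integral_const_mul, ← integral_const_mul,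
      ← integral_add (e _) (e _), ← integral_add (k0.const_mul _) (k2.const_mul _),
      ← integral_add ((k0.const_mul _).fun_add (k2.const_mul _)) (k4.const_mul _)]
    exact integral_congr_ae (.of_forall fun ω => by ring)
  rw [integral_pow_four_of_gaussian (hG 1 1) (hc 1), integral_pow_four_of_gaussian (hG 1 (-1)) (hc _),
    h2, h2, integral_pow_four_of_gaussian hX hX0, integral_pow_four_of_gaussian hY hY0] at h4
  simp only [← sq] at h4
  linarith

/-- The fourth order Wick formula. -/
lemma integral_mul_four_of_gaussian {X Y Z W : Ω → ℝ}
    (hG : ∀ a b c d : ℝ, HasGaussianLaw (fun ω => a * X ω + b * Y ω + c * Z ω + d * W ω) P)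
    (hX0 : ∫ ω, X ω ∂P = 0) (hY0 : ∫ ω, Y ω ∂P = 0) (hZ0 : ∫ ω, Z ω ∂P = 0)
    (hW0 : ∫ ω, W ω ∂P = 0) :
    ∫ ω, X ω * Y ω * (Z ω * W ω) ∂P =
      (∫ ω, X ω * Y ω ∂P) * (∫ ω, Z ω * W ω ∂P) + (∫ ω, X ω * Z ω ∂P) * (∫ ω, Y ω * W ω ∂P) +
      (∫ ω, X ω * W ω ∂P) * (∫ ω, Y ω * Z ω ∂P) := by
  have hX : HasGaussianLaw X P := by simpa using hG 1 0 0 0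
  have hY : HasGaussianLaw Y P := by simpa using hG 0 1 0 0
  have hZ : HasGaussianLaw Z P := by simpa using hG 0 0 1 0
  have hW : HasGaussianLaw W P := by simpa using hG 0 0 0 1
  have iX := hX.integrable
  have iY := hY.integrable
  have iZ := hZ.integrable
  have iW := hW.integrable
  have hXY : ∀ b : ℝ, HasGaussianLaw (fun ω => X ω + b * Y ω) P := fun b => by
    simpa using hG 1 b 0 0
  have hZW : ∀ d : ℝ, HasGaussianLaw (fun ω => Z ω + d * W ω) P := fun d => by
    simpa using hG 0 0 1 d
  have q := fun b d => integral_sq_mul_sq_of_gaussian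
    (X := fun ω => X ω + b * Y ω) (Y := fun ω => Z ω + d * W ω) (P := P)
    (fun s t => by
      have := hG s (s * b) t (t * d)
      refine this.congr (.of_forall fun ω => ?_)
      simp only
      ring)
    (by rw [integral_add iX (iY.const_mul _), integral_const_mul, hX0, hY0]; ring)
    (by rw [integral_add iZ (iW.const_mul _), integral_const_mul, hZ0, hW0]; ring)
  have s1 : ∀ b : ℝ, ∫ ω, (X ω + b * Y ω) ^ 2 ∂P =
      (∫ ω, X ω * X ω ∂P) + 2 * b * (∫ ω, X ω * Y ω ∂P) + b ^ 2 * (∫ ω, Y ω * Y ω ∂P) := fun b => by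
    have i1 := integrable_mul_of_gaussian hX hX
    have i2 := integrable_mul_of_gaussian hX hY
    have i3 := integrable_mul_of_gaussian hY hY
    rw [← integral_const_mul, ← integral_const_mul, ← integral_add i1 (i2.const_mul _),
      ← integral_add (i1.fun_add (i2.const_mul _)) (i3.const_mul _)]
    exact integral_congr_ae (.of_forall fun ω => by ring)
  have s2 : ∀ b : ℝ, ∫ ω, (Z ω + b * W ω) ^ 2 ∂P =
      (∫ ω, Z ω * Z ω ∂P) + 2 * b * (∫ ω, Z ω * W ω ∂P) + b ^ 2 * (∫ ω, W ω * W ω ∂P) := fun b => by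
    have i1 := integrable_mul_of_gaussian hZ hZ
    have i2 := integrable_mul_of_gaussian hZ hW
    have i3 := integrable_mul_of_gaussian hW hW
    rw [← integral_const_mul, ← integral_const_mul, ← integral_add i1 (i2.const_mul _),
      ← integral_add (i1.fun_add (i2.const_mul _)) (i3.const_mul _)]
    exact integral_congr_ae (.of_forall fun ω => by ring)
  have s3 : ∀ b d : ℝ, ∫ ω, (X ω + b * Y ω) * (Z ω + d * W ω) ∂P =
      (∫ ω, X ω * Z ω ∂P) + b * (∫ ω, Y ω * Z ω ∂P) + d * (∫ ω, X ω * W ω ∂P) +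
        b * d * (∫ ω, Y ω * W ω ∂P) := fun b d => by
    have i1 := integrable_mul_of_gaussian hX hZ
    have i2 := integrable_mul_of_gaussian hY hZ
    have i3 := integrable_mul_of_gaussian hX hW
    have i4 := integrable_mul_of_gaussian hY hW
    rw [← integral_const_mul, ← integral_const_mul, ← integral_const_mul,
      ← integral_add i1 (i2.const_mul _), ← integral_add (i1.fun_add (i2.const_mul _)) (i3.const_mul _),
      ← integral_add ((i1.fun_add (i2.const_mul _)).fun_add (i3.const_mul _)) (i4.const_mul _)]
    exact integral_congr_ae (.of_forall fun ω => by ring)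
  have iq : ∀ b d : ℝ, Integrable (fun ω => (X ω + b * Y ω) ^ 2 * (Z ω + d * W ω) ^ 2) P :=
    fun b d => (integrable_mul_mul_mul_of_gaussian (hXY b) (hXY b) (hZW d) (hZW d)).congr
      (.of_forall fun ω => by ring)
  -- Polarization in both pairs: the alternating sum of `(X ± Y)² (Z ± W)²` over the four sign
  -- choices is `16 X Y Z W`.
  have key : (∫ ω, (X ω + 1 * Y ω) ^ 2 * (Z ω + 1 * W ω) ^ 2 ∂P) +
      (∫ ω, (X ω + (-1) * Y ω) ^ 2 * (Z ω + (-1) * W ω) ^ 2 ∂P) =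
      (∫ ω, (X ω + 1 * Y ω) ^ 2 * (Z ω + (-1) * W ω) ^ 2 ∂P) +
      (∫ ω, (X ω + (-1) * Y ω) ^ 2 * (Z ω + 1 * W ω) ^ 2 ∂P) +
      16 * ∫ ω, X ω * Y ω * (Z ω * W ω) ∂P := by
    rw [← integral_const_mul, ← integral_add (iq 1 1) (iq (-1) (-1)),
      ← integral_add (iq 1 (-1)) (iq (-1) 1),
      ← integral_add ((iq 1 (-1)).fun_add (iq (-1) 1))
        ((integrable_mul_mul_mul_of_gaussian hX hY hZ hW).const_mul 16)]
    exact integral_congr_ae (.of_forall fun ω => by ring)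
  simp only [q, s1, s2, s3] at key
  linarith

/-- Second moments on the event `X ≥ u`. -/
lemma integral_above_mul_sq_of_gaussian {X Y : Ω → ℝ}
    (hG : HasGaussianLaw (fun ω => (X ω, Y ω)) P)
    (hX0 : ∫ ω, X ω ∂P = 0) (hY0 : ∫ ω, Y ω ∂P = 0) (hX1 : ∫ ω, X ω ^ 2 ∂P = 1) (u : ℝ) :
    ∫ ω, above u (X ω) * Y ω ^ 2 ∂P =
      (∫ ω, Y ω ^ 2 ∂P) * gaussTail u +
        (∫ ω, X ω * Y ω ∂P) ^ 2 * (u * gaussianPDFReal 0 1 u) := by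
  have hX := hG.fst
  have hY := hG.snd
  set r := ∫ ω, X ω * Y ω ∂P with hr
  have hXR : HasGaussianLaw (fun ω => (X ω, Y ω - r * X ω)) P :=
    hG.map ((ContinuousLinearMap.fst ℝ ℝ ℝ).prod
      (ContinuousLinearMap.snd ℝ ℝ ℝ - r • ContinuousLinearMap.fst ℝ ℝ ℝ))
  have hR := hXR.snd
  have iXX := integrable_mul_of_gaussian hX hX
  have iXY := integrable_mul_of_gaussian hX hY
  have iYY := integrable_mul_of_gaussian hY hY
  have hX1' : ∫ ω, X ω * X ω ∂P = 1 := by rw [← hX1]; simp_rw [sq]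
  have hR0 : ∫ ω, (Y ω - r * X ω) ∂P = 0 := by
    rw [integral_sub hY.integrable (hX.integrable.const_mul _), integral_const_mul, hX0, hY0]; simp
  have hXR0 : ∫ ω, X ω * (Y ω - r * X ω) ∂P = 0 := by
    have : ∀ ω, X ω * (Y ω - r * X ω) = X ω * Y ω - r * (X ω * X ω) := fun ω => by ring
    simp_rw [this]
    rw [integral_sub iXY (iXX.const_mul _), integral_const_mul, hX1', ← hr]; ring
  have hR2 : ∫ ω, (Y ω - r * X ω) ^ 2 ∂P = (∫ ω, Y ω ^ 2 ∂P) - r ^ 2 := by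
    have : ∀ ω, (Y ω - r * X ω) ^ 2 = Y ω * Y ω + (-(2 * r)) * (X ω * Y ω) + r ^ 2 * (X ω * X ω) :=
      fun ω => by ring
    simp_rw [this]
    rw [integral_add (iYY.fun_add (iXY.const_mul _)) (iXX.const_mul _),
      integral_add iYY (iXY.const_mul _), integral_const_mul, integral_const_mul, hX1', ← hr]
    simp_rw [sq (Y _)]
    ring
  -- The regression residual `Y - r X` is uncorrelated with `X`, hence independent of it. Writing
  -- `Y` as `r X` plus the residual leaves only one-dimensional truncated moments of `X`.
  have hind : IndepFun X (fun ω => Y ω - r * X ω) P := by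
    refine hXR.indepFun_of_covariance_eq_zero ?_
    rw [covariance_eq_sub hX.memLp_two hR.memLp_two, hX0, zero_mul, sub_zero]
    exact hXR0
  have hlaw : P.map X = gaussianReal 0 1 := by rw [map_eq_of_gaussian hX hX0, hX1]; simp
  have mA := measurable_above u
  have cA : ∀ f : ℝ → ℝ, Measurable f → ∫ ω, above u (X ω) * f (X ω) ∂P =
      ∫ x, above u x * f x ∂(gaussianReal 0 1) := fun f hf => by
    rw [← hlaw, integral_map hX.aemeasurable (f := fun x => above u x * f x) (mA.mul hf).aestronglyMeasurable]
  have c1 := hind.integral_fun_comp_mul_comp hX.aemeasurable hR.aemeasurable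
    (f := fun x => above u x * x) (g := fun y => y) (mA.mul measurable_id).aestronglyMeasurable
    measurable_id.aestronglyMeasurable
  have c2 := hind.integral_fun_comp_mul_comp hX.aemeasurable hR.aemeasurable
    (f := fun x => above u x) (g := fun y => y ^ 2) mA.aestronglyMeasurable
    (measurable_id.pow_const 2).aestronglyMeasurable
  have c0 := cA (fun _ => 1) measurable_const
  simp only [mul_one] at c0
  rw [hR0, mul_zero] at c1
  rw [hR2, c0, integral_above_gaussian] at c2
  have e : ∀ ω, above u (X ω) * Y ω ^ 2 = r ^ 2 * (above u (X ω) * X ω ^ 2) +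
      2 * r * ((above u (X ω) * X ω) * (Y ω - r * X ω)) +
      above u (X ω) * (Y ω - r * X ω) ^ 2 := fun ω => by ring
  have bdd : ∀ f : Ω → ℝ, Integrable f P → Integrable (fun ω => above u (X ω) * f ω) P :=
    fun f hf => hf.bdd_mul (c := 1)
      (mA.comp_aemeasurable hX.aemeasurable).aestronglyMeasurable
      (.of_forall fun ω => abs_above_le_one u _)
  have i1 := bdd _ (iXX.congr (.of_forall fun ω => (sq (X ω)).symm))
  have i2 : Integrable (fun ω => (above u (X ω) * X ω) * (Y ω - r * X ω)) P :=
    (bdd _ (integrable_mul_of_gaussian hX hR)).congr (.of_forall fun ω => by ring)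
  have i3 := bdd _ ((integrable_mul_of_gaussian hR hR).congr
    (.of_forall fun ω => (sq (Y ω - r * X ω)).symm))
  simp_rw [e]
  rw [integral_add ((i1.const_mul _).fun_add (i2.const_mul _)) i3,
    integral_add (i1.const_mul _) (i2.const_mul _), integral_const_mul, integral_const_mul, c1, c2,
    cA (fun x => x ^ 2) (measurable_id.pow_const 2), integral_above_mul_sq_gaussian]
  ring

/-- Mixed second moments on the event `X ≥ u`. -/
lemma integral_above_mul_mul_of_gaussian {X Y W : Ω → ℝ}
    (hG : ∀ a b : ℝ, HasGaussianLaw (fun ω => (X ω, a * Y ω + b * W ω)) P)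
    (hX0 : ∫ ω, X ω ∂P = 0) (hY0 : ∫ ω, Y ω ∂P = 0) (hW0 : ∫ ω, W ω ∂P = 0)
    (hX1 : ∫ ω, X ω ^ 2 ∂P = 1) (u : ℝ) :
    ∫ ω, above u (X ω) * (Y ω * W ω) ∂P =
      (∫ ω, Y ω * W ω ∂P) * gaussTail u +
        (∫ ω, X ω * Y ω ∂P) * (∫ ω, X ω * W ω ∂P) * (u * gaussianPDFReal 0 1 u) := by
  have hX := (hG 1 0).fst
  have hY : HasGaussianLaw Y P := by simpa using (hG 1 0).snd
  have hW : HasGaussianLaw W P := by simpa using (hG 0 1).snd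
  have iXY := integrable_mul_of_gaussian hX hY
  have iXW := integrable_mul_of_gaussian hX hW
  have iYY := integrable_mul_of_gaussian hY hY
  have iYW := integrable_mul_of_gaussian hY hW
  have iWW := integrable_mul_of_gaussian hW hW
  have q := fun b => integral_above_mul_sq_of_gaussian (hG 1 b) hX0
    (by rw [integral_add (hY.integrable.const_mul _) (hW.integrable.const_mul _),
          integral_const_mul, integral_const_mul, hY0, hW0]; ring) hX1 u
  have s1 : ∀ b : ℝ, ∫ ω, (1 * Y ω + b * W ω) ^ 2 ∂P =
      (∫ ω, Y ω * Y ω ∂P) + 2 * b * (∫ ω, Y ω * W ω ∂P) + b ^ 2 * (∫ ω, W ω * W ω ∂P) := fun b => by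
    rw [← integral_const_mul, ← integral_const_mul, ← integral_add iYY (iYW.const_mul _),
      ← integral_add (iYY.fun_add (iYW.const_mul _)) (iWW.const_mul _)]
    exact integral_congr_ae (.of_forall fun ω => by ring)
  have s2 : ∀ b : ℝ, ∫ ω, X ω * (1 * Y ω + b * W ω) ∂P =
      (∫ ω, X ω * Y ω ∂P) + b * (∫ ω, X ω * W ω ∂P) := fun b => by
    rw [← integral_const_mul, ← integral_add iXY (iXW.const_mul _)]
    exact integral_congr_ae (.of_forall fun ω => by ring)
  have iq : ∀ b : ℝ, Integrable (fun ω => above u (X ω) * (1 * Y ω + b * W ω) ^ 2) P := fun b =>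
    ((integrable_mul_of_gaussian (hG 1 b).snd (hG 1 b).snd).congr
      (.of_forall fun ω => (sq (1 * Y ω + b * W ω)).symm)).bdd_mul (c := 1)
      ((measurable_above u).comp_aemeasurable hX.aemeasurable).aestronglyMeasurable
      (.of_forall fun ω => abs_above_le_one u _)
  have key : (∫ ω, above u (X ω) * (1 * Y ω + 1 * W ω) ^ 2 ∂P) -
      (∫ ω, above u (X ω) * (1 * Y ω + (-1) * W ω) ^ 2 ∂P) =
      4 * ∫ ω, above u (X ω) * (Y ω * W ω) ∂P := by
    rw [← integral_sub (iq _) (iq _), ← integral_const_mul]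
    exact integral_congr_ae (.of_forall fun ω => by ring)
  simp only [q, s1, s2] at key
  linarith

end Gaussian

/-! ### The bivariate normal tail -/

lemma continuous_gaussianPDFReal_std : Continuous (gaussianPDFReal 0 1) := by
  rw [funext gaussianPDFReal_std]
  fun_prop

lemma gaussianPDFReal_std_le_one (x : ℝ) : gaussianPDFReal 0 1 x ≤ 1 := by
  rw [gaussianPDFReal_std]
  have h1 : 1 ≤ √(2 * Real.pi) := by
    rw [Real.one_le_sqrt]
    linarith [Real.pi_gt_three]
  have h2 : Real.exp (-(1 / 2) * x ^ 2) ≤ 1 := Real.exp_le_one_iff.2 (by nlinarith [sq_nonneg x])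
  calc _ ≤ (1 : ℝ) * 1 := mul_le_mul (inv_le_one_of_one_le₀ h1) h2 (Real.exp_nonneg _) zero_le_one
    _ = 1 := one_mul 1

lemma gaussTail_nonneg (v : ℝ) : 0 ≤ gaussTail v := measureReal_nonneg

lemma gaussTail_le_one (v : ℝ) : gaussTail v ≤ 1 := measureReal_le_one

lemma hasDerivAt_gaussTail (v : ℝ) : HasDerivAt gaussTail (-gaussianPDFReal 0 1 v) v := by
  have hi := integrable_gaussianPDFReal 0 1
  have h : gaussTail = fun v => gaussTail 0 - ∫ x in (0 : ℝ)..v, gaussianPDFReal 0 1 x := by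
    ext v
    rw [gaussTail_eq_integral, gaussTail_eq_integral,
      ← intervalIntegral.integral_Ioi_sub_Ioi' hi.integrableOn hi.integrableOn]
    ring
  rw [h]
  exact (intervalIntegral.integral_hasDerivAt_right hi.intervalIntegrable
    (stronglyMeasurable_gaussianPDFReal 0 1).stronglyMeasurableAtFilter
    continuous_gaussianPDFReal_std.continuousAt).const_sub _

lemma continuous_gaussTail : Continuous gaussTail :=
  continuous_iff_continuousAt.2 fun v => (hasDerivAt_gaussTail v).continuousAt

/-- The probability that two standard normal variables with correlation `r` both exceed `u`. -/
noncomputable def bivTail (u r : ℝ) : ℝ :=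
  ∫ x in Set.Ioi u, gaussTail ((u - r * x) / √(1 - r ^ 2)) * gaussianPDFReal 0 1 x

/-- The density of the bivariate normal law with correlation `r` at `(u, u)`. -/
noncomputable def bivDensity (u r : ℝ) : ℝ :=
  (2 * Real.pi)⁻¹ * ((√(1 - r ^ 2))⁻¹ * Real.exp (-(u ^ 2 / (1 + r))))

lemma hasDerivAt_bivArg (u x : ℝ) {r : ℝ} (hr : |r| < 1) :
    HasDerivAt (fun r => (u - r * x) / √(1 - r ^ 2))
      ((r * u - x) / ((1 - r ^ 2) * √(1 - r ^ 2))) r := by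
  have h1 : 0 < 1 - r ^ 2 := by
    have := (sq_lt_one_iff_abs_lt_one r).2 hr
    linarith
  have hs : √(1 - r ^ 2) ≠ 0 := (Real.sqrt_pos.2 h1).ne'
  have hs2 : √(1 - r ^ 2) ^ 2 = 1 - r ^ 2 := Real.sq_sqrt h1.le
  have hd : HasDerivAt (fun r : ℝ => 1 - r ^ 2) (-(2 * r)) r := by
    simpa using ((hasDerivAt_id r).pow 2).const_sub 1
  have hn : HasDerivAt (fun r : ℝ => u - r * x) (-x) r := by
    simpa using ((hasDerivAt_id r).mul_const x).const_sub u
  refine (hn.div (hd.sqrt h1.ne') hs).congr_deriv ?_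
  rw [hs2]
  field_simp
  rw [hs2]
  ring

/-- Completing the square in the joint exponent turns the integrand into `(x - r u)` times a
Gaussian centred at `r u`, an exact derivative; the boundary value at `x = u` is the bivariate
density there. -/
lemma integral_bivDensity (u : ℝ) {r : ℝ} (hr : |r| < 1) :
    ∫ x in Set.Ioi u, -gaussianPDFReal 0 1 ((u - r * x) / √(1 - r ^ 2)) *
      ((r * u - x) / ((1 - r ^ 2) * √(1 - r ^ 2))) * gaussianPDFReal 0 1 x = bivDensity u r := by
  have h1 : 0 < 1 - r ^ 2 := by
    have := (sq_lt_one_iff_abs_lt_one r).2 hr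
    linarith
  set s := √(1 - r ^ 2) with hs_def
  have hs : 0 < s := Real.sqrt_pos.2 h1
  have hs2 : s ^ 2 = 1 - r ^ 2 := Real.sq_sqrt h1.le
  have hpi : (√(2 * Real.pi))⁻¹ * (√(2 * Real.pi))⁻¹ = (2 * Real.pi)⁻¹ := by
    rw [← mul_inv, Real.mul_self_sqrt (by positivity)]
  set c : ℝ := (2 * Real.pi)⁻¹ * Real.exp (-(u ^ 2 / 2)) with hc
  have hint : ∀ x, -gaussianPDFReal 0 1 ((u - r * x) / s) *
      ((r * u - x) / ((1 - r ^ 2) * s)) * gaussianPDFReal 0 1 x =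
      c * ((x - r * u) / s ^ 3 * Real.exp (-((x - r * u) ^ 2 / (2 * s ^ 2)))) := by
    intro x
    have e : Real.exp (-(1 / 2) * ((u - r * x) / s) ^ 2) * Real.exp (-(1 / 2) * x ^ 2) =
        Real.exp (-(u ^ 2 / 2)) * Real.exp (-((x - r * u) ^ 2 / (2 * s ^ 2))) := by
      rw [← Real.exp_add, ← Real.exp_add]
      congr 1
      field_simp
      rw [hs2]
      ring
    rw [gaussianPDFReal_std, gaussianPDFReal_std, hc, ← hpi, ← hs2]
    have : -((√(2 * Real.pi))⁻¹ * Real.exp (-(1 / 2) * ((u - r * x) / s) ^ 2)) *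
        ((r * u - x) / (s ^ 2 * s)) * ((√(2 * Real.pi))⁻¹ * Real.exp (-(1 / 2) * x ^ 2)) =
        (√(2 * Real.pi))⁻¹ * (√(2 * Real.pi))⁻¹ * ((x - r * u) / s ^ 3) *
        (Real.exp (-(1 / 2) * ((u - r * x) / s) ^ 2) * Real.exp (-(1 / 2) * x ^ 2)) := by
      ring
    rw [this, e]
    ring
  simp_rw [hint]
  rw [integral_const_mul]
  have hd : ∀ x, HasDerivAt (fun x => -(s⁻¹ * Real.exp (-((x - r * u) ^ 2 / (2 * s ^ 2)))))
      ((x - r * u) / s ^ 3 * Real.exp (-((x - r * u) ^ 2 / (2 * s ^ 2)))) x := by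
    intro x
    have h := ((((((hasDerivAt_id x).sub_const (r * u)).pow 2).div_const
      (2 * s ^ 2)).neg).exp.const_mul s⁻¹).neg
    refine h.congr_deriv ?_
    simp
    field_simp
  have hpos : ∀ᶠ x in atTop, 0 ≤ x - r * u := by
    filter_upwards [eventually_ge_atTop (r * u)] with x hx
    linarith
  have hlim : Tendsto (fun x => -(s⁻¹ * Real.exp (-((x - r * u) ^ 2 / (2 * s ^ 2))))) atTop (𝓝 0) := by
    have h1 : Tendsto (fun x : ℝ => (x - r * u) ^ 2 / (2 * s ^ 2)) atTop atTop :=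
      ((tendsto_pow_atTop two_ne_zero).comp
        (tendsto_atTop_add_const_right _ (-(r * u)) tendsto_id)).atTop_div_const (by positivity)
    have h2 := ((Real.tendsto_exp_neg_atTop_nhds_zero.comp h1).const_mul s⁻¹).neg
    simpa using h2
  have hge : ∀ x ∈ Set.Ioi u, 0 ≤ c := fun _ _ => by positivity
  have hi : Integrable fun x : ℝ => (x - r * u) / s ^ 3 *
      Real.exp (-((x - r * u) ^ 2 / (2 * s ^ 2))) := by
    have h := ((integrable_mul_exp_neg_mul_sq (b := 1 / (2 * s ^ 2)) (by positivity)).comp_sub_right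
      (r * u)).const_mul (1 / s ^ 3)
    refine h.congr (.of_forall fun x => ?_)
    simp only
    rw [show -(1 / (2 * s ^ 2)) * (x - r * u) ^ 2 = -((x - r * u) ^ 2 / (2 * s ^ 2)) by ring]
    ring
  rw [integral_Ioi_of_hasDerivAt_of_tendsto' (fun x _ => hd x) hi.integrableOn hlim, bivDensity, hc,
    ← hs_def]
  have hr1 : 0 < 1 + r := by
    have := (abs_lt.1 hr).1
    linarith
  have e : Real.exp (-(u ^ 2 / (1 + r))) =
      Real.exp (-(u ^ 2 / 2)) * Real.exp (-((u - r * u) ^ 2 / (2 * s ^ 2))) := by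
    rw [← Real.exp_add, hs2]
    congr 1
    have : 1 - r ≠ 0 := by
      have := (abs_lt.1 hr).2
      linarith
    rw [show 1 - r ^ 2 = (1 - r) * (1 + r) by ring, show u - r * u = u * (1 - r) by ring]
    field_simp
    ring
  rw [e]
  ring

/-- Differentiation under the integral sign. The restriction to `|r| < 1/2` keeps `1 - r²` away from
`0`, and the expansion at `0` requires no more. -/
lemma hasDerivAt_bivTail (u : ℝ) {r : ℝ} (hr : |r| < 1 / 2) :
    HasDerivAt (bivTail u) (bivDensity u r) r := by
  rw [← integral_bivDensity u (by linarith)]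
  have hmem : {r : ℝ | |r| < 1 / 2} ∈ 𝓝 r :=
    (isOpen_lt continuous_abs continuous_const).mem_nhds hr
  have hφ := continuous_gaussianPDFReal_std
  have hψ := continuous_gaussTail
  have hφi := integrable_gaussianPDFReal 0 1
  have i1 := integrable_pow_mul_gaussianPDFReal_std 1
  have hcont : ∀ r : ℝ, Continuous fun x : ℝ =>
      gaussTail ((u - r * x) / √(1 - r ^ 2)) * gaussianPDFReal 0 1 x := fun r => by fun_prop
  refine (hasDerivAt_integral_of_dominated_loc_of_deriv_le
    -- The factor `3` bounds the inverse of `(1 - r²) √(1 - r²)`, which is at least `3/4 · 1/2`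
    -- here.
    (bound := fun x => 3 * (|x ^ 1 * gaussianPDFReal 0 1 x| + |u| * gaussianPDFReal 0 1 x))
    (F' := fun r x => -gaussianPDFReal 0 1 ((u - r * x) / √(1 - r ^ 2)) *
      ((r * u - x) / ((1 - r ^ 2) * √(1 - r ^ 2))) * gaussianPDFReal 0 1 x)
    hmem (.of_forall fun r => (hcont r).aestronglyMeasurable) ?_ ?_ ?_ ?_ ?_).2
  · refine hφi.integrableOn.bdd_mul (c := 1) ?_ (.of_forall fun x => ?_)
    · exact Continuous.aestronglyMeasurable (by fun_prop)
    · rw [Real.norm_of_nonneg (gaussTail_nonneg _)]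
      exact gaussTail_le_one _
  · exact Continuous.aestronglyMeasurable (by fun_prop)
  · refine .of_forall fun x r hr => ?_
    have hr' : |r| < 1 / 2 := hr
    have hr2 : r ^ 2 ≤ 1 / 4 := by
      rw [← sq_abs]
      nlinarith [abs_nonneg r]
    have hs : 1 / 2 ≤ √(1 - r ^ 2) := Real.le_sqrt_of_sq_le (by linarith)
    have hden : 1 / 3 ≤ (1 - r ^ 2) * √(1 - r ^ 2) := by nlinarith
    have hφ0 := gaussianPDFReal_nonneg 0 1 x
    rw [norm_mul, norm_mul, norm_neg, norm_div, Real.norm_of_nonneg (gaussianPDFReal_nonneg _ _ _),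
      Real.norm_of_nonneg hφ0, Real.norm_of_nonneg (show 0 ≤ (1 - r ^ 2) * √(1 - r ^ 2) by linarith),
      Real.norm_eq_abs]
    have h1 : |r * u - x| ≤ |x| + |u| := by
      calc |r * u - x| ≤ |r * u| + |x| := abs_sub _ _
        _ ≤ |x| + |u| := by
          rw [abs_mul]
          nlinarith [abs_nonneg u, abs_nonneg r]
    have h2 : |r * u - x| / ((1 - r ^ 2) * √(1 - r ^ 2)) ≤ 3 * (|x| + |u|) := by
      rw [div_le_iff₀ (by linarith)]
      nlinarith [abs_nonneg x, abs_nonneg u]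
    have h3 : gaussianPDFReal 0 1 ((u - r * x) / √(1 - r ^ 2)) *
        (|r * u - x| / ((1 - r ^ 2) * √(1 - r ^ 2))) ≤ 1 * (3 * (|x| + |u|)) :=
      mul_le_mul (gaussianPDFReal_std_le_one _) h2 (div_nonneg (abs_nonneg _) (by linarith))
        zero_le_one
    calc _ ≤ 1 * (3 * (|x| + |u|)) * gaussianPDFReal 0 1 x := mul_le_mul_of_nonneg_right h3 hφ0
      _ = _ := by rw [pow_one, abs_mul, abs_of_nonneg hφ0]; ring
  · exact ((i1.abs.add (hφi.const_mul _)).const_mul _).integrableOn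
  · refine .of_forall fun x r hr => ?_
    have hr' : |r| < 1 / 2 := hr
    exact ((hasDerivAt_gaussTail _).comp r (hasDerivAt_bivArg u x (by linarith))).mul_const _

lemma bivTail_zero (u : ℝ) : bivTail u 0 = gaussTail u ^ 2 := by
  simp only [bivTail, zero_mul, sub_zero, ne_eq, OfNat.ofNat_ne_zero, not_false_eq_true, zero_pow,
    Real.sqrt_one, div_one]
  rw [integral_const_mul, ← gaussTail_eq_integral]
  ring

lemma bivDensity_zero (u : ℝ) : bivDensity u 0 = gaussianPDFReal 0 1 u ^ 2 := by
  rw [gaussianPDFReal_std, mul_pow, inv_pow, Real.sq_sqrt (by positivity), ← Real.exp_nat_mul,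
    bivDensity]
  simp

lemma hasDerivAt_bivDensity_zero (u : ℝ) :
    HasDerivAt (bivDensity u) (u ^ 2 * gaussianPDFReal 0 1 u ^ 2) 0 := by
  have hd : HasDerivAt (fun r : ℝ => 1 - r ^ 2) 0 0 := by
    simpa using ((hasDerivAt_id (0 : ℝ)).pow 2).const_sub 1
  have h1 : HasDerivAt (fun r : ℝ => (√(1 - r ^ 2))⁻¹) 0 0 := by
    exact ((hd.sqrt (by norm_num)).inv (by norm_num)).congr_deriv (by simp)
  have h2 : HasDerivAt (fun r : ℝ => Real.exp (-(u ^ 2 / (1 + r)))) (Real.exp (-u ^ 2) * u ^ 2) 0 := by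
    have h := ((((hasDerivAt_id (0 : ℝ)).const_add 1).inv (by norm_num)).const_mul (u ^ 2)).neg.exp
    refine (h.congr_deriv ?_)
    simp
  refine ((h1.mul h2).const_mul (2 * Real.pi)⁻¹).congr_deriv ?_
  rw [← bivDensity_zero, bivDensity]
  simp
  ring

/-- Second order expansion of the bivariate tail in the correlation. -/
lemma exists_bivTail_expansion (u : ℝ) {ε : ℝ} (hε : 0 < ε) : ∃ δ > 0, δ < 1 ∧ ∀ r, |r| < δ →
    |bivTail u r - gaussTail u ^ 2 - gaussianPDFReal 0 1 u ^ 2 * r -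
      u ^ 2 * gaussianPDFReal 0 1 u ^ 2 / 2 * r ^ 2| ≤ ε * r ^ 2 := by
  have h := (hasDerivAt_bivDensity_zero u).isLittleO
  have h2 := (Asymptotics.isLittleO_iff.1 h) hε
  obtain ⟨δ, hδ, hball⟩ := Metric.eventually_nhds_iff.1 h2
  refine ⟨min δ (1 / 2), by positivity, (min_le_right _ _).trans_lt (by norm_num), fun r hr => ?_⟩
  set K := u ^ 2 * gaussianPDFReal 0 1 u ^ 2 with hK
  -- The derivative of the error is the first-order Taylor error of the density, at most `ε |r|` on
  -- the ball of radius `|r|`; the mean value inequality supplies the second factor `|r|`.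
  have hd : ∀ x ∈ Metric.closedBall (0 : ℝ) |r|, HasDerivWithinAt
      (fun r => bivTail u r - gaussTail u ^ 2 - gaussianPDFReal 0 1 u ^ 2 * r - K / 2 * r ^ 2)
      (bivDensity u x - bivDensity u 0 - x * K) (Metric.closedBall (0 : ℝ) |r|) x := by
    intro x hx
    have hx' : |x| ≤ |r| := by simpa using hx
    have h1 := hasDerivAt_bivTail u
      (hx'.trans_lt (hr.trans_le (min_le_right _ _)))
    refine HasDerivAt.hasDerivWithinAt (((((h1.sub_const (gaussTail u ^ 2)).sub
      ((hasDerivAt_id x).const_mul (gaussianPDFReal 0 1 u ^ 2)))).sub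
      (((hasDerivAt_id x).pow 2).const_mul (K / 2))).congr_deriv ?_)
    rw [bivDensity_zero]
    simp
    ring
  have hb : ∀ x ∈ Metric.closedBall (0 : ℝ) |r|,
      ‖bivDensity u x - bivDensity u 0 - x * K‖ ≤ ε * |r| := by
    intro x hx
    have hx' : |x| ≤ |r| := by simpa using hx
    have h3 := hball (y := x) (by
      rw [Real.dist_eq, sub_zero]
      exact hx'.trans_lt (hr.trans_le (min_le_left _ _)))
    simp only [sub_zero, smul_eq_mul] at h3
    exact h3.trans (mul_le_mul_of_nonneg_left hx' hε.le)
  have := (convex_closedBall (0 : ℝ) |r|).norm_image_sub_le_of_norm_hasDerivWithin_le hd hb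
    (x := 0) (y := r) (by simp) (by simp)
  simp only [bivTail_zero, sub_zero, mul_zero, sub_self, ne_eq, OfNat.ofNat_ne_zero,
    not_false_eq_true, zero_pow, Real.norm_eq_abs] at this
  rw [mul_assoc, ← sq, sq_abs] at this
  exact this

section Gaussian

variable {Ω : Type*} [MeasurableSpace Ω] {P : Measure Ω} [IsProbabilityMeasure P]

/-- Write `Y = r X + √(1 - r²) N` with `N` standard normal and independent of `X`, and integrate out
`N` first. -/
lemma integral_above_mul_above_of_gaussian {X Y : Ω → ℝ}
    (hG : HasGaussianLaw (fun ω => (X ω, Y ω)) P)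
    (hX0 : ∫ ω, X ω ∂P = 0) (hY0 : ∫ ω, Y ω ∂P = 0) (hX1 : ∫ ω, X ω ^ 2 ∂P = 1)
    (hY1 : ∫ ω, Y ω ^ 2 ∂P = 1) {r : ℝ} (hr : ∫ ω, X ω * Y ω ∂P = r) (hr1 : |r| < 1) (u : ℝ) :
    ∫ ω, above u (X ω) * above u (Y ω) ∂P = bivTail u r := by
  have h1 : 0 < 1 - r ^ 2 := by
    have := (sq_lt_one_iff_abs_lt_one r).2 hr1
    linarith
  set s := √(1 - r ^ 2) with hs_def
  have hs : 0 < s := Real.sqrt_pos.2 h1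
  have hs2 : s ^ 2 = 1 - r ^ 2 := Real.sq_sqrt h1.le
  have hX := hG.fst
  have hY := hG.snd
  have iXX := integrable_mul_of_gaussian hX hX
  have iXY := integrable_mul_of_gaussian hX hY
  have iYY := integrable_mul_of_gaussian hY hY
  have hX1' : ∫ ω, X ω * X ω ∂P = 1 := by rw [← hX1]; simp_rw [sq]
  have hY1' : ∫ ω, Y ω * Y ω ∂P = 1 := by rw [← hY1]; simp_rw [sq]
  have hXN : HasGaussianLaw (fun ω => (X ω, s⁻¹ * (Y ω - r * X ω))) P :=
    hG.map ((ContinuousLinearMap.fst ℝ ℝ ℝ).prod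
      (s⁻¹ • (ContinuousLinearMap.snd ℝ ℝ ℝ - r • ContinuousLinearMap.fst ℝ ℝ ℝ)))
  have hN := hXN.snd
  have hN0 : ∫ ω, s⁻¹ * (Y ω - r * X ω) ∂P = 0 := by
    rw [integral_const_mul, integral_sub hY.integrable (hX.integrable.const_mul _),
      integral_const_mul, hX0, hY0]
    simp
  have hXN0 : ∫ ω, X ω * (s⁻¹ * (Y ω - r * X ω)) ∂P = 0 := by
    have : ∀ ω, X ω * (s⁻¹ * (Y ω - r * X ω)) = s⁻¹ * (X ω * Y ω - r * (X ω * X ω)) :=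
      fun ω => by ring
    simp_rw [this]
    rw [integral_const_mul, integral_sub iXY (iXX.const_mul _), integral_const_mul, hX1', hr]
    ring
  have hN2 : ∫ ω, (s⁻¹ * (Y ω - r * X ω)) ^ 2 ∂P = 1 := by
    have : ∀ ω, (s⁻¹ * (Y ω - r * X ω)) ^ 2 =
      (s ^ 2)⁻¹ * (Y ω * Y ω + (-(2 * r)) * (X ω * Y ω) + r ^ 2 * (X ω * X ω)) := fun ω => by
      rw [mul_pow, inv_pow]; ring
    simp_rw [this]
    rw [integral_const_mul, integral_add (iYY.fun_add (iXY.const_mul _)) (iXX.const_mul _),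
      integral_add iYY (iXY.const_mul _), integral_const_mul, integral_const_mul, hX1', hY1', hr, hs2]
    field_simp
    ring
  have hind : IndepFun X (fun ω => s⁻¹ * (Y ω - r * X ω)) P := by
    refine hXN.indepFun_of_covariance_eq_zero ?_
    rw [covariance_eq_sub hX.memLp_two hN.memLp_two, hX0, zero_mul, sub_zero]
    exact hXN0
  have hlX : P.map X = gaussianReal 0 1 := by rw [map_eq_of_gaussian hX hX0, hX1]; simp
  have hlN : P.map (fun ω => s⁻¹ * (Y ω - r * X ω)) = gaussianReal 0 1 := by
    rw [map_eq_of_gaussian hN hN0, hN2]; simp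
  have hprod := (indepFun_iff_map_prod_eq_prod_map_map hX.aemeasurable hN.aemeasurable).1 hind
  rw [hlX, hlN] at hprod
  have mA := measurable_above u
  have mf : Measurable fun p : ℝ × ℝ => above u p.1 * above u (r * p.1 + s * p.2) :=
    (mA.comp measurable_fst).mul (mA.comp (by fun_prop))
  have e : ∀ ω, above u (X ω) * above u (Y ω) =
      (fun p : ℝ × ℝ => above u p.1 * above u (r * p.1 + s * p.2))
        (X ω, s⁻¹ * (Y ω - r * X ω)) := by
    intro ω
    simp only
    rw [← mul_assoc, mul_inv_cancel₀ hs.ne', one_mul, add_sub_cancel]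
  simp_rw [e]
  rw [← integral_map (φ := fun ω => (X ω, s⁻¹ * (Y ω - r * X ω))) hXN.aemeasurable
    mf.aestronglyMeasurable, hprod, integral_prod]
  · simp only
    simp_rw [integral_const_mul]
    have : ∀ x, ∫ y, above u (r * x + s * y) ∂(gaussianReal 0 1) = gaussTail ((u - r * x) / s) := by
      intro x
      rw [← integral_above_gaussian]
      refine integral_congr_ae (.of_forall fun y => ?_)
      simp only [above]
      congr 1
      rw [div_le_iff₀ hs, eq_iff_iff]
      constructor <;> intro h <;> linarith
    simp_rw [this]
    rw [integral_above_mul_gaussian u (fun x => gaussTail ((u - r * x) / s)), bivTail]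
  · refine Integrable.of_bound mf.aestronglyMeasurable 1 (.of_forall fun p => ?_)
    rw [norm_mul]
    exact mul_le_one₀ (abs_above_le_one _ _) (norm_nonneg _) (abs_above_le_one _ _)

end Gaussian

/-- Second order expansion of the covariance of two Gaussian excursion indicators. -/
lemma exists_above_mul_above_expansion (u : ℝ) {ε : ℝ} (hε : 0 < ε) : ∃ C : ℝ, 0 ≤ C ∧
    ∀ {Ω : Type*} [MeasurableSpace Ω] {P : Measure Ω} [IsProbabilityMeasure P] {X Y : Ω → ℝ}
      (_ : HasGaussianLaw (fun ω => (X ω, Y ω)) P)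
      (_ : ∫ ω, X ω ∂P = 0) (_ : ∫ ω, Y ω ∂P = 0) (_ : ∫ ω, X ω ^ 2 ∂P = 1)
      (_ : ∫ ω, Y ω ^ 2 ∂P = 1) {r : ℝ} (_ : ∫ ω, X ω * Y ω ∂P = r) (_ : |r| ≤ 1),
      |∫ ω, above u (X ω) * above u (Y ω) ∂P - gaussTail u ^ 2 - gaussianPDFReal 0 1 u ^ 2 * r -
        u ^ 2 * gaussianPDFReal 0 1 u ^ 2 / 2 * r ^ 2| ≤ ε * r ^ 2 + C * |r| ^ 3 := by
  obtain ⟨δ, hδ, hδ1, hexp⟩ := exists_bivTail_expansion u hε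
  set a := gaussianPDFReal 0 1 u ^ 2 with ha
  have ha0 : 0 ≤ a := sq_nonneg _
  set b := u ^ 2 * a / 2 with hb
  have hb0 : 0 ≤ b := by positivity
  -- For `|r| ≥ δ` the trivial bound `2 + a + b` is absorbed by the cubic term. This removes any
  -- need for uniformity as `|r|` approaches `1`, and the constant depends neither on the
  -- probability space nor on the variables.
  refine ⟨(2 + a + b) / δ ^ 3, by positivity, fun {Ω _ P _ X Y} hG hX0 hY0 hX1 hY1 {r} hr hr1 => ?_⟩
  rcases lt_or_ge |r| δ with h | h
  · rw [integral_above_mul_above_of_gaussian hG hX0 hY0 hX1 hY1 hr (h.trans hδ1)]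
    refine (hexp r h).trans (le_add_of_nonneg_right (by positivity))
  · have hE0 : 0 ≤ ∫ ω, above u (X ω) * above u (Y ω) ∂P :=
      integral_nonneg fun ω => mul_nonneg (above_nonneg _ _) (above_nonneg _ _)
    have hE1 : ∫ ω, above u (X ω) * above u (Y ω) ∂P ≤ 1 := by
      have h := integral_mono_of_nonneg (μ := P) (f := fun ω => above u (X ω) * above u (Y ω))
        (g := fun _ => (1 : ℝ))
        (.of_forall fun ω => mul_nonneg (above_nonneg _ _) (above_nonneg _ _))
        (integrable_const 1)
        (.of_forall fun ω => mul_le_one₀ (above_le_one _ _) (above_nonneg _ _) (above_le_one _ _))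
      simpa using h
    have hp0 := gaussTail_nonneg u
    have hp1 := gaussTail_le_one u
    have hp2 : gaussTail u ^ 2 ≤ 1 := pow_le_one₀ hp0 hp1
    have hr2 : r ^ 2 ≤ 1 := by rw [← sq_abs]; exact pow_le_one₀ (abs_nonneg _) hr1
    have h1 : |∫ ω, above u (X ω) * above u (Y ω) ∂P - gaussTail u ^ 2 - a * r - b * r ^ 2| ≤
        2 + a + b := by
      have hr1' := abs_le.1 hr1
      rw [abs_le]
      constructor <;> nlinarith [sq_nonneg r, sq_nonneg (gaussTail u)]
    have h2 : 2 + a + b ≤ (2 + a + b) / δ ^ 3 * |r| ^ 3 := by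
      rw [div_mul_eq_mul_div, le_div_iff₀ (by positivity)]
      exact mul_le_mul_of_nonneg_left (pow_le_pow_left₀ hδ.le h 3) (by positivity)
    have h3 : 0 ≤ ε * r ^ 2 := by positivity
    linarith

/-! ### Fubini for processes with uniformly bounded second moments -/

section SecondOrder

variable {Ω A B : Type*} [MeasurableSpace Ω] [MeasurableSpace A] [MeasurableSpace B]
  {P : Measure Ω} [IsFiniteMeasure P] {μ : Measure A} {ν : Measure B}
  [IsFiniteMeasure μ] [IsFiniteMeasure ν] {X : A → Ω → ℝ} {W : B → Ω → ℝ}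

/-- A jointly measurable process with uniformly bounded second moments. -/
structure IsL2Bounded (P : Measure Ω) (X : A → Ω → ℝ) : Prop where
  measurable : Measurable fun p : Ω × A => X p.2 p.1
  memLp : ∀ a, MemLp (X a) 2 P
  bounded : ∃ K, ∀ a, ∫ ω, X a ω ^ 2 ∂P ≤ K

namespace IsL2Bounded

lemma integrable_sq (hX : IsL2Bounded P X) (a : A) : Integrable (fun ω => X a ω ^ 2) P :=
  (hX.memLp a).integrable_sq

lemma integrable_mul (hX : IsL2Bounded P X) (hW : IsL2Bounded P W) (a : A) (b : B) :
    Integrable (fun ω => X a ω * W b ω) P :=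
  (hX.memLp a).integrable_mul (hW.memLp b)

lemma exists_integral_abs_mul_le (hX : IsL2Bounded P X) (hW : IsL2Bounded P W) :
    ∃ K, ∀ a b, ∫ ω, |X a ω * W b ω| ∂P ≤ K := by
  obtain ⟨K, hK⟩ := hX.bounded
  obtain ⟨L, hL⟩ := hW.bounded
  refine ⟨K + L, fun a b => ?_⟩
  calc ∫ ω, |X a ω * W b ω| ∂P ≤ ∫ ω, (X a ω ^ 2 + W b ω ^ 2) ∂P := by
        refine integral_mono (hX.integrable_mul hW a b).abs
          ((hX.integrable_sq a).fun_add (hW.integrable_sq b)) fun ω => ?_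
        rw [abs_mul]
        nlinarith [sq_nonneg (|X a ω| - |W b ω|), sq_abs (X a ω), sq_abs (W b ω)]
    _ = ∫ ω, X a ω ^ 2 ∂P + ∫ ω, W b ω ^ 2 ∂P :=
        integral_add (hX.integrable_sq a) (hW.integrable_sq b)
    _ ≤ K + L := add_le_add (hK a) (hL b)

lemma measurable_mul (hX : IsL2Bounded P X) (hW : IsL2Bounded P W) :
    Measurable fun p : Ω × (A × B) => X p.2.1 p.1 * W p.2.2 p.1 :=
  (hX.measurable.comp (measurable_fst.prodMk measurable_snd.fst)).mul
    (hW.measurable.comp (measurable_fst.prodMk measurable_snd.snd))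

lemma integrable_prod_mul (hX : IsL2Bounded P X) (hW : IsL2Bounded P W) :
    Integrable (fun p : Ω × (A × B) => X p.2.1 p.1 * W p.2.2 p.1) (P.prod (μ.prod ν)) := by
  have hm := hX.measurable_mul hW
  rw [integrable_prod_iff' hm.aestronglyMeasurable]
  refine ⟨.of_forall fun p => hX.integrable_mul hW p.1 p.2, ?_⟩
  obtain ⟨K, hK⟩ := hX.exists_integral_abs_mul_le hW
  refine Integrable.of_bound hm.norm.stronglyMeasurable.integral_prod_left'.aestronglyMeasurable K
    (.of_forall fun p => ?_)
  rw [Real.norm_of_nonneg (integral_nonneg fun _ => norm_nonneg _)]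
  exact hK p.1 p.2

/-- Fubini. Every covariance of integrated functionals below is reduced by this to pointwise second
moments. -/
lemma integral_mul_integral (hX : IsL2Bounded P X) (hW : IsL2Bounded P W) :
    ∫ ω, (∫ a, X a ω ∂μ) * (∫ b, W b ω ∂ν) ∂P =
      ∫ p, (∫ ω, X p.1 ω * W p.2 ω ∂P) ∂(μ.prod ν) := by
  rw [← integral_integral_swap (f := fun ω (p : A × B) => X p.1 ω * W p.2 ω)
    (hX.integrable_prod_mul hW)]
  exact integral_congr_ae (.of_forall fun ω =>
    (integral_prod_mul (fun a => X a ω) (fun b => W b ω)).symm)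

lemma integrable_integral_mul (hX : IsL2Bounded P X) (hW : IsL2Bounded P W) :
    Integrable (fun p : A × B => ∫ ω, X p.1 ω * W p.2 ω ∂P) (μ.prod ν) :=
  (hX.integrable_prod_mul hW).integral_prod_right

lemma const (f : B → ℝ) (hf : Measurable f) (hb : ∃ K, ∀ b, |f b| ≤ K) :
    IsL2Bounded P (fun b (_ : Ω) => f b) where
  measurable := hf.comp measurable_snd
  memLp b := memLp_const _
  bounded := by
    obtain ⟨K, hK⟩ := hb
    refine ⟨P.real Set.univ * K ^ 2, fun b => ?_⟩
    rw [integral_const, smul_eq_mul]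
    exact mul_le_mul_of_nonneg_left (sq_le_sq.2 ((hK b).trans (le_abs_self K))) measureReal_nonneg

lemma integrable_prod (hX : IsL2Bounded P X) :
    Integrable (fun p : Ω × A => X p.2 p.1) (P.prod μ) := by
  have h1 : IsL2Bounded P (fun (_ : A) (_ : Ω) => (1 : ℝ)) :=
    const (fun _ => 1) measurable_const ⟨1, fun _ => by simp⟩
  rw [integrable_prod_iff' hX.measurable.aestronglyMeasurable]
  refine ⟨.of_forall fun a => (hX.memLp a).integrable (by norm_num), ?_⟩
  obtain ⟨K, hK⟩ := hX.exists_integral_abs_mul_le h1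
  refine Integrable.of_bound
    hX.measurable.norm.stronglyMeasurable.integral_prod_left'.aestronglyMeasurable K
    (.of_forall fun a => ?_)
  rw [Real.norm_of_nonneg (integral_nonneg fun _ => norm_nonneg _)]
  simpa using hK a a

lemma integral_integral (hX : IsL2Bounded P X) :
    ∫ ω, (∫ a, X a ω ∂μ) ∂P = ∫ a, (∫ ω, X a ω ∂P) ∂μ :=
  integral_integral_swap (f := fun ω a => X a ω) hX.integrable_prod

lemma stronglyMeasurable_integral (hX : IsL2Bounded P X) :
    StronglyMeasurable fun ω => ∫ a, X a ω ∂μ :=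
  hX.measurable.stronglyMeasurable.integral_prod_right'

lemma memLp_integral (hX : IsL2Bounded P X) : MemLp (fun ω => ∫ a, X a ω ∂μ) 2 P := by
  rw [memLp_two_iff_integrable_sq hX.stronglyMeasurable_integral.aestronglyMeasurable]
  refine (hX.integrable_prod_mul hX (μ := μ) (ν := μ)).integral_prod_left.congr
    (.of_forall fun ω => ?_)
  simp only [sq]
  exact integral_prod_mul (fun a => X a ω) (fun b => X b ω)

/-- Integrating out some of the parameters stays within the class, so that integration over the
sphere can be followed by integration over time. -/
lemma integral {X : A × B → Ω → ℝ} (hX : IsL2Bounded P X) :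
    IsL2Bounded P (fun b ω => ∫ a, X (a, b) ω ∂μ) := by
  have hb : ∀ b, IsL2Bounded P (fun a => X (a, b)) := fun b =>
    ⟨hX.measurable.comp (measurable_fst.prodMk (measurable_snd.prodMk measurable_const)),
      fun a => hX.memLp _, hX.bounded.imp fun K hK a => hK _⟩
  refine ⟨?_, fun b => (hb b).memLp_integral, ?_⟩
  · have : Measurable fun p : (Ω × B) × A => X (p.2, p.1.2) p.1.1 :=
      hX.measurable.comp (measurable_fst.fst.prodMk (measurable_snd.prodMk measurable_fst.snd))
    exact this.stronglyMeasurable.integral_prod_right'.measurable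
  · obtain ⟨K, hK⟩ := hX.exists_integral_abs_mul_le hX
    refine ⟨K * (μ.prod μ).real Set.univ, fun b => ?_⟩
    simp_rw [sq]
    rw [(hb b).integral_mul_integral (hb b)]
    refine (le_abs_self _).trans ?_
    rw [← Real.norm_eq_abs]
    refine norm_integral_le_of_norm_le_const (.of_forall fun p => ?_)
    exact (norm_integral_le_integral_norm _).trans (hK _ _)

lemma add {W : A → Ω → ℝ} (hX : IsL2Bounded P X) (hW : IsL2Bounded P W) :
    IsL2Bounded P (fun a ω => X a ω + W a ω) where
  measurable := hX.measurable.add hW.measurable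
  memLp a := (hX.memLp a).add (hW.memLp a)
  bounded := by
    obtain ⟨K, hK⟩ := hX.bounded
    obtain ⟨L, hL⟩ := hW.bounded
    refine ⟨2 * K + 2 * L, fun a => ?_⟩
    calc ∫ ω, (X a ω + W a ω) ^ 2 ∂P ≤ ∫ ω, (2 * X a ω ^ 2 + 2 * W a ω ^ 2) ∂P := by
          refine integral_mono ((hX.memLp a).add (hW.memLp a)).integrable_sq
            (((hX.integrable_sq a).const_mul 2).fun_add ((hW.integrable_sq a).const_mul 2))
            fun ω => ?_
          nlinarith [sq_nonneg (X a ω - W a ω)]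
      _ = 2 * ∫ ω, X a ω ^ 2 ∂P + 2 * ∫ ω, W a ω ^ 2 ∂P := by
          rw [integral_add ((hX.integrable_sq a).const_mul 2) ((hW.integrable_sq a).const_mul 2),
            integral_const_mul, integral_const_mul]
      _ ≤ 2 * K + 2 * L := by linarith [hK a, hL a]

lemma sum {ι : Type*} (s : Finset ι) {X : ι → A → Ω → ℝ} (hX : ∀ i ∈ s, IsL2Bounded P (X i)) :
    IsL2Bounded P (fun a ω => ∑ i ∈ s, X i a ω) := by
  classical
  induction s using Finset.induction_on with
  | empty => simpa using const (fun _ => 0) measurable_const ⟨0, fun _ => by simp⟩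
  | insert i s hi ih =>
    simp_rw [Finset.sum_insert hi]
    exact (hX i (by simp)).add (ih fun j hj => hX j (by simp [hj]))

/-- A bounded measurable multiple. -/
lemma const_mul (hX : IsL2Bounded P X) {f : A → ℝ} (hf : Measurable f) (hb : ∃ K, ∀ a, |f a| ≤ K) :
    IsL2Bounded P (fun a ω => f a * X a ω) where
  measurable := (hf.comp measurable_snd).mul hX.measurable
  memLp a := (hX.memLp a).const_mul _
  bounded := by
    obtain ⟨K, hK⟩ := hX.bounded
    obtain ⟨L, hL⟩ := hb
    refine ⟨L ^ 2 * K, fun a => ?_⟩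
    simp_rw [mul_pow]
    rw [integral_const_mul]
    exact mul_le_mul (sq_le_sq.2 ((hL a).trans (le_abs_self L))) (hK a)
      (integral_nonneg fun _ => sq_nonneg _) (sq_nonneg _)

lemma comp {f : B → A} (hX : IsL2Bounded P X) (hf : Measurable f) :
    IsL2Bounded P (fun b => X (f b)) :=
  ⟨hX.measurable.comp (measurable_fst.prodMk (hf.comp measurable_snd)), fun _ => hX.memLp _,
    hX.bounded.imp fun _ hK _ => hK _⟩

end IsL2Bounded

end SecondOrder

/-! ### Gaussian laws of linear combinations of field values -/

section FiniteDimensional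

variable {Ω T : Type*} [MeasurableSpace Ω] {P : Measure Ω} {X : T → Ω → ℝ}

lemma hasGaussianLaw_prodMk_comb (hX : IsGaussianProcess X P) (i j k : T) (a b : ℝ) :
    HasGaussianLaw (fun ω => (X i ω, a * X j ω + b * X k ω)) P := by
  have h := (hX.comp_right ![i, j, k]).hasGaussianLaw Finset.univ
  let p : Fin 3 → (↥(Finset.univ : Finset (Fin 3)) → ℝ) →L[ℝ] ℝ := fun n =>
    ContinuousLinearMap.proj ⟨n, Finset.mem_univ n⟩
  exact h.map_fun ((p 0).prod (a • p 1 + b • p 2))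

lemma hasGaussianLaw_comb_four (hX : IsGaussianProcess X P) (i j k l : T) (a b c d : ℝ) :
    HasGaussianLaw (fun ω => a * X i ω + b * X j ω + c * X k ω + d * X l ω) P := by
  have h := (hX.comp_right ![i, j, k, l]).hasGaussianLaw Finset.univ
  let p : Fin 4 → (↥(Finset.univ : Finset (Fin 4)) → ℝ) →L[ℝ] ℝ := fun n =>
    ContinuousLinearMap.proj ⟨n, Finset.mem_univ n⟩
  exact h.map_fun (a • p 0 + b • p 1 + c • p 2 + d • p 3)

end FiniteDimensional

/-- Every `θ ∈ [-1, 1]` is realized by two points, so symmetry and boundedness of `Γ` on its domain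
follow from the same properties of covariances. -/
lemma exists_inner_eq {θ : ℝ} (hθ : θ ∈ Set.Icc (-1 : ℝ) 1) : ∃ x y : S2, inner ℝ x.1 y.1 = θ := by
  have h : 0 ≤ 1 - θ ^ 2 := by nlinarith [hθ.1, hθ.2]
  refine ⟨northPole, ⟨!₂[√(1 - θ ^ 2), 0, θ], ?_⟩, ?_⟩
  · rw [mem_sphere_zero_iff_norm, EuclideanSpace.norm_eq, Fin.sum_univ_three]
    simp [Real.sq_sqrt h]
  · rw [inner_northPole]
    simp

/-! ### The covariance function and integrability of the field -/

section Field

variable {Ω : Type*} [MeasurableSpace Ω] {P : Measure Ω}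
  {Z : S2 → ℝ → Ω → ℝ} {Γ : ℝ → ℝ → ℝ}

namespace IsIsotropicStationaryGaussian

lemma continuousOn_left (hZ : IsIsotropicStationaryGaussian P Z Γ) (τ : ℝ) :
    ContinuousOn (fun θ => Γ θ τ) (Set.Icc (-1) 1) :=
  hZ.continuousOn.comp (f := fun θ => (θ, τ)) (by fun_prop) fun _ hθ => ⟨hθ, Set.mem_univ _⟩

lemma continuous_cov (hZ : IsIsotropicStationaryGaussian P Z Γ) (τ : ℝ) :
    Continuous fun p : S2 × S2 => Γ (inner ℝ p.1.1 p.2.1) τ :=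
  (hZ.continuousOn_left τ).comp_continuous (by fun_prop) fun p => inner_mem_Icc p.1 p.2

lemma cov_neg (hZ : IsIsotropicStationaryGaussian P Z Γ) {θ : ℝ} (hθ : θ ∈ Set.Icc (-1 : ℝ) 1)
    (τ : ℝ) : Γ θ (-τ) = Γ θ τ := by
  obtain ⟨x, y, rfl⟩ := exists_inner_eq hθ
  have h1 := hZ.covariance_eq x y 0 τ
  have h2 := hZ.covariance_eq y x τ 0
  rw [zero_sub] at h1
  rw [sub_zero, real_inner_comm] at h2
  rw [← h1, ← h2]
  simp_rw [mul_comm]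

lemma coeffC_neg (hZ : IsIsotropicStationaryGaussian P Z Γ) (l : ℕ) (τ : ℝ) :
    coeffC Γ l (-τ) = coeffC Γ l τ := by
  unfold coeffC
  congr 1
  refine intervalIntegral.integral_congr fun θ hθ => ?_
  rw [Set.uIcc_of_le (by norm_num)] at hθ
  simp only [hZ.cov_neg hθ]

lemma hasGaussianLaw (hZ : IsIsotropicStationaryGaussian P Z Γ) (x : S2) (t : ℝ) :
    HasGaussianLaw (Z x t) P :=
  hZ.gaussian.hasGaussianLaw_eval (x, t)

lemma hasGaussianLaw_prodMk (hZ : IsIsotropicStationaryGaussian P Z Γ) (x y : S2) (t s : ℝ) :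
    HasGaussianLaw (fun ω => (Z x t ω, Z y s ω)) P :=
  hZ.gaussian.hasGaussianLaw_prodMk (s := (x, t)) (t := (y, s))

lemma hasGaussianLaw_prodMk_comb (hZ : IsIsotropicStationaryGaussian P Z Γ) (x y z : S2)
    (t s r a b : ℝ) : HasGaussianLaw (fun ω => (Z x t ω, a * Z y s ω + b * Z z r ω)) P :=
  SphereTime.hasGaussianLaw_prodMk_comb hZ.gaussian (x, t) (y, s) (z, r) a b

lemma hasGaussianLaw_comb_four (hZ : IsIsotropicStationaryGaussian P Z Γ) (x y z w : S2)
    (t s r q a b c d : ℝ) :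
    HasGaussianLaw (fun ω => a * Z x t ω + b * Z y s ω + c * Z z r ω + d * Z w q ω) P :=
  SphereTime.hasGaussianLaw_comb_four hZ.gaussian (x, t) (y, s) (z, r) (w, q) a b c d

variable [IsProbabilityMeasure P]

lemma isL2Bounded (hZ : IsIsotropicStationaryGaussian P Z Γ)
    (hvar : ∀ x t, ∫ ω, Z x t ω ^ 2 ∂P = 1) : IsL2Bounded P (fun p : S2 × ℝ => Z p.1 p.2) :=
  ⟨hZ.measurable, fun p => (hZ.hasGaussianLaw p.1 p.2).memLp_two,
    1, fun p => (hvar p.1 p.2).le⟩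

lemma abs_integral_mul_le_one (hZ : IsIsotropicStationaryGaussian P Z Γ)
    (hvar : ∀ x t, ∫ ω, Z x t ω ^ 2 ∂P = 1) (x y : S2) (t s : ℝ) :
    |∫ ω, Z x t ω * Z y s ω ∂P| ≤ 1 := by
  have hx := (hZ.hasGaussianLaw x t).memLp_two
  have hy := (hZ.hasGaussianLaw y s).memLp_two
  calc |∫ ω, Z x t ω * Z y s ω ∂P| ≤ ∫ ω, |Z x t ω * Z y s ω| ∂P := abs_integral_le_integral_abs
    _ ≤ ∫ ω, (1 / 2 * Z x t ω ^ 2 + 1 / 2 * Z y s ω ^ 2) ∂P := by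
        refine integral_mono (hx.integrable_mul hy).abs
          ((hx.integrable_sq.const_mul _).fun_add (hy.integrable_sq.const_mul _)) fun ω => ?_
        rw [abs_mul]
        nlinarith [sq_nonneg (|Z x t ω| - |Z y s ω|), sq_abs (Z x t ω), sq_abs (Z y s ω)]
    _ = 1 := by
        rw [integral_add (hx.integrable_sq.const_mul _) (hy.integrable_sq.const_mul _),
          integral_const_mul, integral_const_mul, hvar, hvar]
        norm_num

lemma abs_cov_le_one (hZ : IsIsotropicStationaryGaussian P Z Γ)
    (hvar : ∀ x t, ∫ ω, Z x t ω ^ 2 ∂P = 1) {θ : ℝ} (hθ : θ ∈ Set.Icc (-1 : ℝ) 1) (τ : ℝ) :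
    |Γ θ τ| ≤ 1 := by
  obtain ⟨x, y, rfl⟩ := exists_inner_eq hθ
  have h := hZ.abs_integral_mul_le_one hvar x y τ 0
  rwa [hZ.covariance_eq, sub_zero] at h

lemma isL2Bounded_mul (hZ : IsIsotropicStationaryGaussian P Z Γ)
    (hvar : ∀ x t, ∫ ω, Z x t ω ^ 2 ∂P = 1) :
    IsL2Bounded P (fun (q : (S2 × S2) × ℝ) ω => Z q.1.1 q.2 ω * Z q.1.2 q.2 ω) where
  measurable := (hZ.measurable.comp (measurable_fst.prodMk
      (measurable_snd.fst.fst.prodMk measurable_snd.snd))).mul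
    (hZ.measurable.comp (measurable_fst.prodMk
      (measurable_snd.fst.snd.prodMk measurable_snd.snd)))
  memLp q := memLp_mul_of_gaussian (hZ.hasGaussianLaw _ _) (hZ.hasGaussianLaw _ _)
  bounded := by
    -- By the Wick formula `E[X² Y²] = 1 + 2 E[XY]²`, and the correlation is at most `1`.
    refine ⟨3, fun q => ?_⟩
    have hG (a b : ℝ) := (hZ.hasGaussianLaw_prodMk_comb q.1.1 q.1.1 q.1.2 q.2 q.2 q.2 a b).snd
    simp_rw [mul_pow]
    rw [integral_sq_mul_sq_of_gaussian hG (hZ.centered _ _) (hZ.centered _ _), hvar, hvar]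
    have h := hZ.abs_integral_mul_le_one hvar q.1.1 q.1.2 q.2 q.2
    nlinarith [abs_le.1 h]

lemma isL2Bounded_above (hZ : IsIsotropicStationaryGaussian P Z Γ) (u : ℝ) :
    IsL2Bounded P (fun (p : S2 × ℝ) ω => above u (Z p.1 p.2 ω) - gaussTail u) := by
  have hm : Measurable fun p : Ω × (S2 × ℝ) => above u (Z p.2.1 p.2.2 p.1) - gaussTail u :=
    ((measurable_above u).comp hZ.measurable).sub_const _
  have hb : ∀ (p : S2 × ℝ) ω, |above u (Z p.1 p.2 ω) - gaussTail u| ≤ 1 := fun p ω =>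
    abs_le.2 ⟨by linarith [above_nonneg u (Z p.1 p.2 ω), gaussTail_le_one u],
      by linarith [above_le_one u (Z p.1 p.2 ω), gaussTail_nonneg u]⟩
  have hL : ∀ p : S2 × ℝ, MemLp (fun ω => above u (Z p.1 p.2 ω) - gaussTail u) 2 P := fun p =>
    MemLp.of_bound (hm.comp (measurable_id.prodMk measurable_const)).aestronglyMeasurable 1
      (.of_forall (hb p))
  refine ⟨hm, hL, 1, fun p => ?_⟩
  calc _ ≤ ∫ _, (1 : ℝ) ∂P := integral_mono (hL p).integrable_sq (integrable_const _)
        fun ω => by simpa using (sq_le_sq.2 ((hb p ω).trans (le_abs_self 1)))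
    _ = 1 := by simp

end IsIsotropicStationaryGaussian

end Field

lemma exists_abs_sphHarm_le (l : ℕ) (m : ℤ) : ∃ K, ∀ x, |sphHarm l m x| ≤ K := by
  obtain ⟨K, hK⟩ := (isCompact_univ (X := S2)).exists_bound_of_continuousOn
    (continuous_sphHarm l m).continuousOn
  exact ⟨K, fun x => hK x (Set.mem_univ x)⟩

/-! ### Random harmonic coefficients and the centred functionals at a fixed time -/

section Coefficients

variable {Ω : Type*} [MeasurableSpace Ω] {P : Measure Ω} {Z : S2 → ℝ → Ω → ℝ} {Γ : ℝ → ℝ → ℝ}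

lemma harmCoeff_eq (Z : S2 → ℝ → Ω → ℝ) (l : ℕ) (m : ℤ) (t : ℝ) (ω : Ω) :
    harmCoeff Z l m t ω = ∫ x, sphHarm l m x * Z x t ω ∂area :=
  integral_congr_ae (.of_forall fun x => mul_comm _ _)

/-- As an integral over pairs of points, the squared coefficient has moments computable from those
of the field itself; joint Gaussianity of the coefficients never has to be established. -/
lemma harmCoeff_sq (Z : S2 → ℝ → Ω → ℝ) (l : ℕ) (m : ℤ) (t : ℝ) (ω : Ω) :
    harmCoeff Z l m t ω ^ 2 = ∫ q : S2 × S2, (sphHarm l m q.1 * sphHarm l m q.2) *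
      (Z q.1 t ω * Z q.2 t ω) ∂(area.prod area) := by
  rw [harmCoeff_eq, sq, ← integral_prod_mul]
  exact integral_congr_ae (.of_forall fun q => by ring)

/-- The centred excursion area. -/
noncomputable def centredArea (Z : S2 → ℝ → Ω → ℝ) (u t : ℝ) (ω : Ω) : ℝ :=
  ∫ x, (above u (Z x t ω) - gaussTail u) ∂area

/-- The centred square of a random coefficient. -/
noncomputable def centredPower (Γ : ℝ → ℝ → ℝ) (Z : S2 → ℝ → Ω → ℝ) (l : ℕ) (m : ℤ) (t : ℝ)
    (ω : Ω) : ℝ :=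
  harmCoeff Z l m t ω ^ 2 - coeffC Γ l 0

namespace IsIsotropicStationaryGaussian

lemma integral_cov_mul_sphHarm (hZ : IsIsotropicStationaryGaussian P Z Γ) {l : ℕ} {m : ℤ}
    (hm : m.natAbs ≤ l) (τ : ℝ) (x : S2) :
    ∫ y, Γ (inner ℝ x.1 y.1) τ * sphHarm l m y ∂area = coeffC Γ l τ * sphHarm l m x :=
  integral_comp_inner_mul_sphHarm (hZ.continuousOn_left τ) hm x

/-- Funk–Hecke makes the harmonics eigenfunctions of the covariance kernel; orthonormality does the
rest. -/
lemma integral_cov_mul_sphHarm_mul_sphHarm (hZ : IsIsotropicStationaryGaussian P Z Γ) {l : ℕ}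
    {m m' : ℤ} (hm : m.natAbs ≤ l) (hm' : m'.natAbs ≤ l) (τ : ℝ) :
    ∫ p : S2 × S2, sphHarm l m p.1 * sphHarm l m' p.2 * Γ (inner ℝ p.1.1 p.2.1) τ
      ∂(area.prod area) = if m = m' then coeffC Γ l τ else 0 := by
  have hc : Continuous fun p : S2 × S2 =>
      sphHarm l m p.1 * sphHarm l m' p.2 * Γ (inner ℝ p.1.1 p.2.1) τ :=
    (((continuous_sphHarm l m).comp continuous_fst).mul
      ((continuous_sphHarm l m').comp continuous_snd)).mul (hZ.continuous_cov τ)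
  rw [integral_prod _ (hc.integrable_of_hasCompactSupport (HasCompactSupport.of_compactSpace _))]
  have h : ∀ x : S2, ∫ y, sphHarm l m x * sphHarm l m' y * Γ (inner ℝ x.1 y.1) τ ∂area =
      coeffC Γ l τ * (sphHarm l m x * sphHarm l m' x) := fun x => by
    rw [← mul_assoc, mul_comm (coeffC Γ l τ), mul_assoc, ← hZ.integral_cov_mul_sphHarm hm',
      ← integral_const_mul]
    exact integral_congr_ae (.of_forall fun y => by ring)
  simp_rw [h]
  rw [integral_const_mul, integral_sphHarm_mul_sphHarm hm hm']
  simp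

variable [IsProbabilityMeasure P]

lemma isL2Bounded_sphHarm_mul (hZ : IsIsotropicStationaryGaussian P Z Γ)
    (hvar : ∀ x t, ∫ ω, Z x t ω ^ 2 ∂P = 1) (l : ℕ) (m : ℤ) :
    IsL2Bounded P (fun (p : S2 × ℝ) ω => sphHarm l m p.1 * Z p.1 p.2 ω) :=
  (hZ.isL2Bounded hvar).const_mul (f := fun p => sphHarm l m p.1)
    ((continuous_sphHarm l m).measurable.comp measurable_fst)
    ((exists_abs_sphHarm_le l m).imp fun _ h p => h p.1)

lemma isL2Bounded_sphHarm_mul_mul (hZ : IsIsotropicStationaryGaussian P Z Γ)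
    (hvar : ∀ x t, ∫ ω, Z x t ω ^ 2 ∂P = 1) (l : ℕ) (m : ℤ) :
    IsL2Bounded P (fun (q : (S2 × S2) × ℝ) ω => (sphHarm l m q.1.1 * sphHarm l m q.1.2) *
      (Z q.1.1 q.2 ω * Z q.1.2 q.2 ω)) := by
  refine (hZ.isL2Bounded_mul hvar).const_mul
    (f := fun q => sphHarm l m q.1.1 * sphHarm l m q.1.2)
    (((continuous_sphHarm l m).measurable.comp measurable_fst.fst).mul
      ((continuous_sphHarm l m).measurable.comp measurable_fst.snd)) ?_
  obtain ⟨K, hK⟩ := exists_abs_sphHarm_le l m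
  refine ⟨K * K, fun q => ?_⟩
  rw [abs_mul]
  exact mul_le_mul (hK _) (hK _) (abs_nonneg _) ((abs_nonneg _).trans (hK q.1.1))

lemma isL2Bounded_harmCoeff (hZ : IsIsotropicStationaryGaussian P Z Γ)
    (hvar : ∀ x t, ∫ ω, Z x t ω ^ 2 ∂P = 1) (l : ℕ) (m : ℤ) :
    IsL2Bounded P (harmCoeff Z l m) := by
  rw [show harmCoeff Z l m = fun t ω => ∫ x, sphHarm l m x * Z x t ω ∂area from
    funext fun t => funext fun ω => harmCoeff_eq Z l m t ω]
  exact (hZ.isL2Bounded_sphHarm_mul hvar l m).integral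

lemma isL2Bounded_harmCoeff_sq (hZ : IsIsotropicStationaryGaussian P Z Γ)
    (hvar : ∀ x t, ∫ ω, Z x t ω ^ 2 ∂P = 1) (l : ℕ) (m : ℤ) :
    IsL2Bounded P (fun t ω => harmCoeff Z l m t ω ^ 2) := by
  simp_rw [harmCoeff_sq]
  exact (hZ.isL2Bounded_sphHarm_mul_mul hvar l m).integral

lemma isL2Bounded_centredPower (hZ : IsIsotropicStationaryGaussian P Z Γ)
    (hvar : ∀ x t, ∫ ω, Z x t ω ^ 2 ∂P = 1) (l : ℕ) (m : ℤ) :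
    IsL2Bounded P (centredPower Γ Z l m) :=
  (hZ.isL2Bounded_harmCoeff_sq hvar l m).add
    (IsL2Bounded.const (fun _ => -coeffC Γ l 0) measurable_const ⟨_, fun _ => le_rfl⟩)

lemma isL2Bounded_centredArea (hZ : IsIsotropicStationaryGaussian P Z Γ) (u : ℝ) :
    IsL2Bounded P (centredArea Z u) :=
  (hZ.isL2Bounded_above u).integral

lemma integral_above (hZ : IsIsotropicStationaryGaussian P Z Γ)
    (hvar : ∀ x t, ∫ ω, Z x t ω ^ 2 ∂P = 1) (u : ℝ) (x : S2) (t : ℝ) :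
    ∫ ω, above u (Z x t ω) ∂P = gaussTail u := by
  have h := integral_map (hZ.hasGaussianLaw x t).aemeasurable (f := above u)
    (measurable_above u).aestronglyMeasurable
  rw [← h, map_eq_of_gaussian (hZ.hasGaussianLaw x t) (hZ.centered x t), hvar, Real.toNNReal_one,
    integral_above_gaussian]

lemma integrable_above (hZ : IsIsotropicStationaryGaussian P Z Γ) (u : ℝ) (x : S2) (t : ℝ) :
    Integrable (fun ω => above u (Z x t ω)) P :=
  Integrable.of_bound ((measurable_above u).comp_aemeasurable
    (hZ.hasGaussianLaw x t).aemeasurable).aestronglyMeasurable 1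
    (.of_forall fun ω => abs_above_le_one _ _)

lemma integral_above_sub (hZ : IsIsotropicStationaryGaussian P Z Γ)
    (hvar : ∀ x t, ∫ ω, Z x t ω ^ 2 ∂P = 1) (u : ℝ) (x : S2) (t : ℝ) :
    ∫ ω, (above u (Z x t ω) - gaussTail u) ∂P = 0 := by
  rw [integral_sub (hZ.integrable_above u x t) (integrable_const _), hZ.integral_above hvar]
  simp

end IsIsotropicStationaryGaussian

end Coefficients

/-! ### Exact covariances between two times -/

section Covariances

variable {Ω : Type*} [MeasurableSpace Ω] {P : Measure Ω} [IsProbabilityMeasure P]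
  {Z : S2 → ℝ → Ω → ℝ} {Γ : ℝ → ℝ → ℝ}

namespace IsIsotropicStationaryGaussian

lemma integral_harmCoeff_mul_harmCoeff (hZ : IsIsotropicStationaryGaussian P Z Γ)
    (hvar : ∀ x t, ∫ ω, Z x t ω ^ 2 ∂P = 1) {l : ℕ} {m m' : ℤ} (hm : m.natAbs ≤ l)
    (hm' : m'.natAbs ≤ l) (t s : ℝ) :
    ∫ ω, harmCoeff Z l m t ω * harmCoeff Z l m' s ω ∂P =
      if m = m' then coeffC Γ l (t - s) else 0 := by
  have h (n : ℤ) (r : ℝ) := (hZ.isL2Bounded_sphHarm_mul hvar l n).comp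
    (f := fun x : S2 => (x, r)) (by fun_prop)
  simp_rw [harmCoeff_eq]
  rw [(h m t).integral_mul_integral (h m' s),
    ← hZ.integral_cov_mul_sphHarm_mul_sphHarm hm hm' (t - s)]
  refine integral_congr_ae (.of_forall fun p => ?_)
  simp only
  rw [← hZ.covariance_eq, ← integral_const_mul]
  exact integral_congr_ae (.of_forall fun ω => by ring)

lemma integral_harmCoeff_sq (hZ : IsIsotropicStationaryGaussian P Z Γ)
    (hvar : ∀ x t, ∫ ω, Z x t ω ^ 2 ∂P = 1) {l : ℕ} {m : ℤ} (hm : m.natAbs ≤ l) (t : ℝ) :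
    ∫ ω, harmCoeff Z l m t ω ^ 2 ∂P = coeffC Γ l 0 := by
  have h := hZ.integral_harmCoeff_mul_harmCoeff hvar hm hm t t
  simp_rw [sq]
  simpa using h

/-- Up to the time shift, `C_l` is the autocovariance of the stationary process `a_{l,0}`, and `|ab|
≤ (a² + b²)/2`. -/
lemma abs_coeffC_le (hZ : IsIsotropicStationaryGaussian P Z Γ)
    (hvar : ∀ x t, ∫ ω, Z x t ω ^ 2 ∂P = 1) (l : ℕ) (τ : ℝ) : |coeffC Γ l τ| ≤ coeffC Γ l 0 := by
  have hL := hZ.isL2Bounded_harmCoeff hvar l 0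
  have h := hZ.integral_harmCoeff_mul_harmCoeff hvar (m := 0) (m' := 0) (Nat.zero_le l)
    (Nat.zero_le l) τ 0
  have h2 := hZ.integral_harmCoeff_sq hvar (m := 0) (Nat.zero_le l)
  rw [if_pos rfl, sub_zero] at h
  rw [← h]
  calc _ ≤ ∫ ω, |harmCoeff Z l 0 τ ω * harmCoeff Z l 0 0 ω| ∂P := abs_integral_le_integral_abs
    _ ≤ ∫ ω, (1 / 2 * harmCoeff Z l 0 τ ω ^ 2 + 1 / 2 * harmCoeff Z l 0 0 ω ^ 2) ∂P := by
        refine integral_mono (hL.integrable_mul hL τ 0).abs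
          (((hL.integrable_sq τ).const_mul _).fun_add ((hL.integrable_sq 0).const_mul _))
          fun ω => ?_
        rw [abs_mul]
        nlinarith [sq_nonneg (|harmCoeff Z l 0 τ ω| - |harmCoeff Z l 0 0 ω|),
          sq_abs (harmCoeff Z l 0 τ ω), sq_abs (harmCoeff Z l 0 0 ω)]
    _ = coeffC Γ l 0 := by
        rw [integral_add ((hL.integrable_sq τ).const_mul _) ((hL.integrable_sq 0).const_mul _),
          integral_const_mul, integral_const_mul, h2, h2]
        ring

lemma coeffC_zero_nonneg (hZ : IsIsotropicStationaryGaussian P Z Γ)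
    (hvar : ∀ x t, ∫ ω, Z x t ω ^ 2 ∂P = 1) (l : ℕ) : 0 ≤ coeffC Γ l 0 :=
  (abs_nonneg _).trans (hZ.abs_coeffC_le hvar l 0)

lemma integral_centredPower (hZ : IsIsotropicStationaryGaussian P Z Γ)
    (hvar : ∀ x t, ∫ ω, Z x t ω ^ 2 ∂P = 1) {l : ℕ} {m : ℤ} (hm : m.natAbs ≤ l) (t : ℝ) :
    ∫ ω, centredPower Γ Z l m t ω ∂P = 0 := by
  unfold centredPower
  rw [integral_sub (((hZ.isL2Bounded_harmCoeff hvar l m).integrable_sq t)) (integrable_const _),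
    hZ.integral_harmCoeff_sq hvar hm]
  simp

lemma integral_centredArea (hZ : IsIsotropicStationaryGaussian P Z Γ)
    (hvar : ∀ x t, ∫ ω, Z x t ω ^ 2 ∂P = 1) (u t : ℝ) :
    ∫ ω, centredArea Z u t ω ∂P = 0 := by
  have h := (hZ.isL2Bounded_above u).comp (f := fun x : S2 => (x, t)) (by fun_prop)
  unfold centredArea
  rw [h.integral_integral]
  simp [hZ.integral_above_sub hvar]

/-- Centring the indicator cancels the term `E[Z Z]` times the Gaussian tail, leaving only the
product of the two correlations. -/
lemma integral_above_mul_mul (hZ : IsIsotropicStationaryGaussian P Z Γ)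
    (hvar : ∀ x t, ∫ ω, Z x t ω ^ 2 ∂P = 1) (u : ℝ) (x y z : S2) (t s : ℝ) :
    ∫ ω, (above u (Z x t ω) - gaussTail u) * (Z y s ω * Z z s ω) ∂P =
      u * gaussianPDFReal 0 1 u *
        (Γ (inner ℝ x.1 y.1) (t - s) * Γ (inner ℝ x.1 z.1) (t - s)) := by
  have hi : Integrable (fun ω => Z y s ω * Z z s ω) P :=
    integrable_mul_of_gaussian (hZ.hasGaussianLaw y s) (hZ.hasGaussianLaw z s)
  have h := integral_above_mul_mul_of_gaussian (hZ.hasGaussianLaw_prodMk_comb x y z t s s)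
    (hZ.centered x t) (hZ.centered y s) (hZ.centered z s) (hvar x t) u
  have hi2 : Integrable (fun ω => above u (Z x t ω) * (Z y s ω * Z z s ω)) P :=
    hi.bdd_mul ((measurable_above u).comp_aemeasurable
      (hZ.hasGaussianLaw x t).aemeasurable).aestronglyMeasurable
      (.of_forall fun ω => abs_above_le_one _ _)
  simp_rw [sub_mul]
  rw [integral_sub hi2 (hi.const_mul _), h, integral_const_mul, hZ.covariance_eq x y,
    hZ.covariance_eq x z]
  ring

/-- The joint moment is a product of two covariances from the excursion point `x`; Funk–Hecke in
each of the other two variables yields `C_l² Y_{l,m}(x)²`, and the integral over `x` is `1` by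
orthonormality. -/
lemma integral_centredArea_mul_centredPower (hZ : IsIsotropicStationaryGaussian P Z Γ)
    (hvar : ∀ x t, ∫ ω, Z x t ω ^ 2 ∂P = 1) {l : ℕ} {m : ℤ} (hm : m.natAbs ≤ l) (u t s : ℝ) :
    ∫ ω, centredArea Z u t ω * centredPower Γ Z l m s ω ∂P =
      u * gaussianPDFReal 0 1 u * coeffC Γ l (t - s) ^ 2 := by
  have h1 := (hZ.isL2Bounded_above u).comp (f := fun x : S2 => (x, t)) (by fun_prop)
  have h2 := (hZ.isL2Bounded_sphHarm_mul_mul hvar l m).comp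
    (f := fun x : S2 × S2 => (x, s)) (by fun_prop)
  have hA := hZ.isL2Bounded_centredArea u
  have key : ∫ ω, centredArea Z u t ω * harmCoeff Z l m s ω ^ 2 ∂P =
      u * gaussianPDFReal 0 1 u * coeffC Γ l (t - s) ^ 2 := by
    simp_rw [harmCoeff_sq]
    unfold centredArea
    rw [h1.integral_mul_integral h2]
    have hp : ∀ p : S2 × (S2 × S2), ∫ ω, (above u (Z p.1 t ω) - gaussTail u) *
        (sphHarm l m p.2.1 * sphHarm l m p.2.2 * (Z p.2.1 s ω * Z p.2.2 s ω)) ∂P =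
        u * gaussianPDFReal 0 1 u * ((Γ (inner ℝ p.1.1 p.2.1.1) (t - s) * sphHarm l m p.2.1) *
          (Γ (inner ℝ p.1.1 p.2.2.1) (t - s) * sphHarm l m p.2.2)) := fun p => by
      rw [show u * gaussianPDFReal 0 1 u *
        ((Γ (inner ℝ p.1.1 p.2.1.1) (t - s) * sphHarm l m p.2.1) *
          (Γ (inner ℝ p.1.1 p.2.2.1) (t - s) * sphHarm l m p.2.2)) =
          sphHarm l m p.2.1 * sphHarm l m p.2.2 * (u * gaussianPDFReal 0 1 u *
        (Γ (inner ℝ p.1.1 p.2.1.1) (t - s) * Γ (inner ℝ p.1.1 p.2.2.1) (t - s))) by ring,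
        ← hZ.integral_above_mul_mul hvar, ← integral_const_mul]
      exact integral_congr_ae (.of_forall fun ω => by ring)
    have hc : Continuous fun p : S2 × (S2 × S2) =>
        (Γ (inner ℝ p.1.1 p.2.1.1) (t - s) * sphHarm l m p.2.1) *
          (Γ (inner ℝ p.1.1 p.2.2.1) (t - s) * sphHarm l m p.2.2) :=
      (((hZ.continuous_cov (t - s)).comp (continuous_fst.prodMk continuous_snd.fst)).mul
        ((continuous_sphHarm l m).comp continuous_snd.fst)).mul
      (((hZ.continuous_cov (t - s)).comp (continuous_fst.prodMk continuous_snd.snd)).mul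
        ((continuous_sphHarm l m).comp continuous_snd.snd))
    simp_rw [hp]
    rw [integral_const_mul, integral_prod _
      (hc.integrable_of_hasCompactSupport (HasCompactSupport.of_compactSpace _))]
    have hx : ∀ x : S2, ∫ q : S2 × S2, (Γ (inner ℝ x.1 q.1.1) (t - s) * sphHarm l m q.1) *
        (Γ (inner ℝ x.1 q.2.1) (t - s) * sphHarm l m q.2) ∂(area.prod area) =
        coeffC Γ l (t - s) ^ 2 * (sphHarm l m x * sphHarm l m x) := fun x => by
      rw [integral_prod_mul (fun y : S2 => Γ (inner ℝ x.1 y.1) (t - s) * sphHarm l m y)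
        (fun y : S2 => Γ (inner ℝ x.1 y.1) (t - s) * sphHarm l m y),
        hZ.integral_cov_mul_sphHarm hm]
      ring
    simp_rw [hx]
    rw [integral_const_mul, integral_sphHarm_mul_sphHarm hm hm]
    simp
  unfold centredPower
  simp_rw [mul_sub]
  rw [integral_sub (hA.integrable_mul (hZ.isL2Bounded_harmCoeff_sq hvar l m) t s)
    (((hA.memLp t).integrable (by norm_num)).mul_const _), key, integral_mul_const,
    hZ.integral_centredArea hvar]
  simp

/-- Wick's formula has three pairings: the one within each time gives `C_l(0)²`, removed by
centring, and the two across times give `C_l(t-s)²` each when `m = m'` and nothing otherwise. -/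
lemma integral_centredPower_mul_centredPower (hZ : IsIsotropicStationaryGaussian P Z Γ)
    (hvar : ∀ x t, ∫ ω, Z x t ω ^ 2 ∂P = 1) {l : ℕ} {m m' : ℤ} (hm : m.natAbs ≤ l)
    (hm' : m'.natAbs ≤ l) (t s : ℝ) :
    ∫ ω, centredPower Γ Z l m t ω * centredPower Γ Z l m' s ω ∂P =
      if m = m' then 2 * coeffC Γ l (t - s) ^ 2 else 0 := by
  have hL (n : ℤ) := hZ.isL2Bounded_harmCoeff_sq hvar l n
  have hi (n : ℤ) (r : ℝ) : Integrable (fun ω => harmCoeff Z l n r ω ^ 2) P :=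
    ((hL n).memLp r).integrable (by norm_num)
  have h (n : ℤ) (r : ℝ) := (hZ.isL2Bounded_sphHarm_mul_mul hvar l n).comp
    (f := fun x : S2 × S2 => (x, r)) (by fun_prop)
  have hd : Continuous (sphHarm l m) := continuous_sphHarm l m
  have hd' : Continuous (sphHarm l m') := continuous_sphHarm l m'
  have hΓ (τ : ℝ) := hZ.continuous_cov τ
  have key : ∫ ω, harmCoeff Z l m t ω ^ 2 * harmCoeff Z l m' s ω ^ 2 ∂P =
      coeffC Γ l 0 ^ 2 + if m = m' then 2 * coeffC Γ l (t - s) ^ 2 else 0 := by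
    simp_rw [harmCoeff_sq]
    rw [(h m t).integral_mul_integral (h m' s)]
    have hp : ∀ p : (S2 × S2) × (S2 × S2), ∫ ω,
        (sphHarm l m p.1.1 * sphHarm l m p.1.2 * (Z p.1.1 t ω * Z p.1.2 t ω)) *
        (sphHarm l m' p.2.1 * sphHarm l m' p.2.2 * (Z p.2.1 s ω * Z p.2.2 s ω)) ∂P =
        (sphHarm l m p.1.1 * sphHarm l m p.1.2) * (
          Γ (inner ℝ p.1.1.1 p.1.2.1) 0 *
            (sphHarm l m' p.2.1 * sphHarm l m' p.2.2 * Γ (inner ℝ p.2.1.1 p.2.2.1) 0) +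
          (Γ (inner ℝ p.1.1.1 p.2.1.1) (t - s) * sphHarm l m' p.2.1) *
            (Γ (inner ℝ p.1.2.1 p.2.2.1) (t - s) * sphHarm l m' p.2.2) +
          (Γ (inner ℝ p.1.2.1 p.2.1.1) (t - s) * sphHarm l m' p.2.1) *
            (Γ (inner ℝ p.1.1.1 p.2.2.1) (t - s) * sphHarm l m' p.2.2)) := fun p => by
      have hw := integral_mul_four_of_gaussian
        (hZ.hasGaussianLaw_comb_four p.1.1 p.1.2 p.2.1 p.2.2 t t s s)
        (hZ.centered _ _) (hZ.centered _ _) (hZ.centered _ _) (hZ.centered _ _)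
      simp_rw [hZ.covariance_eq, sub_self] at hw
      calc _ = sphHarm l m p.1.1 * sphHarm l m p.1.2 * (sphHarm l m' p.2.1 * sphHarm l m' p.2.2) *
          ∫ ω, Z p.1.1 t ω * Z p.1.2 t ω * (Z p.2.1 s ω * Z p.2.2 s ω) ∂P := by
            rw [← integral_const_mul]
            exact integral_congr_ae (.of_forall fun ω => by ring)
        _ = _ := by rw [hw]; ring
    have hq : ∀ q : S2 × S2, ∫ r : S2 × S2, (
          Γ (inner ℝ q.1.1 q.2.1) 0 *
            (sphHarm l m' r.1 * sphHarm l m' r.2 * Γ (inner ℝ r.1.1 r.2.1) 0) +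
          (Γ (inner ℝ q.1.1 r.1.1) (t - s) * sphHarm l m' r.1) *
            (Γ (inner ℝ q.2.1 r.2.1) (t - s) * sphHarm l m' r.2) +
          (Γ (inner ℝ q.2.1 r.1.1) (t - s) * sphHarm l m' r.1) *
            (Γ (inner ℝ q.1.1 r.2.1) (t - s) * sphHarm l m' r.2)) ∂(area.prod area) =
        coeffC Γ l 0 * Γ (inner ℝ q.1.1 q.2.1) 0 +
          2 * coeffC Γ l (t - s) ^ 2 * (sphHarm l m' q.1 * sphHarm l m' q.2) := fun q => by
      have hg (x : S2) : Continuous fun y : S2 => Γ (inner ℝ x.1 y.1) (t - s) * sphHarm l m' y :=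
        (continuous_comp_inner (hZ.continuousOn_left (t - s)) x).mul hd'
      have i1 : Integrable (fun r : S2 × S2 => Γ (inner ℝ q.1.1 q.2.1) 0 *
          (sphHarm l m' r.1 * sphHarm l m' r.2 * Γ (inner ℝ r.1.1 r.2.1) 0)) (area.prod area) :=
        (continuous_const.mul (((hd'.comp continuous_fst).mul (hd'.comp continuous_snd)).mul
          (hΓ 0))).integrable_of_hasCompactSupport (HasCompactSupport.of_compactSpace _)
      have i2 (x y : S2) : Integrable (fun r : S2 × S2 =>
          (Γ (inner ℝ x.1 r.1.1) (t - s) * sphHarm l m' r.1) *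
            (Γ (inner ℝ y.1 r.2.1) (t - s) * sphHarm l m' r.2)) (area.prod area) :=
        (((hg x).comp continuous_fst).mul ((hg y).comp
          continuous_snd)).integrable_of_hasCompactSupport (HasCompactSupport.of_compactSpace _)
      have e (x y : S2) : ∫ r : S2 × S2, (Γ (inner ℝ x.1 r.1.1) (t - s) * sphHarm l m' r.1) *
            (Γ (inner ℝ y.1 r.2.1) (t - s) * sphHarm l m' r.2) ∂(area.prod area) =
          coeffC Γ l (t - s) ^ 2 * (sphHarm l m' x * sphHarm l m' y) := by
        rw [integral_prod_mul (fun z : S2 => Γ (inner ℝ x.1 z.1) (t - s) * sphHarm l m' z)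
          (fun z : S2 => Γ (inner ℝ y.1 z.1) (t - s) * sphHarm l m' z),
          hZ.integral_cov_mul_sphHarm hm', hZ.integral_cov_mul_sphHarm hm']
        ring
      rw [integral_add (i1.fun_add (i2 _ _)) (i2 _ _), integral_add i1 (i2 _ _),
        integral_const_mul, e, e, hZ.integral_cov_mul_sphHarm_mul_sphHarm hm' hm', if_pos rfl]
      ring
    have hc : Continuous fun p : (S2 × S2) × (S2 × S2) =>
        (sphHarm l m p.1.1 * sphHarm l m p.1.2) * (
          Γ (inner ℝ p.1.1.1 p.1.2.1) 0 *
            (sphHarm l m' p.2.1 * sphHarm l m' p.2.2 * Γ (inner ℝ p.2.1.1 p.2.2.1) 0) +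
          (Γ (inner ℝ p.1.1.1 p.2.1.1) (t - s) * sphHarm l m' p.2.1) *
            (Γ (inner ℝ p.1.2.1 p.2.2.1) (t - s) * sphHarm l m' p.2.2) +
          (Γ (inner ℝ p.1.2.1 p.2.1.1) (t - s) * sphHarm l m' p.2.1) *
            (Γ (inner ℝ p.1.1.1 p.2.2.1) (t - s) * sphHarm l m' p.2.2)) := by
      have g {f g : (S2 × S2) × (S2 × S2) → S2} (τ : ℝ) (hf : Continuous f) (hg : Continuous g) :
          Continuous fun p => Γ (inner ℝ (f p).1 (g p).1) τ := (hΓ τ).comp (hf.prodMk hg)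
      have c1 : Continuous fun p : (S2 × S2) × (S2 × S2) => p.1.1 := continuous_fst.fst
      have c2 : Continuous fun p : (S2 × S2) × (S2 × S2) => p.1.2 := continuous_fst.snd
      have c3 : Continuous fun p : (S2 × S2) × (S2 × S2) => p.2.1 := continuous_snd.fst
      have c4 : Continuous fun p : (S2 × S2) × (S2 × S2) => p.2.2 := continuous_snd.snd
      exact ((hd.comp c1).mul (hd.comp c2)).mul ((((g 0 c1 c2).mul
        (((hd'.comp c3).mul (hd'.comp c4)).mul (g 0 c3 c4))).add
        (((g _ c1 c3).mul (hd'.comp c3)).mul ((g _ c2 c4).mul (hd'.comp c4)))).add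
        (((g _ c2 c3).mul (hd'.comp c3)).mul ((g _ c1 c4).mul (hd'.comp c4))))
    simp_rw [hp]
    rw [integral_prod _
      (hc.integrable_of_hasCompactSupport (HasCompactSupport.of_compactSpace _))]
    simp_rw [integral_const_mul, hq]
    have j1 : Integrable (fun q : S2 × S2 => coeffC Γ l 0 * (sphHarm l m q.1 * sphHarm l m q.2 *
        Γ (inner ℝ q.1.1 q.2.1) 0)) (area.prod area) :=
      (continuous_const.mul (((hd.comp continuous_fst).mul (hd.comp continuous_snd)).mul
        (hΓ 0))).integrable_of_hasCompactSupport (HasCompactSupport.of_compactSpace _)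
    have j2 : Integrable (fun q : S2 × S2 => 2 * coeffC Γ l (t - s) ^ 2 *
        ((sphHarm l m q.1 * sphHarm l m' q.1) * (sphHarm l m q.2 * sphHarm l m' q.2)))
        (area.prod area) :=
      (continuous_const.mul (((hd.mul hd').comp continuous_fst).mul ((hd.mul hd').comp
        continuous_snd))).integrable_of_hasCompactSupport (HasCompactSupport.of_compactSpace _)
    calc _ = ∫ q : S2 × S2, (coeffC Γ l 0 * (sphHarm l m q.1 * sphHarm l m q.2 *
          Γ (inner ℝ q.1.1 q.2.1) 0) + 2 * coeffC Γ l (t - s) ^ 2 *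
        ((sphHarm l m q.1 * sphHarm l m' q.1) * (sphHarm l m q.2 * sphHarm l m' q.2)))
          ∂(area.prod area) := integral_congr_ae (.of_forall fun q => by simp only; ring)
      _ = _ := by
        rw [integral_add j1 j2, integral_const_mul, integral_const_mul,
          hZ.integral_cov_mul_sphHarm_mul_sphHarm hm hm, if_pos rfl,
          integral_prod_mul (fun y : S2 => sphHarm l m y * sphHarm l m' y)
            (fun y : S2 => sphHarm l m y * sphHarm l m' y),
          integral_sphHarm_mul_sphHarm hm hm']
        split_ifs <;> ring
  have j0 : Integrable (fun ω => harmCoeff Z l m t ω ^ 2 * harmCoeff Z l m' s ω ^ 2) P :=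
    (hL m).integrable_mul (hL m') t s
  have j1 := (hi m t).const_mul (-coeffC Γ l 0)
  have j2 := (hi m' s).const_mul (-coeffC Γ l 0)
  calc _ = ∫ ω, (harmCoeff Z l m t ω ^ 2 * harmCoeff Z l m' s ω ^ 2 +
        -coeffC Γ l 0 * harmCoeff Z l m t ω ^ 2 + -coeffC Γ l 0 * harmCoeff Z l m' s ω ^ 2 +
        coeffC Γ l 0 ^ 2) ∂P :=
        integral_congr_ae (.of_forall fun ω => by simp only [centredPower]; ring)
    _ = _ := by
      rw [integral_add ((j0.fun_add j1).fun_add j2) (integrable_const _),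
        integral_add (j0.fun_add j1) j2, integral_add j0 j1, integral_const_mul,
        integral_const_mul, hZ.integral_harmCoeff_sq hvar hm, hZ.integral_harmCoeff_sq hvar hm',
        key, integral_const, probReal_univ, one_smul]
      ring

end IsIsotropicStationaryGaussian

end Covariances

/-- Lebesgue measure on the time window `(0, T]`. -/
noncomputable abbrev window (T : ℝ) : Measure ℝ := volume.restrict (Set.Ioc 0 T)

lemma window_real_univ {T : ℝ} (hT : 0 ≤ T) : (window T).real Set.univ = T := by
  simp [window, measureReal_def, hT]

lemma card_Icc_neg (l : ℕ) : ((Finset.Icc (-(l : ℤ)) l).card : ℝ) = 2 * l + 1 := by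
  rw [Int.card_Icc]
  have : ((l : ℤ) + 1 - -(l : ℤ)).toNat = 2 * l + 1 := by omega
  rw [this]
  push_cast
  ring

lemma natAbs_le_of_mem {l : ℕ} {m : ℤ} (hm : m ∈ Finset.Icc (-(l : ℤ)) l) : m.natAbs ≤ l := by
  rw [Finset.mem_Icc] at hm
  omega

lemma aeval_hermite_two (x : ℝ) : Polynomial.aeval x (Polynomial.hermite 2) = x ^ 2 - 1 := by
  rw [Polynomial.hermite_succ, Polynomial.hermite_one]
  simp
  ring

/-! ### Time-integrated functionals and the exact correlation -/

section Functionals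

variable {Ω : Type*} [MeasurableSpace Ω] {P : Measure Ω}
  {Z : S2 → ℝ → Ω → ℝ} {Γ : ℝ → ℝ → ℝ}

/-- The time integral of the centred total power of the `l`-th component. -/
noncomputable def totalPower (Γ : ℝ → ℝ → ℝ) (Z : S2 → ℝ → Ω → ℝ) (l : ℕ) (T : ℝ) (ω : Ω) : ℝ :=
  ∫ t, (∑ m ∈ Finset.Icc (-(l : ℤ)) l, centredPower Γ Z l m t ω) ∂(window T)

/-- The time integral of the centred excursion area. -/
noncomputable def totalArea (Z : S2 → ℝ → Ω → ℝ) (u T : ℝ) (ω : Ω) : ℝ :=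
  ∫ t, centredArea Z u t ω ∂(window T)

/-- The double integral of the squared coefficient. -/
noncomputable def sqCoeffIntegral (Γ : ℝ → ℝ → ℝ) (l : ℕ) (T : ℝ) : ℝ :=
  ∫ p : ℝ × ℝ, coeffC Γ l (p.1 - p.2) ^ 2 ∂((window T).prod (window T))

variable [IsProbabilityMeasure P]

namespace IsIsotropicStationaryGaussian

lemma excursionArea_eq (hZ : IsIsotropicStationaryGaussian P Z Γ) (u t : ℝ) (ω : Ω) :
    excursionArea Z u t ω = ∫ x, above u (Z x t ω) ∂area := by
  have hm : Measurable fun x : S2 => Z x t ω :=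
    hZ.measurable.comp (measurable_const.prodMk (measurable_id.prodMk measurable_const))
  have : (fun x : S2 => above u (Z x t ω)) = Set.indicator {x | u ≤ Z x t ω} 1 := by
    ext x
    simp [above, Set.indicator_apply]
  rw [this, integral_indicator_one (measurableSet_le measurable_const hm)]
  rfl

lemma centredArea_eq (hZ : IsIsotropicStationaryGaussian P Z Γ) (u t : ℝ) (ω : Ω) :
    centredArea Z u t ω = excursionArea Z u t ω - 4 * Real.pi * gaussTail u := by
  have hm : Measurable fun x : S2 => above u (Z x t ω) := (measurable_above u).comp
    (hZ.measurable.comp (measurable_const.prodMk (measurable_id.prodMk measurable_const)))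
  rw [centredArea, integral_sub (Integrable.of_bound hm.aestronglyMeasurable 1
    (.of_forall fun x => abs_above_le_one _ _)) (integrable_const _), hZ.excursionArea_eq,
    integral_const, area_real_univ, smul_eq_mul]

lemma integral_excursionArea (hZ : IsIsotropicStationaryGaussian P Z Γ)
    (hvar : ∀ x t, ∫ ω, Z x t ω ^ 2 ∂P = 1) (u t : ℝ) :
    ∫ ω, excursionArea Z u t ω ∂P = 4 * Real.pi * gaussTail u := by
  have h := hZ.integral_centredArea hvar u t
  have hi := ((hZ.isL2Bounded_centredArea u).memLp t).integrable (by norm_num)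
  have e : excursionArea Z u t = fun ω => centredArea Z u t ω + 4 * Real.pi * gaussTail u := by
    ext ω
    rw [hZ.centredArea_eq]
    ring
  rw [e, integral_add hi (integrable_const _), h]
  simp

lemma excursionFunctional_eq (hZ : IsIsotropicStationaryGaussian P Z Γ)
    (hvar : ∀ x t, ∫ ω, Z x t ω ^ 2 ∂P = 1) (u : ℝ) {T : ℝ} (hT : 0 ≤ T) :
    excursionFunctional P Z u T = totalArea Z u T := by
  ext ω
  rw [excursionFunctional, totalArea, intervalIntegral.integral_of_le hT]
  refine integral_congr_ae (.of_forall fun t => ?_)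
  simp only
  rw [hZ.integral_excursionArea hvar, hZ.centredArea_eq]

lemma isL2Bounded_sum_centredPower (hZ : IsIsotropicStationaryGaussian P Z Γ)
    (hvar : ∀ x t, ∫ ω, Z x t ω ^ 2 ∂P = 1) (l : ℕ) : IsL2Bounded P
      (fun t ω => ∑ m ∈ Finset.Icc (-(l : ℤ)) l, centredPower Γ Z l m t ω) :=
  IsL2Bounded.sum _ fun m _ => hZ.isL2Bounded_centredPower hvar l m

lemma memLp_totalArea (hZ : IsIsotropicStationaryGaussian P Z Γ) (u T : ℝ) :
    MemLp (totalArea Z u T) 2 P :=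
  (hZ.isL2Bounded_centredArea u).memLp_integral

lemma memLp_totalPower (hZ : IsIsotropicStationaryGaussian P Z Γ)
    (hvar : ∀ x t, ∫ ω, Z x t ω ^ 2 ∂P = 1) (l : ℕ) (T : ℝ) :
    MemLp (totalPower Γ Z l T) 2 P :=
  (hZ.isL2Bounded_sum_centredPower hvar l).memLp_integral

lemma integral_totalArea (hZ : IsIsotropicStationaryGaussian P Z Γ)
    (hvar : ∀ x t, ∫ ω, Z x t ω ^ 2 ∂P = 1) (u T : ℝ) : ∫ ω, totalArea Z u T ω ∂P = 0 := by
  unfold totalArea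
  rw [(hZ.isL2Bounded_centredArea u).integral_integral]
  simp [hZ.integral_centredArea hvar]

lemma integral_totalPower (hZ : IsIsotropicStationaryGaussian P Z Γ)
    (hvar : ∀ x t, ∫ ω, Z x t ω ^ 2 ∂P = 1) (l : ℕ) (T : ℝ) :
    ∫ ω, totalPower Γ Z l T ω ∂P = 0 := by
  unfold totalPower
  rw [(hZ.isL2Bounded_sum_centredPower hvar l).integral_integral]
  have : ∀ t, ∫ ω, ∑ m ∈ Finset.Icc (-(l : ℤ)) l, centredPower Γ Z l m t ω ∂P = 0 := fun t => by
    rw [integral_finsetSum _ fun m _ =>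
      ((hZ.isL2Bounded_centredPower hvar l m).memLp t).integrable (by norm_num)]
    exact Finset.sum_eq_zero fun m hm => hZ.integral_centredPower hvar (natAbs_le_of_mem hm) t
  simp [this]

/-- The covariance at fixed times does not depend on `m`, so the `2l + 1` orders contribute equally.
-/
lemma covariance_totalArea_totalPower (hZ : IsIsotropicStationaryGaussian P Z Γ)
    (hvar : ∀ x t, ∫ ω, Z x t ω ^ 2 ∂P = 1) (l : ℕ) (u T : ℝ) :
    covariance (totalArea Z u T) (totalPower Γ Z l T) P =
      (2 * l + 1) * (u * gaussianPDFReal 0 1 u) * sqCoeffIntegral Γ l T := by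
  rw [covariance_eq_sub (hZ.memLp_totalArea u T) (hZ.memLp_totalPower hvar l T),
    hZ.integral_totalArea hvar, zero_mul, sub_zero]
  change ∫ ω, (∫ t, centredArea Z u t ω ∂(window T)) * (∫ t, (∑ m ∈ Finset.Icc (-(l : ℤ)) l,
    centredPower Γ Z l m t ω) ∂(window T)) ∂P = _
  rw [(hZ.isL2Bounded_centredArea u).integral_mul_integral
    (hZ.isL2Bounded_sum_centredPower hvar l), sqCoeffIntegral, ← integral_const_mul]
  refine integral_congr_ae (.of_forall fun p => ?_)
  simp only [Finset.mul_sum]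
  rw [integral_finsetSum _ fun m _ =>
    (hZ.isL2Bounded_centredArea u).integrable_mul (hZ.isL2Bounded_centredPower hvar l m) _ _,
    Finset.sum_congr rfl fun m hm =>
      hZ.integral_centredArea_mul_centredPower hvar (natAbs_le_of_mem hm) u p.1 p.2,
    Finset.sum_const, nsmul_eq_mul, card_Icc_neg]
  ring

lemma variance_totalPower (hZ : IsIsotropicStationaryGaussian P Z Γ)
    (hvar : ∀ x t, ∫ ω, Z x t ω ^ 2 ∂P = 1) (l : ℕ) (T : ℝ) :
    variance (totalPower Γ Z l T) P = 2 * (2 * l + 1) * sqCoeffIntegral Γ l T := by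
  have hL := hZ.isL2Bounded_sum_centredPower hvar l
  rw [variance_of_integral_eq_zero (hZ.memLp_totalPower hvar l T).aestronglyMeasurable.aemeasurable
    (hZ.integral_totalPower hvar l T)]
  simp_rw [sq, totalPower]
  rw [hL.integral_mul_integral hL, sqCoeffIntegral, ← integral_const_mul]
  refine integral_congr_ae (.of_forall fun p => ?_)
  simp only [Finset.sum_mul_sum]
  have hi (m n : ℤ) := (hZ.isL2Bounded_centredPower hvar l m).integrable_mul
    (hZ.isL2Bounded_centredPower hvar l n) p.1 p.2
  rw [integral_finsetSum _ fun m _ => integrable_finsetSum _ fun n _ => hi m n]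
  have : ∀ m ∈ Finset.Icc (-(l : ℤ)) l, ∫ ω, ∑ n ∈ Finset.Icc (-(l : ℤ)) l,
      centredPower Γ Z l m p.1 ω * centredPower Γ Z l n p.2 ω ∂P =
      2 * coeffC Γ l (p.1 - p.2) ^ 2 := fun m hm => by
    rw [integral_finsetSum _ fun n _ => hi m n, Finset.sum_congr rfl fun n hn =>
      hZ.integral_centredPower_mul_centredPower hvar (natAbs_le_of_mem hm) (natAbs_le_of_mem hn)
        p.1 p.2]
    simp [hm]
  rw [Finset.sum_congr rfl this, Finset.sum_const, nsmul_eq_mul, card_Icc_neg]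
  ring

lemma variance_totalArea (hZ : IsIsotropicStationaryGaussian P Z Γ)
    (hvar : ∀ x t, ∫ ω, Z x t ω ^ 2 ∂P = 1) (u T : ℝ) :
    variance (totalArea Z u T) P = ∫ p : ℝ × ℝ,
      (∫ ω, centredArea Z u p.1 ω * centredArea Z u p.2 ω ∂P) ∂((window T).prod (window T)) := by
  have hL := hZ.isL2Bounded_centredArea u
  rw [variance_of_integral_eq_zero (hZ.memLp_totalArea u T).aestronglyMeasurable.aemeasurable
    (hZ.integral_totalArea hvar u T)]
  simp_rw [sq, totalArea]
  rw [hL.integral_mul_integral hL]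

lemma sigma_sq (hZ : IsIsotropicStationaryGaussian P Z Γ)
    (hvar : ∀ x t, ∫ ω, Z x t ω ^ 2 ∂P = 1) (l : ℕ) :
    sigma Γ l ^ 2 = (2 * (l : ℝ) + 1) / (4 * Real.pi) * coeffC Γ l 0 :=
  Real.sq_sqrt (mul_nonneg (by positivity) (hZ.coeffC_zero_nonneg hvar l))

/-- By orthonormality the spatial integral of `Z_l²` is `∑ₘ a_{l,m}²`, and `4π σ_l² = (2l+1) C_l(0)`
matches the constant of `H₂` with the centring. The exceptional null set consists of paths whose
coefficients fail to be square integrable over the window. -/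
lemma integral_hermite_monoField (hZ : IsIsotropicStationaryGaussian P Z Γ)
    (hvar : ∀ x t, ∫ ω, Z x t ω ^ 2 ∂P = 1) {l : ℕ} (hl : coeffC Γ l 0 ≠ 0) {T : ℝ} (hT : 0 ≤ T) :
    ∀ᵐ ω ∂P, ∫ x, (∫ t in (0 : ℝ)..T,
      Polynomial.aeval (monoField Z l x t ω / sigma Γ l) (Polynomial.hermite 2)) ∂area =
      totalPower Γ Z l T ω / sigma Γ l ^ 2 := by
  have hσ : sigma Γ l ^ 2 ≠ 0 := by
    rw [hZ.sigma_sq hvar]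
    have := Real.pi_pos
    positivity
  have hae : ∀ᵐ ω ∂P, ∀ m ∈ Finset.Icc (-(l : ℤ)) l,
      Integrable (fun t => harmCoeff Z l m t ω ^ 2) (window T) := by
    rw [eventually_all_finset]
    intro m _
    exact ((hZ.isL2Bounded_harmCoeff_sq hvar l m).integrable_prod (μ := window T)).prod_right_ae
  filter_upwards [hae] with ω hω
  have hmeas (m : ℤ) : Measurable fun t => harmCoeff Z l m t ω :=
    (hZ.isL2Bounded_harmCoeff hvar l m).measurable.comp (measurable_const.prodMk measurable_id)
  have hL (m : ℤ) (hm : m ∈ Finset.Icc (-(l : ℤ)) l) :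
      MemLp (fun t => harmCoeff Z l m t ω) 2 (window T) :=
    (memLp_two_iff_integrable_sq (hmeas m).aestronglyMeasurable).2 (hω m hm)
  have hprod (m n : ℤ) (hm : m ∈ Finset.Icc (-(l : ℤ)) l) (hn : n ∈ Finset.Icc (-(l : ℤ)) l) :
      Integrable (fun t => harmCoeff Z l m t ω * harmCoeff Z l n t ω) (window T) :=
    (hL m hm).integrable_mul (hL n hn)
  set A : ℤ → ℤ → ℝ := fun m n => ∫ t, harmCoeff Z l m t ω * harmCoeff Z l n t ω ∂(window T)
    with hA
  have hin (x : S2) : ∫ t in (0 : ℝ)..T,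
      Polynomial.aeval (monoField Z l x t ω / sigma Γ l) (Polynomial.hermite 2) =
      ∑ m ∈ Finset.Icc (-(l : ℤ)) l, ∑ n ∈ Finset.Icc (-(l : ℤ)) l,
        A m n / sigma Γ l ^ 2 * (sphHarm l m x * sphHarm l n x) + -T := by
    have hi : ∀ m ∈ Finset.Icc (-(l : ℤ)) l, ∀ n ∈ Finset.Icc (-(l : ℤ)) l,
        Integrable (fun t => (harmCoeff Z l m t ω * harmCoeff Z l n t ω) *
          ((sphHarm l m x * sphHarm l n x) / sigma Γ l ^ 2)) (window T) := fun m hm n hn =>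
      (hprod m n hm hn).mul_const _
    rw [intervalIntegral.integral_of_le hT]
    calc _ = ∫ t, (∑ m ∈ Finset.Icc (-(l : ℤ)) l, ∑ n ∈ Finset.Icc (-(l : ℤ)) l,
          (harmCoeff Z l m t ω * harmCoeff Z l n t ω) *
          ((sphHarm l m x * sphHarm l n x) / sigma Γ l ^ 2) + -1) ∂(window T) := by
          refine integral_congr_ae (.of_forall fun t => ?_)
          simp only
          rw [aeval_hermite_two, div_pow, monoField, sq, Finset.sum_mul_sum, Finset.sum_div,
            sub_eq_add_neg]
          congr 1
          refine Finset.sum_congr rfl fun m _ => ?_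
          rw [Finset.sum_div]
          exact Finset.sum_congr rfl fun n _ => by ring
      _ = _ := by
          rw [integral_add (integrable_finsetSum _ fun m hm => integrable_finsetSum _ (hi m hm))
            (integrable_const _), integral_const, window_real_univ hT,
            integral_finsetSum _ fun m hm => integrable_finsetSum _ (hi m hm)]
          congr 1
          · refine Finset.sum_congr rfl fun m hm => ?_
            rw [integral_finsetSum _ (hi m hm)]
            refine Finset.sum_congr rfl fun n _ => ?_
            rw [integral_mul_const]
            ring
          · simp
  have hY (m n : ℤ) : Integrable (fun x => A m n / sigma Γ l ^ 2 * (sphHarm l m x * sphHarm l n x))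
      area := integrable_of_continuous
    (continuous_const.mul ((continuous_sphHarm l m).mul (continuous_sphHarm l n)))
  simp_rw [hin]
  rw [integral_add (integrable_finsetSum _ fun m _ => integrable_finsetSum _ fun n _ => hY m n)
    (integrable_const _), integral_finsetSum _ fun m _ => integrable_finsetSum _ fun n _ => hY m n,
    integral_const, area_real_univ, smul_eq_mul]
  have h1 : ∀ m ∈ Finset.Icc (-(l : ℤ)) l, ∫ x, ∑ n ∈ Finset.Icc (-(l : ℤ)) l,
      A m n / sigma Γ l ^ 2 * (sphHarm l m x * sphHarm l n x) ∂area =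
      A m m / sigma Γ l ^ 2 := fun m hm => by
    rw [integral_finsetSum _ fun n _ => hY m n]
    have : ∀ n ∈ Finset.Icc (-(l : ℤ)) l,
        ∫ x, A m n / sigma Γ l ^ 2 * (sphHarm l m x * sphHarm l n x) ∂area =
        if m = n then A m n / sigma Γ l ^ 2 else 0 := fun n hn => by
      rw [integral_const_mul, integral_sphHarm_mul_sphHarm (natAbs_le_of_mem hm)
        (natAbs_le_of_mem hn)]
      simp
    rw [Finset.sum_congr rfl this]
    simp [hm]
  have h2 : totalPower Γ Z l T ω = ∑ m ∈ Finset.Icc (-(l : ℤ)) l, A m m -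
      (2 * l + 1) * coeffC Γ l 0 * T := by
    unfold totalPower centredPower
    have hs : ∀ m ∈ Finset.Icc (-(l : ℤ)) l,
        Integrable (fun t => harmCoeff Z l m t ω ^ 2 - coeffC Γ l 0) (window T) := fun m hm =>
      (hω m hm).sub (integrable_const _)
    rw [integral_finsetSum _ hs]
    have : ∀ m ∈ Finset.Icc (-(l : ℤ)) l, ∫ t, (harmCoeff Z l m t ω ^ 2 - coeffC Γ l 0)
        ∂(window T) = A m m - coeffC Γ l 0 * T := fun m hm => by
      rw [integral_sub (hω m hm) (integrable_const _), integral_const, window_real_univ hT,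
        smul_eq_mul, mul_comm T, hA]
      simp only [sq]
    rw [Finset.sum_congr rfl this, Finset.sum_sub_distrib, Finset.sum_const, nsmul_eq_mul,
      card_Icc_neg]
    ring
  rw [Finset.sum_congr rfl h1, ← Finset.sum_div, h2, sub_div]
  have h3 : (2 * (l : ℝ) + 1) * coeffC Γ l 0 = 4 * Real.pi * sigma Γ l ^ 2 := by
    rw [hZ.sigma_sq hvar]
    field_simp
  rw [h3, mul_right_comm _ _ T, mul_div_cancel_right₀ _ hσ]
  ring

/-- The monochromatic functional is almost surely `κ` times the power, and `|κ|` cancels in the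
correlation. Substituting the exact covariance and variance leaves one factor `J_T` against the
variance of the excursion functional. -/
lemma corr_eq (hZ : IsIsotropicStationaryGaussian P Z Γ)
    (hvar : ∀ x t, ∫ ω, Z x t ω ^ 2 ∂P = 1) {l : ℕ} (hl : coeffC Γ l 0 ≠ 0) {T : ℝ} (hT : 0 ≤ T)
    {u : ℝ} (hu : u ≠ 0) :
    corr P (excursionFunctional P Z u T) (monoFunctional Z Γ l u T) =
      √((u ^ 2 * gaussianPDFReal 0 1 u ^ 2 / 2 * (2 * l + 1)) * sqCoeffIntegral Γ l T /
        ∫ p : ℝ × ℝ, (∫ ω, centredArea Z u p.1 ω * centredArea Z u p.2 ω ∂P)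
          ∂((window T).prod (window T))) := by
  have hσ2 : 0 < sigma Γ l ^ 2 := by
    rw [hZ.sigma_sq hvar]
    have := (hZ.coeffC_zero_nonneg hvar l).lt_of_ne' hl
    positivity
  have hσ : 0 < sigma Γ l := (Real.sqrt_nonneg _).lt_of_ne' fun h => by
    rw [sigma, h] at hσ2
    simp at hσ2
  set κ : ℝ := u / (2 * sigma Γ l) * gaussianPDFReal 0 1 (u / sigma Γ l) / sigma Γ l ^ 2 with hκ
  have hmono : monoFunctional Z Γ l u T =ᵐ[P] fun ω => κ * totalPower Γ Z l T ω := by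
    filter_upwards [hZ.integral_hermite_monoField hvar hl hT] with ω hω
    rw [monoFunctional, hω, hκ]
    ring
  -- The sign of `κ` is that of `u`, and the covariance carries another factor `u`; so the
  -- correlation is nonnegative for both signs of `u` and equals the square root of its square.
  have hκu : 0 < κ * u := by
    have h1 := gaussianPDFReal_pos 0 1 (u / sigma Γ l) one_ne_zero
    have h2 : 0 < u ^ 2 := by positivity
    rw [hκ, show u / (2 * sigma Γ l) * gaussianPDFReal 0 1 (u / sigma Γ l) / sigma Γ l ^ 2 * u =
      u ^ 2 * (1 / (2 * sigma Γ l) * gaussianPDFReal 0 1 (u / sigma Γ l) / sigma Γ l ^ 2) by ring]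
    positivity
  have hκ0 : κ ≠ 0 := fun h => by simp [h] at hκu
  have hJ : 0 ≤ sqCoeffIntegral Γ l T := integral_nonneg fun _ => sq_nonneg _
  have hφ := gaussianPDFReal_nonneg 0 1 u
  have hX : 0 ≤ κ * ((2 * l + 1) * (u * gaussianPDFReal 0 1 u) * sqCoeffIntegral Γ l T) := by
    rw [show κ * ((2 * l + 1) * (u * gaussianPDFReal 0 1 u) * sqCoeffIntegral Γ l T) =
      (κ * u) * ((2 * l + 1) * gaussianPDFReal 0 1 u * sqCoeffIntegral Γ l T) by ring]
    positivity
  have hcov : covariance (totalArea Z u T) (monoFunctional Z Γ l u T) P =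
      covariance (totalArea Z u T) (fun ω => κ * totalPower Γ Z l T ω) P := by
    rw [covariance, covariance, integral_congr_ae hmono]
    refine integral_congr_ae ?_
    filter_upwards [hmono] with ω hω
    rw [hω]
  rw [corr, hZ.excursionFunctional_eq hvar u hT, variance_congr hmono, hcov, covariance_const_mul_right, variance_const_mul,
    hZ.covariance_totalArea_totalPower hvar, hZ.variance_totalPower hvar,
    hZ.variance_totalArea hvar, ← Real.sqrt_sq hX, ← Real.sqrt_div (sq_nonneg _)]
  congr 1
  generalize (∫ p : ℝ × ℝ, (∫ ω, centredArea Z u p.1 ω * centredArea Z u p.2 ω ∂P)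
          ∂((window T).prod (window T))) = V
  -- When either variance vanishes, both sides are `0` by the convention on division by zero.
  rcases eq_or_ne (sqCoeffIntegral Γ l T) 0 with h | h
  · simp [h]
  rcases eq_or_ne V 0 with h0 | h0
  · simp [h0]
  field_simp

end IsIsotropicStationaryGaussian

end Functionals

/-! ### Expansion of the covariance of excursion areas -/

lemma integral_prod_comp_inner {f : ℝ → ℝ} (hf : ContinuousOn f (Set.Icc (-1) 1)) :
    ∫ p : S2 × S2, f (inner ℝ p.1.1 p.2.1) ∂(area.prod area) =
      8 * Real.pi ^ 2 * ∫ θ in (-1 : ℝ)..1, f θ := by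
  have hc : Continuous fun p : S2 × S2 => f (inner ℝ p.1.1 p.2.1) :=
    hf.comp_continuous (by fun_prop) fun p => inner_mem_Icc p.1 p.2
  rw [integral_prod _ (hc.integrable_of_hasCompactSupport (HasCompactSupport.of_compactSpace _))]
  simp_rw [integral_comp_inner hf]
  rw [integral_const, area_real_univ, smul_eq_mul]
  ring

lemma integral_eq_coeffC_zero (Γ : ℝ → ℝ → ℝ) (τ : ℝ) :
    8 * Real.pi ^ 2 * ∫ θ in (-1 : ℝ)..1, Γ θ τ = 4 * Real.pi * coeffC Γ 0 τ := by
  simp [coeffC, legendre]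
  ring

section AreaCovariance

variable {Ω : Type*} [MeasurableSpace Ω] {P : Measure Ω} [IsProbabilityMeasure P]
  {Z : S2 → ℝ → Ω → ℝ} {Γ : ℝ → ℝ → ℝ}

namespace IsIsotropicStationaryGaussian

/-- The pointwise expansion in the correlation `Γ(⟨x,y⟩, t-s)`, with its uniform constant, is
integrated over pairs of points; by Archimedes' theorem each term becomes an integral over `θ`, the
linear one being a multiple of `C_0`. -/
lemma exists_centredArea_expansion (hZ : IsIsotropicStationaryGaussian P Z Γ)
    (hvar : ∀ x t, ∫ ω, Z x t ω ^ 2 ∂P = 1) (u : ℝ) {ε : ℝ} (hε : 0 < ε) : ∃ C : ℝ, 0 ≤ C ∧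
    ∀ t s, |∫ ω, centredArea Z u t ω * centredArea Z u s ω ∂P -
      gaussianPDFReal 0 1 u ^ 2 * (4 * Real.pi * coeffC Γ 0 (t - s)) -
      u ^ 2 * gaussianPDFReal 0 1 u ^ 2 / 2 *
        (8 * Real.pi ^ 2 * ∫ θ in (-1 : ℝ)..1, Γ θ (t - s) ^ 2)| ≤
      ε * (8 * Real.pi ^ 2 * ∫ θ in (-1 : ℝ)..1, Γ θ (t - s) ^ 2) +
      C * (8 * Real.pi ^ 2 * ∫ θ in (-1 : ℝ)..1, |Γ θ (t - s)| ^ 3) := by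
  obtain ⟨C, hC, h⟩ := exists_above_mul_above_expansion u hε
  refine ⟨C, hC, fun t s => ?_⟩
  have hL (r : ℝ) := (hZ.isL2Bounded_above u).comp (f := fun x : S2 => (x, r)) (by fun_prop)
  have hΓ := hZ.continuousOn_left (t - s)
  have hΓ2 : ContinuousOn (fun θ => Γ θ (t - s) ^ 2) (Set.Icc (-1) 1) := hΓ.pow 2
  have hΓ3 : ContinuousOn (fun θ => |Γ θ (t - s)| ^ 3) (Set.Icc (-1) 1) := hΓ.abs.pow 3
  have hcc : ∀ {f : ℝ → ℝ}, ContinuousOn f (Set.Icc (-1) 1) →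
      Integrable (fun p : S2 × S2 => f (inner ℝ p.1.1 p.2.1)) (area.prod area) := fun hf =>
    (hf.comp_continuous (by fun_prop) fun p : S2 × S2 =>
      inner_mem_Icc p.1 p.2).integrable_of_hasCompactSupport (HasCompactSupport.of_compactSpace _)
  have i0 := (hL t).integrable_integral_mul (hL s) (μ := area) (ν := area)
  have i1 := (hcc hΓ).const_mul (-gaussianPDFReal 0 1 u ^ 2)
  have i2 := (hcc hΓ2).const_mul (-(u ^ 2 * gaussianPDFReal 0 1 u ^ 2 / 2))
  have i3 := (hcc hΓ2).const_mul ε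
  have i4 := (hcc hΓ3).const_mul C
  rw [← integral_eq_coeffC_zero, ← integral_prod_comp_inner hΓ, ← integral_prod_comp_inner hΓ2,
    ← integral_prod_comp_inner hΓ3]
  unfold centredArea
  rw [(hL t).integral_mul_integral (hL s), sub_eq_add_neg, sub_eq_add_neg, ← neg_mul, ← neg_mul,
    ← integral_const_mul, ← integral_const_mul, ← integral_const_mul, ← integral_const_mul,
    ← integral_add i0 i1, ← integral_add (i0.fun_add i1) i2, ← integral_add i3 i4]
  refine (abs_integral_le_integral_abs).trans (integral_mono ((i0.fun_add i1).fun_add i2).abs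
    (i3.fun_add i4) fun p => ?_)
  have hr : |∫ ω, Z p.1 t ω * Z p.2 s ω ∂P| ≤ 1 := hZ.abs_integral_mul_le_one hvar _ _ _ _
  rw [hZ.covariance_eq] at hr
  have hp := h (hZ.hasGaussianLaw_prodMk p.1 p.2 t s) (hZ.centered _ _) (hZ.centered _ _)
    (hvar _ _) (hvar _ _) (hZ.covariance_eq p.1 p.2 t s) hr
  have hm : ∫ ω, (above u (Z p.1 t ω) - gaussTail u) * (above u (Z p.2 s ω) - gaussTail u) ∂P =
      ∫ ω, above u (Z p.1 t ω) * above u (Z p.2 s ω) ∂P - gaussTail u ^ 2 := by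
    have j1 := (hZ.integrable_above u p.1 t)
    have j2 := (hZ.integrable_above u p.2 s).const_mul (-gaussTail u)
    have j3 : Integrable (fun ω => above u (Z p.1 t ω) * above u (Z p.2 s ω)) P :=
      (hZ.integrable_above u p.2 s).bdd_mul j1.aestronglyMeasurable
        (.of_forall fun ω => abs_above_le_one _ _)
    have j4 := j1.const_mul (-gaussTail u)
    calc _ = ∫ ω, (above u (Z p.1 t ω) * above u (Z p.2 s ω) + -gaussTail u * above u (Z p.1 t ω) +
          -gaussTail u * above u (Z p.2 s ω) + gaussTail u ^ 2) ∂P :=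
          integral_congr_ae (.of_forall fun ω => by ring)
      _ = _ := by
          rw [integral_add ((j3.fun_add j4).fun_add j2) (integrable_const _),
            integral_add (j3.fun_add j4) j2, integral_add j3 j4, integral_const_mul,
            integral_const_mul, hZ.integral_above hvar, hZ.integral_above hvar, integral_const,
            probReal_univ, one_smul]
          ring
  simp only [hm]
  refine le_trans (le_of_eq ?_) hp
  congr 1
  ring

lemma integrable_integral_centredArea (hZ : IsIsotropicStationaryGaussian P Z Γ) (u : ℝ) (T : ℝ) :
    Integrable (fun p : ℝ × ℝ => ∫ ω, centredArea Z u p.1 ω * centredArea Z u p.2 ω ∂P)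
      ((window T).prod (window T)) :=
  (hZ.isL2Bounded_centredArea u).integrable_integral_mul (hZ.isL2Bounded_centredArea u)

end IsIsotropicStationaryGaussian

end AreaCovariance

/-! ### Double integrals of slowly decaying kernels -/

section LongMemory

/-- The reference kernel `(1 + |τ|) ^ (-a)`. -/
noncomputable def powerKernel (a τ : ℝ) : ℝ := (1 + |τ|) ^ (-a)

lemma powerKernel_pos (a τ : ℝ) : 0 < powerKernel a τ :=
  Real.rpow_pos_of_pos (by positivity) _

lemma powerKernel_le_one {a : ℝ} (ha : 0 ≤ a) (τ : ℝ) : powerKernel a τ ≤ 1 :=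
  Real.rpow_le_one_of_one_le_of_nonpos (by linarith [abs_nonneg τ]) (by linarith)

lemma continuous_powerKernel (a : ℝ) : Continuous (powerKernel a) :=
  (by fun_prop : Continuous fun τ : ℝ => 1 + |τ|).rpow_const fun τ => Or.inl (by positivity)

/-- The double integral of the reference kernel. -/
noncomputable def powerKernelIntegral (a T : ℝ) : ℝ :=
  ∫ p : ℝ × ℝ, powerKernel a (p.1 - p.2) ∂((window T).prod (window T))

lemma integrable_powerKernel {a : ℝ} (ha : 0 ≤ a) (T : ℝ) :
    Integrable (fun p : ℝ × ℝ => powerKernel a (p.1 - p.2)) ((window T).prod (window T)) :=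
  Integrable.of_bound ((continuous_powerKernel a).comp
    (continuous_fst.sub continuous_snd)).aestronglyMeasurable 1 (.of_forall fun p => by
      rw [Real.norm_of_nonneg (powerKernel_pos a _).le]
      exact powerKernel_le_one ha _)

lemma ae_window_prod (T : ℝ) : ∀ᵐ p : ℝ × ℝ ∂((window T).prod (window T)), |p.1 - p.2| ≤ T := by
  rw [Measure.prod_restrict]
  filter_upwards [ae_restrict_mem (measurableSet_Ioc.prod measurableSet_Ioc)] with p hp
  obtain ⟨⟨h1, h2⟩, h3, h4⟩ := hp
  exact abs_le.2 ⟨by linarith, by linarith⟩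

lemma window_prod_real_univ {T : ℝ} (hT : 0 ≤ T) :
    ((window T).prod (window T)).real Set.univ = T ^ 2 := by
  rw [← Set.univ_prod_univ, measureReal_prod_prod, window_real_univ hT, sq]

/-- The lag never exceeds `T` on the window and the kernel decreases in it. This crude bound has the
order `T^(2-a)`, which is enough to beat terms of order `T` when `a < 1`. -/
lemma le_powerKernelIntegral {a : ℝ} (ha : 0 ≤ a) {T : ℝ} (hT : 0 ≤ T) :
    T ^ 2 * (1 + T) ^ (-a) ≤ powerKernelIntegral a T := by
  rw [← window_prod_real_univ hT, ← smul_eq_mul, ← integral_const]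
  refine integral_mono_ae (integrable_const _) (integrable_powerKernel ha T) ?_
  filter_upwards [ae_window_prod T] with p hp
  exact Real.rpow_le_rpow_of_nonpos (by positivity) (by linarith) (by linarith)

lemma measureReal_near_diagonal_le {T τ : ℝ} (hT : 0 ≤ T) (hτ : 0 ≤ τ) :
    ((window T).prod (window T)).real {p | |p.1 - p.2| ≤ τ} ≤ 2 * τ * T := by
  have hm : MeasurableSet {p : ℝ × ℝ | |p.1 - p.2| ≤ τ} :=
    (isClosed_le (by fun_prop) continuous_const).measurableSet
  rw [measureReal_def, Measure.prod_apply hm]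
  refine ENNReal.toReal_le_of_le_ofReal (by positivity) ?_
  calc _ ≤ ∫⁻ _, ENNReal.ofReal (2 * τ) ∂(window T) := by
        refine lintegral_mono fun x => ?_
        refine (Measure.restrict_apply_le _ _).trans ((measure_mono (t := Set.Icc (x - τ) (x + τ))
          fun y hy => ?_).trans ?_)
        · have := abs_le.1 (show |x - y| ≤ τ from hy)
          exact ⟨by linarith, by linarith⟩
        · rw [Real.volume_Icc]
          exact ENNReal.ofReal_le_ofReal (by linarith)
    _ = ENNReal.ofReal (2 * τ * T) := by
        rw [lintegral_const, ← ofReal_measureReal (measure_ne_top _ _), window_real_univ hT,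
          ← ENNReal.ofReal_mul (by positivity)]

lemma tendsto_one_add_rpow_div {a : ℝ} (ha : 0 ≤ a) (ha1 : a < 1) :
    Tendsto (fun T : ℝ => (1 + T) ^ a / T) atTop (𝓝 0) := by
  have h := (tendsto_rpow_neg_atTop (show 0 < 1 - a by linarith)).const_mul ((2 : ℝ) ^ a)
  rw [mul_zero] at h
  refine squeeze_zero' ?_ ?_ h
  · filter_upwards [eventually_ge_atTop 0] with T hT
    positivity
  · filter_upwards [eventually_ge_atTop 1] with T hT
    have hT0 : 0 < T := by linarith
    rw [div_le_iff₀ hT0, mul_assoc, neg_sub, Real.rpow_sub_one hT0.ne', div_mul_cancel₀ _ hT0.ne',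
      ← Real.mul_rpow (by norm_num) hT0.le]
    exact Real.rpow_le_rpow (by positivity) (by linarith) ha

/-- A bounded kernel that is asymptotic to `L` times the reference kernel away from the diagonal has
a double integral asymptotic to `L` times that of the reference kernel. -/
lemma tendsto_integral_div_powerKernelIntegral {a : ℝ} (ha : 0 ≤ a) (ha1 : a < 1)
    {V : ℝ × ℝ → ℝ} {L M : ℝ} (hV : ∀ T, Integrable V ((window T).prod (window T)))
    (hM : ∀ p, |V p| ≤ M)
    (hlim : ∀ ε > 0, ∃ τ, 0 ≤ τ ∧ ∀ p : ℝ × ℝ, τ ≤ |p.1 - p.2| →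
      |V p - L * powerKernel a (p.1 - p.2)| ≤ ε * powerKernel a (p.1 - p.2)) :
    Tendsto (fun T => (∫ p, V p ∂((window T).prod (window T))) / powerKernelIntegral a T) atTop
      (𝓝 L) := by
  rw [Metric.tendsto_atTop']
  intro ε hε
  obtain ⟨τ, hτ, hlim⟩ := hlim (ε / 2) (by positivity)
  have hM0 : 0 ≤ M := (abs_nonneg _).trans (hM (0, 0))
  -- Lags below `τ` occupy a strip of area at most `2 τ T`, on which the integrand is at most `M +
  -- |L|`; so they contribute at most `K T`.
  set K := (M + |L|) * (2 * τ) with hK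
  have hK0 : 0 ≤ K := by positivity
  have ht := (tendsto_one_add_rpow_div ha ha1).const_mul K
  rw [mul_zero] at ht
  obtain ⟨T0, hT0⟩ := (((ht.eventually_lt_const (show 0 < ε / 2 by positivity))).and
    (eventually_gt_atTop 0)).exists_forall_of_atTop
  refine ⟨T0, fun T hT => ?_⟩
  obtain ⟨hT1, hT⟩ := hT0 T hT.le
  have hlow := le_powerKernelIntegral ha hT.le
  have hlow0 : 0 < T ^ 2 * (1 + T) ^ (-a) := by positivity
  have hH := hlow0.trans_le hlow
  set S : Set (ℝ × ℝ) := {p | |p.1 - p.2| ≤ τ} with hS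
  have hSm : MeasurableSet S := (isClosed_le (by fun_prop) continuous_const).measurableSet
  have hk := integrable_powerKernel ha T
  have hbound : |(∫ p, V p ∂((window T).prod (window T))) - L * powerKernelIntegral a T| ≤
      ε / 2 * powerKernelIntegral a T + K * T := by
    rw [powerKernelIntegral, ← integral_const_mul, ← integral_sub (hV T) (hk.const_mul L)]
    have hi : Integrable (fun p : ℝ × ℝ => S.indicator (fun _ => M + |L|) p)
        ((window T).prod (window T)) := (integrable_const _).indicator hSm
    calc _ ≤ ∫ p, |V p - L * powerKernel a (p.1 - p.2)| ∂((window T).prod (window T)) :=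
          abs_integral_le_integral_abs
      _ ≤ ∫ p, (ε / 2 * powerKernel a (p.1 - p.2) + S.indicator (fun _ => M + |L|) p)
          ∂((window T).prod (window T)) := by
          refine integral_mono ((hV T).sub (hk.const_mul L)).abs ((hk.const_mul _).fun_add hi)
            fun p => ?_
          have hp0 := powerKernel_pos a (p.1 - p.2)
          by_cases hp : p ∈ S
          · simp only [Set.indicator_of_mem hp]
            have h1 : |V p - L * powerKernel a (p.1 - p.2)| ≤ M + |L| := by
              refine (abs_sub _ _).trans (add_le_add (hM p) ?_)
              rw [abs_mul, abs_of_pos hp0]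
              exact mul_le_of_le_one_right (abs_nonneg L) (powerKernel_le_one ha _)
            have : 0 ≤ ε / 2 * powerKernel a (p.1 - p.2) := by positivity
            linarith
          · simp only [Set.indicator_of_notMem hp, add_zero]
            exact hlim p (not_le.1 hp).le
      _ ≤ _ := by
          rw [integral_add (hk.const_mul _) hi, integral_const_mul, integral_indicator_const _ hSm,
            smul_eq_mul]
          have := measureReal_near_diagonal_le hT.le hτ
          have h2 := mul_le_mul_of_nonneg_right this (show 0 ≤ M + |L| by positivity)
          rw [hK]
          linarith
  rw [Real.dist_eq, div_sub' hH.ne', abs_div, abs_of_pos hH, div_lt_iff₀ hH]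
  rw [mul_comm (powerKernelIntegral a T) L]
  have h3 : K * T < ε / 2 * powerKernelIntegral a T := by
    refine lt_of_lt_of_le ?_ (mul_le_mul_of_nonneg_left hlow (by positivity))
    have : K * T = K * ((1 + T) ^ a / T) * (T ^ 2 * (1 + T) ^ (-a)) := by
      rw [Real.rpow_neg (by positivity)]
      field_simp
    rw [this]
    exact mul_lt_mul_of_pos_right hT1 hlow0
  linarith

end LongMemory

lemma powerKernel_sq (b τ : ℝ) : powerKernel b τ ^ 2 = powerKernel (2 * b) τ := by
  rw [powerKernel, powerKernel, ← Real.rpow_natCast, ← Real.rpow_mul (by positivity)]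
  congr 1
  push_cast
  ring

lemma powerKernel_anti {a b : ℝ} (h : a ≤ b) (τ : ℝ) : powerKernel b τ ≤ powerKernel a τ :=
  Real.rpow_le_rpow_of_exponent_le (by linarith [abs_nonneg τ]) (by linarith)

lemma powerKernel_div (a b τ : ℝ) : powerKernel a τ / powerKernel b τ = powerKernel (a - b) τ := by
  rw [powerKernel, powerKernel, powerKernel, ← Real.rpow_sub (by positivity)]
  congr 1
  ring

lemma tendsto_powerKernel {a : ℝ} (ha : 0 < a) : Tendsto (powerKernel a) atTop (𝓝 0) :=
  (tendsto_rpow_neg_atTop ha).comp (tendsto_atTop_add_const_left _ 1 tendsto_abs_atTop_atTop)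

lemma memoryKernel_le {α β : ℝ} (hα : 2 ≤ α) (τ : ℝ) : memoryKernel α β τ ≤ powerKernel β τ := by
  unfold memoryKernel
  split_ifs with h
  · subst h
    exact powerKernel_anti (show (1 : ℝ) ≤ α by linarith) τ
  · exact le_rfl

lemma memoryKernel_nonneg (α β τ : ℝ) : 0 ≤ memoryKernel α β τ := by
  unfold memoryKernel
  split_ifs <;> positivity

/-! ### Asymptotics of the coefficients under the memory condition -/

section Coefficients

variable {Γ : ℝ → ℝ → ℝ} {α : ℝ} {β : ℕ → ℝ}

/-- Uniform convergence of `G_ℓ / C_ℓ(0)` to `1` makes the ratio at most `2` in absolute value for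
all active multipoles at once. For `β_ℓ = 1` the kernel with exponent `α` is below the one with
exponent `1`, so one form of bound covers both cases. -/
lemma MemoryCondition.eventually_abs_coeffC_le (hmem : MemoryCondition Γ α β)
    (h0 : ∀ l, 0 ≤ coeffC Γ l 0) : ∀ᶠ τ in atTop, ∀ l ∈ activeMultipoles Γ,
      |coeffC Γ l τ| ≤ 2 * coeffC Γ l 0 * powerKernel (β l) τ := by
  obtain ⟨G, hG, hlim⟩ := hmem.exists_factor
  filter_upwards [Metric.tendstoUniformlyOn_iff.1 hlim 1 one_pos] with τ hτ l hl
  have hC : 0 < coeffC Γ l 0 := (h0 l).lt_of_ne' hl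
  have h := hτ l hl
  rw [dist_comm, Real.dist_eq] at h
  have h2 : |G l τ| ≤ 2 * coeffC Γ l 0 := by
    have h3 : |G l τ / coeffC Γ l 0| ≤ 2 := by
      rw [abs_lt] at h
      exact abs_le.2 ⟨by linarith, by linarith⟩
    rwa [abs_div, abs_of_pos hC, div_le_iff₀ hC] at h3
  rw [hG l hl, abs_mul, abs_of_nonneg (memoryKernel_nonneg _ _ _)]
  exact mul_le_mul h2 (memoryKernel_le hmem.two_le_alpha τ) (memoryKernel_nonneg _ _ _)
    (by positivity)

lemma MemoryCondition.tendsto_coeffC_div (hmem : MemoryCondition Γ α β) {l : ℕ}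
    (hl : l ∈ activeMultipoles Γ) (hβ : β l ≠ 1) :
    Tendsto (fun τ => coeffC Γ l τ / powerKernel (β l) τ) atTop (𝓝 (coeffC Γ l 0)) := by
  obtain ⟨G, hG, hlim⟩ := hmem.exists_factor
  have h := (hlim.tendsto_at hl).mul_const (coeffC Γ l 0)
  rw [one_mul] at h
  refine h.congr fun τ => ?_
  rw [div_mul_cancel₀ _ hl, hG l hl, memoryKernel, if_neg hβ]
  exact (mul_div_cancel_right₀ _ (powerKernel_pos _ _).ne').symm

/-- The standing conditions on the exponents. -/
structure IsDominant (Γ : ℝ → ℝ → ℝ) (α : ℝ) (β : ℕ → ℝ) (l : ℕ) : Prop where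
  memory : MemoryCondition Γ α β
  mem : l ∈ activeMultipoles Γ
  lt_of_ne : ∀ k ∈ activeMultipoles Γ, k ≠ l → β l < β k
  two_mul_lt_one : 2 * β l < 1
  two_mul_lt_zero : 2 * β l < β 0

namespace IsDominant

variable {l : ℕ}

lemma pos (h : IsDominant Γ α β l) : 0 < β l := (h.memory.beta_mem l h.mem).1

lemma le (h : IsDominant Γ α β l) {k : ℕ} (hk : k ∈ activeMultipoles Γ) : β l ≤ β k := by
  rcases eq_or_ne k l with rfl | hne
  · exact le_rfl
  · exact (h.lt_of_ne k hk hne).le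

/-- A common kernel for all `k`, active or not: it is the domination needed to pass to the limit in
the Parseval series. Inactive coefficients vanish at every lag since `|C_k(τ)| ≤ C_k(0)`. -/
lemma eventually_abs_coeffC_le (h : IsDominant Γ α β l)
    (hC : ∀ k τ, |coeffC Γ k τ| ≤ coeffC Γ k 0) : ∀ᶠ τ in atTop, ∀ k,
      |coeffC Γ k τ| ≤ 2 * coeffC Γ k 0 * powerKernel (β l) τ := by
  have h0 : ∀ k, 0 ≤ coeffC Γ k 0 := fun k => (abs_nonneg _).trans (hC k 0)
  filter_upwards [h.memory.eventually_abs_coeffC_le h0] with τ hτ k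
  by_cases hk : k ∈ activeMultipoles Γ
  · exact (hτ k hk).trans (mul_le_mul_of_nonneg_left (powerKernel_anti (h.le hk) τ)
      (by linarith [h0 k]))
  · have hk0 : coeffC Γ k 0 = 0 := not_not.1 hk
    have := hC k τ
    rw [hk0] at this ⊢
    simpa using this

lemma tendsto_coeffC_sq (h : IsDominant Γ α β l) :
    Tendsto (fun τ => coeffC Γ l τ ^ 2 / powerKernel (2 * β l) τ) atTop (𝓝 (coeffC Γ l 0 ^ 2)) := by
  have := (h.memory.tendsto_coeffC_div h.mem (by linarith [h.two_mul_lt_one])).pow 2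
  simpa only [div_pow, powerKernel_sq] using this

lemma tendsto_coeffC_sq_of_ne (h : IsDominant Γ α β l)
    (hC : ∀ k τ, |coeffC Γ k τ| ≤ coeffC Γ k 0) {k : ℕ} (hk : k ≠ l) :
    Tendsto (fun τ => coeffC Γ k τ ^ 2 / powerKernel (2 * β l) τ) atTop (𝓝 0) := by
  have h0 : ∀ k, 0 ≤ coeffC Γ k 0 := fun k => (abs_nonneg _).trans (hC k 0)
  by_cases hka : k ∈ activeMultipoles Γ
  · have hlt := h.lt_of_ne k hka hk
    have ht := (tendsto_powerKernel (show 0 < 2 * β k - 2 * β l by linarith)).const_mul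
      ((2 * coeffC Γ k 0) ^ 2)
    rw [mul_zero] at ht
    refine squeeze_zero' (.of_forall fun τ => div_nonneg (sq_nonneg _) (powerKernel_pos _ _).le) ?_ ht
    filter_upwards [h.memory.eventually_abs_coeffC_le h0] with τ hτ
    rw [← powerKernel_div, ← mul_div_assoc, ← powerKernel_sq (β k), ← mul_pow]
    refine div_le_div_of_nonneg_right ?_ (powerKernel_pos _ _).le
    exact sq_le_sq.2 ((hτ k hka).trans (le_abs_self _))
  · have hk0 : coeffC Γ k 0 = 0 := not_not.1 hka
    have : ∀ τ, coeffC Γ k τ = 0 := fun τ => by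
      have := hC k τ
      rw [hk0] at this
      exact abs_nonpos_iff.1 this
    simp [this]

lemma tendsto_coeffC_zero (h : IsDominant Γ α β l)
    (hC : ∀ k τ, |coeffC Γ k τ| ≤ coeffC Γ k 0) :
    Tendsto (fun τ => coeffC Γ 0 τ / powerKernel (2 * β l) τ) atTop (𝓝 0) := by
  have h0 : ∀ k, 0 ≤ coeffC Γ k 0 := fun k => (abs_nonneg _).trans (hC k 0)
  have ht := (tendsto_powerKernel (show 0 < β 0 - 2 * β l by linarith [h.two_mul_lt_zero])).const_mul
    (2 * coeffC Γ 0 0)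
  rw [mul_zero] at ht
  refine squeeze_zero_norm' ?_ ht
  filter_upwards [h.memory.eventually_abs_coeffC_le h0] with τ hτ
  rw [norm_div, Real.norm_eq_abs, Real.norm_of_nonneg (powerKernel_pos _ _).le, ← powerKernel_div,
    ← mul_div_assoc]
  exact div_le_div_of_nonneg_right (hτ 0 h.memory.zero_mem) (powerKernel_pos _ _).le

/-- The second moment is dominated by the multipole with the smallest exponent. -/
lemma tendsto_tsum_coeffC_sq (h : IsDominant Γ α β l)
    (hC : ∀ k τ, |coeffC Γ k τ| ≤ coeffC Γ k 0)
    (hs : Summable fun k : ℕ => (2 * (k : ℝ) + 1) * coeffC Γ k 0 ^ 2) :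
    Tendsto (fun τ => (∑' k : ℕ, (2 * (k : ℝ) + 1) * coeffC Γ k τ ^ 2) / powerKernel (2 * β l) τ)
      atTop (𝓝 ((2 * l + 1) * coeffC Γ l 0 ^ 2)) := by
  have hsum : ∑' k : ℕ, (if k = l then (2 * (l : ℝ) + 1) * coeffC Γ l 0 ^ 2 else 0) =
      (2 * l + 1) * coeffC Γ l 0 ^ 2 := tsum_ite_eq l _
  rw [← hsum]
  simp_rw [← tsum_div_const]
  -- The dominating series is `4 (2k+1) C_k(0)²`, summable by Parseval at lag `0`.
  refine tendsto_tsum_of_dominated_convergence (hs.mul_left 4) (fun k => ?_) ?_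
  · simp_rw [mul_div_assoc]
    split_ifs with hk
    · subst hk
      exact h.tendsto_coeffC_sq.const_mul _
    · simpa using (h.tendsto_coeffC_sq_of_ne hC hk).const_mul (2 * (k : ℝ) + 1)
  · filter_upwards [h.eventually_abs_coeffC_le hC] with τ hτ k
    have hp := powerKernel_pos (2 * β l) τ
    rw [Real.norm_of_nonneg (by positivity), div_le_iff₀ hp, ← powerKernel_sq]
    have h1 : coeffC Γ k τ ^ 2 ≤ (2 * coeffC Γ k 0 * powerKernel (β l) τ) ^ 2 :=
      sq_le_sq.2 ((hτ k).trans (le_abs_self _))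
    calc _ ≤ (2 * (k : ℝ) + 1) * (2 * coeffC Γ k 0 * powerKernel (β l) τ) ^ 2 :=
          mul_le_mul_of_nonneg_left h1 (by positivity)
      _ = _ := by ring

end IsDominant

end Coefficients

/-! ### Parseval for the covariance and negligibility of the third moment -/

section Moments

/-- Parseval's identity for the covariance function. -/
lemma hasSum_coeffC_sq {Γ : ℝ → ℝ → ℝ} {τ : ℝ}
    (hΓ : ContinuousOn (fun θ => Γ θ τ) (Set.Icc (-1) 1)) :
    HasSum (fun k : ℕ => (2 * (k : ℝ) + 1) * coeffC Γ k τ ^ 2)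
      (8 * Real.pi ^ 2 * ∫ θ in (-1 : ℝ)..1, Γ θ τ ^ 2) := by
  have h := (hasSum_legendre_sq hΓ).mul_left (8 * Real.pi ^ 2)
  refine h.congr_fun fun k => ?_
  simp only [coeffC]
  ring

lemma exists_abs_legendre_le (k : ℕ) : ∃ B, 0 ≤ B ∧ ∀ θ ∈ Set.Icc (-1 : ℝ) 1,
    |(legendre k).eval θ| ≤ B := by
  obtain ⟨B, hB⟩ := (isCompact_Icc (a := (-1 : ℝ)) (b := 1)).exists_bound_of_continuousOn
    (legendre k).continuous.continuousOn
  exact ⟨B, (norm_nonneg _).trans (hB 0 (by norm_num)), hB⟩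

/-- The partial sum of the Legendre expansion. -/
noncomputable def legendrePartialSum (f : ℝ → ℝ) (L : ℕ) (θ : ℝ) : ℝ :=
  ∑ k ∈ Finset.range L, (2 * (k : ℝ) + 1) / 2 * (∫ s in (-1 : ℝ)..1, f s * (legendre k).eval s) *
    (legendre k).eval θ

lemma continuous_legendrePartialSum (f : ℝ → ℝ) (L : ℕ) : Continuous (legendrePartialSum f L) :=
  continuous_finsetSum _ fun k _ => continuous_const.mul (legendre k).continuous

lemma integral_sub_legendrePartialSum_mul {f : ℝ → ℝ} (hf : ContinuousOn f (Set.Icc (-1) 1))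
    (L k : ℕ) :
    ∫ θ in (-1 : ℝ)..1, (f θ - legendrePartialSum f L θ) * (legendre k).eval θ =
      if k < L then 0 else ∫ θ in (-1 : ℝ)..1, f θ * (legendre k).eval θ := by
  have hi : IntervalIntegrable (fun θ => f θ * (legendre k).eval θ) volume (-1) 1 :=
    ContinuousOn.intervalIntegrable_of_Icc (by norm_num)
      (hf.mul (legendre k).continuous.continuousOn)
  have hj : IntervalIntegrable (fun θ => legendrePartialSum f L θ * (legendre k).eval θ) volume
      (-1) 1 :=
    ((continuous_legendrePartialSum f L).mul (legendre k).continuous).intervalIntegrable _ _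
  simp_rw [sub_mul]
  rw [intervalIntegral.integral_sub hi hj]
  have h2 : ∫ θ in (-1 : ℝ)..1, legendrePartialSum f L θ * (legendre k).eval θ =
      if k < L then ∫ θ in (-1 : ℝ)..1, f θ * (legendre k).eval θ else 0 := by
    simp only [legendrePartialSum, Finset.sum_mul, mul_assoc]
    have hn (n : ℕ) (_ : n ∈ Finset.range L) : IntervalIntegrable (fun θ =>
        (2 * (n : ℝ) + 1) / 2 * ((∫ s in (-1 : ℝ)..1, f s * (legendre n).eval s) *
          ((legendre n).eval θ * (legendre k).eval θ))) volume (-1) 1 :=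
      (continuous_const.mul (continuous_const.mul
        ((legendre n).continuous.mul (legendre k).continuous))).intervalIntegrable _ _
    rw [intervalIntegral.integral_finsetSum hn]
    simp_rw [intervalIntegral.integral_const_mul, integral_legendre_mul_legendre, mul_ite, mul_zero]
    rw [Finset.sum_ite_eq' (Finset.range L) k]
    simp only [Finset.mem_range]
    refine if_congr Iff.rfl ?_ rfl
    field_simp
  rw [h2]
  split_ifs <;> simp

/-- Parseval for the difference, whose Legendre coefficients of index below `L` vanish while the
others are those of `f`. -/
lemma integral_sq_sub_legendrePartialSum {f : ℝ → ℝ} (hf : ContinuousOn f (Set.Icc (-1) 1))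
    (L : ℕ) :
    ∫ θ in (-1 : ℝ)..1, (f θ - legendrePartialSum f L θ) ^ 2 = ∑' k : ℕ,
      (2 * ((k + L : ℕ) : ℝ) + 1) / 2 * (∫ θ in (-1 : ℝ)..1, f θ * (legendre (k + L)).eval θ) ^ 2 := by
  have h := hasSum_legendre_sq (f := fun θ => f θ - legendrePartialSum f L θ) (hf.sub (continuous_legendrePartialSum f L).continuousOn)
  simp_rw [integral_sub_legendrePartialSum_mul hf] at h
  rw [← h.tsum_eq, ← h.summable.sum_add_tsum_nat_add L, Finset.sum_eq_zero, zero_add]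
  · simp
  · intro k hk
    simp [Finset.mem_range.1 hk]

/-- With `y` a finite head of the expansion and `x - y` its tail: one factor of `|x|³` is split as
`|y| + |x - y|`, and Young's inequality moves the cross term onto the two squares. -/
lemma abs_cube_le {x y S η : ℝ} (hη : 0 < η) (hx : |x| ≤ 1) (hy : |y| ≤ S) :
    |x| ^ 3 ≤ (S + η) * x ^ 2 + (4 * η)⁻¹ * (x - y) ^ 2 := by
  have h1 : |x| ≤ |y| + |x - y| := by simpa using abs_add_le y (x - y)
  have hx2 : |x| ^ 2 = x ^ 2 := sq_abs x
  have h2 : |x - y| ^ 2 = (x - y) ^ 2 := sq_abs _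
  have h3 : |x| * |x - y| ≤ η * x ^ 2 + (4 * η)⁻¹ * (x - y) ^ 2 := by
    rw [← hx2, ← h2]
    have h4 : 0 ≤ η * (|x| - (2 * η)⁻¹ * |x - y|) ^ 2 := by positivity
    have h5 : η * (|x| - (2 * η)⁻¹ * |x - y|) ^ 2 =
        η * |x| ^ 2 + (4 * η)⁻¹ * |x - y| ^ 2 - |x| * |x - y| := by
      field_simp
      ring
    linarith
  have h6 : |x| ^ 2 * |x - y| ≤ |x| * |x - y| := by
    refine mul_le_mul_of_nonneg_right ?_ (abs_nonneg _)
    nlinarith [abs_nonneg x]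
  calc |x| ^ 3 = |x| ^ 2 * |x| := by ring
    _ ≤ |x| ^ 2 * (|y| + |x - y|) := mul_le_mul_of_nonneg_left h1 (by positivity)
    _ ≤ |x| ^ 2 * S + |x| * |x - y| := by
        rw [mul_add]
        exact add_le_add (mul_le_mul_of_nonneg_left hy (by positivity)) h6
    _ ≤ _ := by rw [hx2]; linarith

lemma integral_abs_cube_le {f : ℝ → ℝ} (hf : ContinuousOn f (Set.Icc (-1) 1))
    (h1 : ∀ θ ∈ Set.Icc (-1 : ℝ) 1, |f θ| ≤ 1) (L : ℕ) {S η : ℝ} (hη : 0 < η)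
    (hS : ∀ θ ∈ Set.Icc (-1 : ℝ) 1, |legendrePartialSum f L θ| ≤ S) :
    ∫ θ in (-1 : ℝ)..1, |f θ| ^ 3 ≤ (S + η) * (∫ θ in (-1 : ℝ)..1, f θ ^ 2) +
      (4 * η)⁻¹ * ∫ θ in (-1 : ℝ)..1, (f θ - legendrePartialSum f L θ) ^ 2 := by
  have i1 : IntervalIntegrable (fun θ => (S + η) * f θ ^ 2) volume (-1) 1 :=
    ContinuousOn.intervalIntegrable_of_Icc (by norm_num) (continuousOn_const.mul (hf.pow 2))
  have i2 : IntervalIntegrable (fun θ => (4 * η)⁻¹ * (f θ - legendrePartialSum f L θ) ^ 2)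
      volume (-1) 1 :=
    ContinuousOn.intervalIntegrable_of_Icc (by norm_num) (continuousOn_const.mul
      ((hf.sub (continuous_legendrePartialSum f L).continuousOn).pow 2))
  have i3 : IntervalIntegrable (fun θ => |f θ| ^ 3) volume (-1) 1 :=
    ContinuousOn.intervalIntegrable_of_Icc (by norm_num) (hf.abs.pow 3)
  rw [← intervalIntegral.integral_const_mul, ← intervalIntegral.integral_const_mul,
    ← intervalIntegral.integral_add i1 i2]
  exact intervalIntegral.integral_mono_on (by norm_num) i3 (i1.add i2) fun θ hθ =>
    abs_cube_le hη (h1 θ hθ) (hS θ hθ)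

/-- The choice of `η` makes both contributions equal to `ε w / 4`: `2 η (D + 1) = ε / 4` for the
second moment, and the tail bound `η ε w` is divided by `4 η`. -/
lemma mul_lt_of_three_bounds {c A X Y w η ε D : ℝ} (hε : 0 < ε) (hD : 0 ≤ D) (hw : 0 < w)
    (hη : η = ε / (8 * (D + 1))) (hA : c * A ≤ c * ((η + η) * X + (4 * η)⁻¹ * Y))
    (hX : c * X < (D + 1) * w) (hY : c * Y ≤ η * ε * w) : c * A < ε * w := by
  have hη0 : 0 < η := by rw [hη]; positivity
  have h2 := mul_le_mul_of_nonneg_left hX.le (show 0 ≤ 2 * η by positivity)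
  have h3 := mul_le_mul_of_nonneg_left hY (show 0 ≤ (4 * η)⁻¹ by positivity)
  have h4 : 2 * η * ((D + 1) * w) = ε / 4 * w := by
    rw [hη]
    field_simp
    ring
  have h5 : (4 * η)⁻¹ * (η * ε * w) = ε / 4 * w := by field_simp
  have h6 : 0 < ε * w := by positivity
  linarith

/-- The third absolute moment is negligible with respect to the second moment. -/
lemma IsDominant.tendsto_integral_abs_cube {Γ : ℝ → ℝ → ℝ} {α : ℝ} {β : ℕ → ℝ} {l : ℕ}
    (h : IsDominant Γ α β l) (hC : ∀ k τ, |coeffC Γ k τ| ≤ coeffC Γ k 0)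
    (hΓ : ∀ τ, ContinuousOn (fun θ => Γ θ τ) (Set.Icc (-1) 1))
    (h1 : ∀ τ, ∀ θ ∈ Set.Icc (-1 : ℝ) 1, |Γ θ τ| ≤ 1) :
    Tendsto (fun τ => (8 * Real.pi ^ 2 * ∫ θ in (-1 : ℝ)..1, |Γ θ τ| ^ 3) / powerKernel (2 * β l) τ)
      atTop (𝓝 0) := by
  have hs := (hasSum_coeffC_sq (hΓ 0)).summable
  have hD := h.tendsto_tsum_coeffC_sq hC hs
  set D := (2 * (l : ℝ) + 1) * coeffC Γ l 0 ^ 2 with hD0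
  have hDn : 0 ≤ D := by positivity
  choose B hB0 hB using exists_abs_legendre_le
  have hC0 : ∀ k, Tendsto (fun τ => coeffC Γ k τ) atTop (𝓝 0) := fun k => by
    have ht := (tendsto_powerKernel h.pos).const_mul (2 * coeffC Γ k 0)
    rw [mul_zero] at ht
    refine squeeze_zero_norm' ?_ ht
    filter_upwards [h.eventually_abs_coeffC_le hC] with τ hτ using hτ k
  have hI : ∀ k, Tendsto (fun τ => ∫ θ in (-1 : ℝ)..1, Γ θ τ * (legendre k).eval θ) atTop (𝓝 0) :=
    fun k => by
    have := (hC0 k).const_mul (2 * Real.pi)⁻¹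
    rw [mul_zero] at this
    refine this.congr fun τ => ?_
    rw [coeffC, inv_mul_cancel_left₀ (by positivity)]
  rw [Metric.tendsto_nhds]
  intro ε hε
  set η := ε / (8 * (D + 1)) with hη
  have hη0 : 0 < η := by positivity
  -- The cut-off is chosen from lag `0` alone: the uniform bound on `|C_k(τ)|` costs a factor `4`
  -- after squaring, so the tail is below `η ε` times the kernel at every large lag.
  obtain ⟨L, hL⟩ := ((tendsto_sum_nat_add fun k : ℕ => (2 * (k : ℝ) + 1) * coeffC Γ k 0 ^ 2)
    |>.eventually_lt_const (show 0 < η * ε / 4 by positivity)).exists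
  -- The head has finitely many terms, each with coefficient tending to `0`, so it is uniformly
  -- small on `[-1, 1]`.
  have hS : Tendsto (fun τ => ∑ k ∈ Finset.range L, (2 * (k : ℝ) + 1) / 2 *
      |∫ θ in (-1 : ℝ)..1, Γ θ τ * (legendre k).eval θ| * B k) atTop (𝓝 0) := by
    have := tendsto_finsetSum (Finset.range L) fun k _ =>
      ((hI k).abs.const_mul ((2 * (k : ℝ) + 1) / 2)).mul_const (B k)
    simpa using this
  filter_upwards [hS.eventually_lt_const hη0, hD.eventually_lt_const (lt_add_one D),
    h.eventually_abs_coeffC_le hC] with τ hSτ hDτ hCτ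
  have hp := powerKernel_pos (2 * β l) τ
  rw [div_lt_iff₀ hp] at hDτ
  have hcube := integral_abs_cube_le (hΓ τ) (h1 τ) L (S := η) hη0 fun θ hθ => by
    refine le_trans ((Finset.abs_sum_le_sum_abs _ _).trans (Finset.sum_le_sum fun k _ => ?_)) hSτ.le
    rw [abs_mul, abs_mul, abs_of_nonneg (show (0 : ℝ) ≤ (2 * (k : ℝ) + 1) / 2 by positivity)]
    exact mul_le_mul_of_nonneg_left (hB k θ hθ) (by positivity)
  have hnn : 0 ≤ ∫ θ in (-1 : ℝ)..1, |Γ θ τ| ^ 3 :=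
    intervalIntegral.integral_nonneg (by norm_num) fun _ _ => by positivity
  have htail : 8 * Real.pi ^ 2 *
      ∫ θ in (-1 : ℝ)..1, (Γ θ τ - legendrePartialSum (fun θ => Γ θ τ) L θ) ^ 2 ≤
      η * ε * powerKernel (2 * β l) τ := by
    have hsL : Summable fun k : ℕ => (2 * ((k + L : ℕ) : ℝ) + 1) * coeffC Γ (k + L) 0 ^ 2 :=
      (summable_nat_add_iff L).2 hs
    rw [integral_sq_sub_legendrePartialSum (hΓ τ), ← tsum_mul_left]
    calc _ = ∑' k : ℕ, (2 * ((k + L : ℕ) : ℝ) + 1) * coeffC Γ (k + L) τ ^ 2 :=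
          tsum_congr fun k => by simp only [coeffC]; ring
      _ ≤ ∑' k : ℕ, 4 * powerKernel (2 * β l) τ *
            ((2 * ((k + L : ℕ) : ℝ) + 1) * coeffC Γ (k + L) 0 ^ 2) := by
          refine Summable.tsum_le_tsum (fun k => ?_)
            ((summable_nat_add_iff L).2 (hasSum_coeffC_sq (hΓ τ)).summable) (hsL.mul_left _)
          have h2 : coeffC Γ (k + L) τ ^ 2 ≤
              (2 * coeffC Γ (k + L) 0 * powerKernel (β l) τ) ^ 2 :=
            sq_le_sq.2 ((hCτ (k + L)).trans (le_abs_self _))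
          rw [← powerKernel_sq]
          calc _ ≤ _ := mul_le_mul_of_nonneg_left h2
                (show (0 : ℝ) ≤ 2 * ((k + L : ℕ) : ℝ) + 1 by positivity)
            _ = _ := by ring
      _ = 4 * powerKernel (2 * β l) τ *
            ∑' k : ℕ, (2 * ((k + L : ℕ) : ℝ) + 1) * coeffC Γ (k + L) 0 ^ 2 := tsum_mul_left
      _ ≤ 4 * powerKernel (2 * β l) τ * (η * ε / 4) :=
          mul_le_mul_of_nonneg_left hL.le (by positivity)
      _ = _ := by ring
  rw [dist_zero_right, Real.norm_of_nonneg (by positivity), div_lt_iff₀ hp]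
  rw [(hasSum_coeffC_sq (hΓ τ)).tsum_eq] at hDτ
  exact mul_lt_of_three_bounds hε hDn hp hη
    (mul_le_mul_of_nonneg_left hcube (show 0 ≤ 8 * Real.pi ^ 2 by positivity)) hDτ htail

end Moments

/-! ### Asymptotic variances and the limit of the correlation -/

section Limit

variable {Ω : Type*} [MeasurableSpace Ω] {P : Measure Ω}
  {Z : S2 → ℝ → Ω → ℝ} {Γ : ℝ → ℝ → ℝ} {α : ℝ} {β : ℕ → ℝ} {l : ℕ}

namespace IsIsotropicStationaryGaussian

/-- The memory condition concerns `τ → +∞` only; evenness carries its consequences to negative lags.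
-/
lemma cov_abs (hZ : IsIsotropicStationaryGaussian P Z Γ) {θ : ℝ} (hθ : θ ∈ Set.Icc (-1 : ℝ) 1)
    (τ : ℝ) : Γ θ |τ| = Γ θ τ := by
  rcases abs_choice τ with h | h <;> rw [h]
  exact hZ.cov_neg hθ τ

lemma coeffC_abs (hZ : IsIsotropicStationaryGaussian P Z Γ) (k : ℕ) (τ : ℝ) :
    coeffC Γ k |τ| = coeffC Γ k τ := by
  rcases abs_choice τ with h | h <;> rw [h]
  exact hZ.coeffC_neg k τ

lemma integral_comp_cov_abs (hZ : IsIsotropicStationaryGaussian P Z Γ) (f : ℝ → ℝ) (τ : ℝ) :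
    ∫ θ in (-1 : ℝ)..1, f (Γ θ |τ|) = ∫ θ in (-1 : ℝ)..1, f (Γ θ τ) := by
  refine intervalIntegral.integral_congr fun θ hθ => ?_
  rw [Set.uIcc_of_le (by norm_num)] at hθ
  simp only [hZ.cov_abs hθ]

variable [IsProbabilityMeasure P]

/-- Measurability in the two times is inherited, through Fubini, from the representation of `C_l` as
a covariance of `a_{l,0}`. -/
lemma integrable_coeffC_sq (hZ : IsIsotropicStationaryGaussian P Z Γ)
    (hvar : ∀ x t, ∫ ω, Z x t ω ^ 2 ∂P = 1) (l : ℕ) (T : ℝ) :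
    Integrable (fun p : ℝ × ℝ => coeffC Γ l (p.1 - p.2) ^ 2) ((window T).prod (window T)) := by
  have hL := hZ.isL2Bounded_harmCoeff hvar l 0
  have h := hL.integrable_integral_mul hL (μ := window T) (ν := window T)
  have e : ∀ p : ℝ × ℝ, ∫ ω, harmCoeff Z l 0 p.1 ω * harmCoeff Z l 0 p.2 ω ∂P =
      coeffC Γ l (p.1 - p.2) := fun p => by
    rw [hZ.integral_harmCoeff_mul_harmCoeff hvar (Nat.zero_le l) (Nat.zero_le l), if_pos rfl]
  simp_rw [e] at h
  refine Integrable.of_bound (h.aestronglyMeasurable.pow 2) (coeffC Γ l 0 ^ 2)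
    (.of_forall fun p => ?_)
  rw [Real.norm_of_nonneg (sq_nonneg _)]
  exact sq_le_sq.2 ((hZ.abs_coeffC_le hvar l _).trans (le_abs_self _))

lemma tendsto_sqCoeffIntegral (hZ : IsIsotropicStationaryGaussian P Z Γ)
    (hvar : ∀ x t, ∫ ω, Z x t ω ^ 2 ∂P = 1) (h : IsDominant Γ α β l) :
    Tendsto (fun T => sqCoeffIntegral Γ l T / powerKernelIntegral (2 * β l) T) atTop
      (𝓝 (coeffC Γ l 0 ^ 2)) := by
  refine tendsto_integral_div_powerKernelIntegral (by linarith [h.pos]) h.two_mul_lt_one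
    (M := coeffC Γ l 0 ^ 2) (fun T => hZ.integrable_coeffC_sq hvar l T) (fun p => ?_) fun ε hε => ?_
  · rw [abs_of_nonneg (sq_nonneg _)]
    exact sq_le_sq.2 ((hZ.abs_coeffC_le hvar l _).trans (le_abs_self _))
  · obtain ⟨τ, hτ⟩ := (((Metric.tendsto_nhds.1 h.tendsto_coeffC_sq) ε hε).and
      (eventually_ge_atTop 0)).exists_forall_of_atTop
    refine ⟨τ, (hτ τ le_rfl).2, fun p hp => ?_⟩
    have hk := powerKernel_pos (2 * β l) (p.1 - p.2)
    have h1 := (hτ _ hp).1.le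
    rw [hZ.coeffC_abs, show powerKernel (2 * β l) |p.1 - p.2| = powerKernel (2 * β l) (p.1 - p.2) by
      simp [powerKernel], Real.dist_eq, div_sub' hk.ne', abs_div, abs_of_pos hk, div_le_iff₀ hk] at h1
    rwa [mul_comm (coeffC Γ l 0 ^ 2)]

lemma exists_abs_integral_centredArea_le (hZ : IsIsotropicStationaryGaussian P Z Γ) (u : ℝ) :
    ∃ M, ∀ p : ℝ × ℝ, |∫ ω, centredArea Z u p.1 ω * centredArea Z u p.2 ω ∂P| ≤ M := by
  have hL := hZ.isL2Bounded_centredArea u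
  obtain ⟨M, hM⟩ := hL.exists_integral_abs_mul_le hL
  exact ⟨M, fun p => abs_integral_le_integral_abs.trans (hM p.1 p.2)⟩

/-- The excursion covariance is asymptotic to the quadratic contribution of the single multipole
`l`; the remaining terms of the expansion are small on the scale of the kernel, and the kernel
comparison transfers this to the double integral. -/
lemma tendsto_variance_totalArea (hZ : IsIsotropicStationaryGaussian P Z Γ)
    (hvar : ∀ x t, ∫ ω, Z x t ω ^ 2 ∂P = 1) (h : IsDominant Γ α β l) (u : ℝ) :
    Tendsto (fun T => (∫ p : ℝ × ℝ, (∫ ω, centredArea Z u p.1 ω * centredArea Z u p.2 ω ∂P)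
        ∂((window T).prod (window T))) / powerKernelIntegral (2 * β l) T) atTop
      (𝓝 (u ^ 2 * gaussianPDFReal 0 1 u ^ 2 / 2 * ((2 * l + 1) * coeffC Γ l 0 ^ 2))) := by
  obtain ⟨M, hM⟩ := hZ.exists_abs_integral_centredArea_le u
  refine tendsto_integral_div_powerKernelIntegral (by linarith [h.pos]) h.two_mul_lt_one
    (M := M) (fun T => hZ.integrable_integral_centredArea u T) hM fun ε hε => ?_
  set D := (2 * (l : ℝ) + 1) * coeffC Γ l 0 ^ 2 with hD
  have hD0 : 0 ≤ D := by positivity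
  set a := gaussianPDFReal 0 1 u ^ 2 with ha
  have ha0 : 0 ≤ a := sq_nonneg _
  set c := u ^ 2 * a / 2 with hc
  have hc0 : 0 ≤ c := by positivity
  -- The quadratic remainder tends, relative to the kernel, to its coefficient times `D`; this
  -- coefficient makes that limit less than `ε`, including when `D` is close to `0`.
  have hε1 : 0 < ε / (2 * (D + 1)) := by positivity
  obtain ⟨C, hC0, hC⟩ := hZ.exists_centredArea_expansion hvar u hε1
  have hb := hZ.abs_coeffC_le hvar
  have h1 := h.tendsto_coeffC_zero hb
  have h2 := h.tendsto_tsum_coeffC_sq hb (hasSum_coeffC_sq (hZ.continuousOn_left 0)).summable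
  simp_rw [fun τ => (hasSum_coeffC_sq (hZ.continuousOn_left τ)).tsum_eq] at h2
  rw [← hD] at h2
  have h3 := h.tendsto_integral_abs_cube hb hZ.continuousOn_left
    fun τ θ hθ => hZ.abs_cov_le_one hvar hθ τ
  have hF := ((((h1.abs.const_mul (a * (4 * Real.pi))).add
    ((h2.sub_const D).abs.const_mul c)).add (h2.const_mul (ε / (2 * (D + 1))))).add
    (h3.const_mul C))
  simp only [abs_zero, mul_zero, sub_self, zero_add, add_zero] at hF
  have hlt : ε / (2 * (D + 1)) * D < ε := by
    rw [div_mul_eq_mul_div, div_lt_iff₀ (by positivity)]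
    nlinarith
  obtain ⟨τ, hτ⟩ := ((hF.eventually_lt_const hlt).and (eventually_ge_atTop 0)).exists_forall_of_atTop
  refine ⟨τ, (hτ τ le_rfl).2, fun p hp => ?_⟩
  have hk := powerKernel_pos (2 * β l) (p.1 - p.2)
  have hp1 := (hτ _ hp).1.le
  have hC := hC p.1 p.2
  rw [hZ.coeffC_abs, hZ.integral_comp_cov_abs (fun x => x ^ 2),
    hZ.integral_comp_cov_abs (fun x => |x| ^ 3),
    show powerKernel (2 * β l) |p.1 - p.2| = powerKernel (2 * β l) (p.1 - p.2) by
      simp [powerKernel]] at hp1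
  generalize (∫ ω, centredArea Z u p.1 ω * centredArea Z u p.2 ω ∂P) = V at hC ⊢
  generalize powerKernel (2 * β l) (p.1 - p.2) = w at hp1 hk ⊢
  generalize (8 * Real.pi ^ 2 * ∫ θ in (-1 : ℝ)..1, Γ θ (p.1 - p.2) ^ 2) = X at hp1 hC
  generalize (8 * Real.pi ^ 2 * ∫ θ in (-1 : ℝ)..1, |Γ θ (p.1 - p.2)| ^ 3) = Y at hp1 hC
  generalize coeffC Γ 0 (p.1 - p.2) = q at hp1 hC
  have e1 : |V - c * D * w| ≤ |V - a * (4 * Real.pi * q) - c * X| + a * (4 * Real.pi) * |q| +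
      c * |X - D * w| := by
    have : V - c * D * w = (V - a * (4 * Real.pi * q) - c * X) + a * (4 * Real.pi) * q +
      c * (X - D * w) := by ring
    rw [this]
    refine (abs_add_three _ _ _).trans (le_of_eq ?_)
    rw [abs_mul (a * (4 * Real.pi)), abs_mul c, abs_of_nonneg hc0,
      abs_of_nonneg (show 0 ≤ a * (4 * Real.pi) by positivity)]
  have e2 : (a * (4 * Real.pi) * |q / w| + c * |X / w - D| + ε / (2 * (D + 1)) * (X / w) +
      C * (Y / w)) * w = a * (4 * Real.pi) * |q| + c * |X - D * w| + ε / (2 * (D + 1)) * X +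
      C * Y := by
    rw [div_sub' hk.ne', abs_div, abs_div, abs_of_pos hk, mul_comm w D]
    field_simp
  have e3 := mul_le_mul_of_nonneg_right hp1 hk.le
  rw [e2] at e3
  linarith

/-- The excursion functional and its projection on the dominant multipole are asymptotically fully
correlated. -/
lemma tendsto_corr (hZ : IsIsotropicStationaryGaussian P Z Γ)
    (hvar : ∀ x t, ∫ ω, Z x t ω ^ 2 ∂P = 1) (h : IsDominant Γ α β l) {u : ℝ} (hu : u ≠ 0) :
    Tendsto (fun T : ℝ => corr P (excursionFunctional P Z u T) (monoFunctional Z Γ l u T))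
      atTop (𝓝 1) := by
  set N := u ^ 2 * gaussianPDFReal 0 1 u ^ 2 / 2 * (2 * (l : ℝ) + 1) with hN
  have hN0 : 0 < N := by
    have := gaussianPDFReal_pos 0 1 u one_ne_zero
    positivity
  have hC0 : coeffC Γ l 0 ≠ 0 := h.mem
  have hJ := (hZ.tendsto_sqCoeffIntegral hvar h).const_mul N
  have hV := hZ.tendsto_variance_totalArea hvar h u
  rw [← mul_assoc, ← hN] at hV
  have hne : N * coeffC Γ l 0 ^ 2 ≠ 0 := mul_ne_zero hN0.ne' (pow_ne_zero 2 hC0)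
  have hlim := (hJ.div hV hne).sqrt
  rw [div_self hne, Real.sqrt_one] at hlim
  refine hlim.congr' ?_
  filter_upwards [eventually_gt_atTop 0] with T hT
  have hH : powerKernelIntegral (2 * β l) T ≠ 0 := by
    refine (lt_of_lt_of_le ?_ (le_powerKernelIntegral (by linarith [h.pos]) hT.le)).ne'
    positivity
  rw [hZ.corr_eq hvar hC0 hT.le hu, Pi.div_apply, ← mul_div_assoc, div_div_div_cancel_right₀ hH]

end IsIsotropicStationaryGaussian

end Limit

end SphereTime

theorem mainTheorem5 {Ω : Type*} [MeasurableSpace Ω] (P : Measure Ω) [IsProbabilityMeasure P]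
    (Z : SphereTime.S2 → ℝ → Ω → ℝ) (Γ : ℝ → ℝ → ℝ)
    (hZ : SphereTime.IsIsotropicStationaryGaussian P Z Γ)
    (hvar : ∀ x t, ∫ ω, Z x t ω ^ 2 ∂P = 1)
    (α : ℝ) (β : ℕ → ℝ) (hmem : SphereTime.MemoryCondition Γ α β)
    (ℓstar : ℕ) (hstar : ℓstar ∈ SphereTime.activeMultipoles Γ) (hstar_pos : 1 ≤ ℓstar)
    (hmin : ∀ ℓ ∈ SphereTime.activeMultipoles Γ, 1 ≤ ℓ → ℓ ≠ ℓstar → β ℓstar < β ℓ)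
    (u : ℝ) (hu : u ≠ 0) (hβ : 2 * β ℓstar < min (β 0) 1) :
    Tendsto
      (fun T : ℝ => SphereTime.corr P (SphereTime.excursionFunctional P Z u T)
        (SphereTime.monoFunctional Z Γ ℓstar u T))
      atTop (𝓝 1) := by
  have h0 : 2 * β ℓstar < β 0 := hβ.trans_le (min_le_left _ _)
  have h1 : 2 * β ℓstar < 1 := hβ.trans_le (min_le_right _ _)
  have hpos : 0 < β ℓstar := (hmem.beta_mem ℓstar hstar).1
  refine hZ.tendsto_corr hvar (α := α) (β := β) ⟨hmem, hstar, fun k hk hne => ?_, h1, h0⟩ hu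
  -- The minimum is taken over multipoles `≥ 1` only; for `k = 0` the strict inequality follows from
  -- `2 β_{ℓ⋆} < β_0` and `β_{ℓ⋆} > 0`.
  rcases Nat.eq_zero_or_pos k with rfl | hk0
  · linarith
  · exact hmin k hk hk0 hne
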